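/- Let $X$ be a complex manifold (Hausdorff and second countable) and let $D\subset X$ be a smooth hypersurface, i.e. a closed complex submanifold of codimension one (possibly empty). A local equation for $D$ on an open set $V\subset X$ is a holomorphic function $f$ on $V$ which generates the ideal, in the sheaf $\mathcal O_V$ of holomorphic functions on $V$, of functions vanishing on $D\cap V$. For $p\ge 0$ and $U\subset X$ open, let - $\mathcal A_X^{p,0}(*D)(U)$ be the space of smooth ($C^\infty$) $(p,0)$-forms $\alpha$ on $U\smallsetminus D$ such that near every point of $U\cap D$ there are a local equation $f$ for $D$ and an integer $m\ge 0$ for which $f^m\alpha$ extends smoothly across $D$; - $\mathcal A_X^{p,0}\langle D\rangle(U)$ be the space of smooth $(p,0)$-forms $\alpha$ on $U\smallsetminus D$ such that for every local equation $f$ for $D$ on an open set $V\subset U$, both $f\alpha$ and $df\wedge\alpha$ extend smoothly to $V$. These define sheaves of complex vector spaces on $X$. With $\partial$, the $(1,0)$-part of the exterior derivative, they form complexes of sheaves, and $\mathcal A_X^{\bullet,0}\langle D\rangle$ is a subcomplex of $\mathcal A_X^{\bullet,0}(*D)$. **Proposition 2.1.** The inclusion $$(\mathcal A_X^{\bullet,0}\langle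 D\rangle,\partial)\longrightarrow(\mathcal A_X^{\bullet,0}(*D),\partial)$$ is a quasi-isomorphism of complexes of sheaves of complex vector spaces on $X$. Moreover, for every open set $U\subset X$ (in particular for $U=X$), the induced inclusion $$(\Gamma_c(U,\mathcal A_X^{\bullet,0}\langle D\rangle),\partial)\longrightarrow(\Gamma_c(U,\mathcal A_X^{\bullet,0}(*D)),\partial)$$ of complexes of sections with compact support is a quasi-isomorphism. Here a section $\alpha$ on $U$ has compact support if the closure in $X$ of the set of points of $U\smallsetminus D$ at which $\alpha$ does not vanish is a compact subset of $U$ (it may meet $D$). -/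

import Mathlib

open scoped Manifold ContDiff

namespace DolbeaultLog

open Set Filter Topology

section LocalCalculus

variable {E F : Type*} [NormedAddCommGroup E] [NormedSpace ℂ E]
  [NormedAddCommGroup F] [NormedSpace ℂ F]

/-- The complex-linear part `v ↦ (L v - i L (i v)) / 2` of a real-linear map `L`. -/
noncomputable def linPart (L : E →L[ℝ] F) : E →L[ℂ] F where
  toFun v := (1 / 2 : ℂ) • (L v - Complex.I • L (Complex.I • v))
  map_add' v w := by simp only [map_add, smul_add, smul_sub]; abel
  map_smul' c v := by
    have key : ∀ u : E, L (c • u) = c.re • L u + c.im • L (Complex.I • u) := by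
      intro u
      have : c • u = c.re • u + c.im • (Complex.I • u) := by
        conv_lhs => rw [← Complex.re_add_im c]
        simp only [add_smul, mul_smul, Complex.coe_smul]
      rw [this, map_add, map_smul, map_smul]
    have h1 : Complex.I • Complex.I • v = -v := by rw [smul_smul]; simp
    rw [smul_comm Complex.I c v, key v, key (Complex.I • v), h1, map_neg, RingHom.id_apply]
    simp only [← Complex.coe_smul (E := F)]
    conv_rhs => rw [← Complex.re_add_im c]
    simp only [smul_sub, smul_add, smul_smul, smul_neg]
    match_scalars
    · ring_nf
    · ring_nf; simp only [Complex.I_sq]; ring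
  cont := by fun_prop

lemma linPart_apply (L : E →L[ℝ] F) (v : E) :
    linPart L v = (1 / 2 : ℂ) • (L v - Complex.I • L (Complex.I • v)) := rfl

variable (E F) in
/-- Taking the complex-linear part, as a continuous real-linear map. -/
noncomputable def linPartCLM : (E →L[ℝ] F) →L[ℝ] (E →L[ℂ] F) :=
  LinearMap.mkContinuous
    { toFun := linPart
      map_add' := fun L M => by
        ext v; simp only [linPart_apply, add_apply]; module
      map_smul' := fun c L => by
        ext v
        simp only [linPart_apply, smul_apply, RingHom.id_apply,
          ← Complex.coe_smul (E := F)]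
        module } 1 (by
    intro L
    refine ContinuousLinearMap.opNorm_le_bound _ (by positivity) fun v => ?_
    change ‖linPart L v‖ ≤ _
    rw [linPart_apply, norm_smul]
    have h1 := L.le_opNorm v
    have h2 := L.le_opNorm (Complex.I • v)
    rw [norm_smul, Complex.norm_I, one_mul] at h2
    have h3 := norm_sub_le (L v) (Complex.I • L (Complex.I • v))
    rw [norm_smul, Complex.norm_I, one_mul] at h3
    norm_num
    linarith)

@[simp] lemma linPartCLM_apply (L : E →L[ℝ] F) : linPartCLM E F L = linPart L := rfl

lemma linPart_restrictScalars (L : E →L[ℂ] F) : linPart (L.restrictScalars ℝ) = L := by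
  ext v
  simp only [linPart_apply, ContinuousLinearMap.coe_restrictScalars', map_smul, smul_smul,
    Complex.I_mul_I]
  module

lemma linPart_add (L M : E →L[ℝ] F) : linPart (L + M) = linPart L + linPart M :=
  map_add (linPartCLM E F) L M

/-- The operator `∂` on `(p, 0)`-forms on an open set of a complex vector space: alternatization
of the complex-linear part of the real derivative. -/
noncomputable def delLocal {p : ℕ} (η : E → E [⋀^Fin p]→L[ℂ] F) (y : E) :
    E [⋀^Fin (p + 1)]→L[ℂ] F :=
  .alternatizeUncurryFin (linPart (fderiv ℝ η y))

open ContinuousAlternatingMap (alternatizeUncurryFinCLM alternatizeUncurryFin_add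
  alternatizeUncurryFin_alternatizeUncurryFinCLM_comp_of_symmetric compContinuousLinearMapCLM
  alternatizeUncurryFin_fderivCompContinuousLinearMap_eq_zero alternatizeUncurryFin_apply
  toContinuousMultilinearMapCLM toContinuousMultilinearMapLI
  hasStrictFDerivAt_compContinuousLinearMap)

lemma delLocal_congr {p : ℕ} {η θ : E → E [⋀^Fin p]→L[ℂ] F} {y : E} (h : η =ᶠ[𝓝 y] θ) :
    delLocal η y = delLocal θ y := by
  rw [delLocal, delLocal, h.fderiv_eq]

lemma delLocal_contDiffAt {p : ℕ} {η : E → E [⋀^Fin p]→L[ℂ] F} {y : E}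
    (h : ContDiffAt ℝ ∞ η y) : ContDiffAt ℝ ∞ (delLocal η) y := by
  have h1 : ContDiffAt ℝ ∞ (fderiv ℝ η) y := h.fderiv_right (by simp)
  exact (((alternatizeUncurryFinCLM ℂ E F (n := p)).restrictScalars ℝ).comp
    (linPartCLM E (E [⋀^Fin p]→L[ℂ] F))).contDiff.contDiffAt.comp y h1

lemma delLocal_delLocal {p : ℕ} {η : E → E [⋀^Fin p]→L[ℂ] F} {y : E}
    (h : ContDiffAt ℝ ∞ η y) : delLocal (delLocal η) y = 0 := by
  have h1 : ContDiffAt ℝ ∞ (fderiv ℝ η) y := h.fderiv_right (by simp)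
  have hd : HasFDerivAt (fderiv ℝ η) (fderiv ℝ (fderiv ℝ η) y) y :=
    (h1.differentiableAt (by simp)).hasFDerivAt
  have hsymm : IsSymmSndFDerivAt ℝ η y :=
    h.isSymmSndFDerivAt (by simpa using ENat.LEInfty.out)
  set B := fderiv ℝ (fderiv ℝ η) y with hB
  let T := (linPartCLM E (E [⋀^Fin p]→L[ℂ] F))
  let A := ((alternatizeUncurryFinCLM ℂ E F (n := p)).restrictScalars ℝ).comp T
  have hA : HasFDerivAt (delLocal η) (A.comp B) y := A.hasFDerivAt.comp y hd
  rw [delLocal, hA.fderiv]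
  let C : E →L[ℂ] E →L[ℂ] E [⋀^Fin p]→L[ℂ] F := linPart (T.comp B)
  have hC : linPart (A.comp B) = (alternatizeUncurryFinCLM ℂ E F (n := p)).comp C := by
    ext1 v
    simp only [linPart_apply, ContinuousLinearMap.comp_apply, C, map_smul, map_sub, A]
    rfl
  rw [hC]
  apply alternatizeUncurryFin_alternatizeUncurryFinCLM_comp_of_symmetric
  intro v w
  have hs : ∀ a b, B a b = B b a := fun a b => hsymm a b
  simp only [C, T, linPart_apply, ContinuousLinearMap.comp_apply, linPartCLM_apply,
    smul_apply, sub_apply]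
  rw [hs v w, hs v, hs (Complex.I • v), hs (Complex.I • v)]
  module

/-- Antisymmetrization divided by `p!`, a left inverse of the inclusion of alternating maps. -/
lemma exists_leftInverse (p : ℕ) :
    ∃ R : ContinuousMultilinearMap ℂ (fun _ : Fin p => E) F →L[ℂ] E [⋀^Fin p]→L[ℂ] F,
      ∀ f : E [⋀^Fin p]→L[ℂ] F, R f.toContinuousMultilinearMap = f := by
  let R₀ : ContinuousMultilinearMap ℂ (fun _ : Fin p => E) F →ₗ[ℂ] E [⋀^Fin p]→L[ℂ] F :=
    { toFun := fun f => ((p.factorial : ℂ)⁻¹) • f.alternatization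
      map_add' := fun f g => by rw [map_add, smul_add]
      map_smul' := fun c f => by
        ext v
        change (p.factorial : ℂ)⁻¹ • ContinuousMultilinearMap.alternatization (c • f) v
          = c • (p.factorial : ℂ)⁻¹ • ContinuousMultilinearMap.alternatization f v
        rw [ContinuousMultilinearMap.alternatization_apply_apply,
          ContinuousMultilinearMap.alternatization_apply_apply, Finset.smul_sum, Finset.smul_sum,
          Finset.smul_sum]
        refine Finset.sum_congr rfl fun σ _ => ?_
        change (p.factorial : ℂ)⁻¹ • Equiv.Perm.sign σ • c • f (v ∘ σ) = _
        rw [smul_comm (Equiv.Perm.sign σ) c, smul_comm c (p.factorial : ℂ)⁻¹] }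
  refine ⟨R₀.mkContinuous 1 fun f => ?_, fun f => ?_⟩
  · refine ContinuousAlternatingMap.opNorm_le_bound _ (by positivity) fun v => ?_
    change ‖((p.factorial : ℂ)⁻¹) • f.alternatization v‖ ≤ _
    rw [norm_smul, ContinuousMultilinearMap.alternatization_apply_apply]
    have : ‖∑ σ : Equiv.Perm (Fin p), Equiv.Perm.sign σ • f (v ∘ σ)‖
        ≤ ∑ σ : Equiv.Perm (Fin p), ‖f‖ * ∏ i, ‖v i‖ := by
      refine norm_sum_le_of_le _ fun σ _ => ?_
      have h1 : ‖Equiv.Perm.sign σ • f (v ∘ σ)‖ = ‖f (v ∘ σ)‖ := by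
        rcases Int.units_eq_one_or (Equiv.Perm.sign σ) with h | h <;> simp [h]
      rw [h1, ← Equiv.prod_comp σ fun i => ‖v i‖]
      exact f.le_opNorm _
    rw [Finset.sum_const, Finset.card_univ, Fintype.card_perm, Fintype.card_fin] at this
    have hp : (0 : ℝ) < p.factorial := by exact_mod_cast p.factorial_pos
    calc _ ≤ ‖(p.factorial : ℂ)⁻¹‖ * (p.factorial • (‖f‖ * ∏ i, ‖v i‖)) := by gcongr
      _ = 1 * ‖f‖ * ∏ i, ‖v i‖ := by
        simp; field_simp
  · ext v
    change ((p.factorial : ℂ)⁻¹) • ContinuousMultilinearMap.alternatization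
      f.toContinuousMultilinearMap v = _
    rw [ContinuousMultilinearMap.alternatization_apply_apply]
    have : ∀ σ : Equiv.Perm (Fin p), Equiv.Perm.sign σ •
        f.toContinuousMultilinearMap (v ∘ σ) = f v := by
      intro σ
      have := f.toAlternatingMap.map_perm v σ
      change Equiv.Perm.sign σ • f.toAlternatingMap (v ∘ σ) = f v
      rw [this, smul_smul]
      simp
    rw [Finset.sum_congr rfl fun σ _ => this σ, Finset.sum_const, Finset.card_univ,
      Fintype.card_perm, Fintype.card_fin, ← Nat.cast_smul_eq_nsmul ℂ, smul_smul,
      inv_mul_cancel₀ (by exact_mod_cast p.factorial_ne_zero), one_smul]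

lemma contDiff_pullback (p : ℕ) {n : ℕ∞ω} :
    ContDiff ℂ n (fun fg : (E [⋀^Fin p]→L[ℂ] F) × (E →L[ℂ] E) =>
      fg.1.compContinuousLinearMap fg.2) := by
  obtain ⟨R, hR⟩ := exists_leftInverse (E := E) (F := F) p
  have h : (fun fg : (E [⋀^Fin p]→L[ℂ] F) × (E →L[ℂ] E) =>
      fg.1.compContinuousLinearMap fg.2) = fun fg =>
      R (ContinuousMultilinearMap.compContinuousLinearMapContinuousMultilinear ℂ
        (fun _ : Fin p ↦ E) (fun _ ↦ E) F (fun _ => fg.2)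
        (toContinuousMultilinearMapCLM ℂ fg.1)) := by
    funext fg
    rw [← hR (fg.1.compContinuousLinearMap fg.2)]
    rfl
  rw [h]
  refine R.contDiff.comp (ContDiff.clm_apply ?_ ?_)
  · exact (ContinuousMultilinearMap.contDiff _).comp (contDiff_pi.2 fun _ => contDiff_snd)
  · exact (toContinuousMultilinearMapLI (𝕜 := ℂ) (E := E) (F := F)
      (ι := Fin p)).contDiff.comp contDiff_fst

/-- Pullback of a form on a vector space by a holomorphic map. -/
noncomputable def pullLocal {p : ℕ} (τ : E → E) (η : E → E [⋀^Fin p]→L[ℂ] F) (y : E) :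
    E [⋀^Fin p]→L[ℂ] F :=
  (η (τ y)).compContinuousLinearMap (fderiv ℂ τ y)

lemma pullLocal_contDiffAt {p : ℕ} {τ : E → E} {η : E → E [⋀^Fin p]→L[ℂ] F} {y : E}
    (hτ : ContDiffAt ℂ ω τ y) (h : ContDiffAt ℝ ∞ η (τ y)) :
    ContDiffAt ℝ ∞ (pullLocal τ η) y := by
  have h1 : ContDiffAt ℝ ∞ (fderiv ℂ τ) y :=
    (hτ.fderiv_right (m := ∞) (by simp)).restrict_scalars ℝ
  have h2 : ContDiffAt ℝ ∞ τ y := (hτ.of_le (by simp)).restrict_scalars ℝ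
  have h3 := (contDiff_pullback (E := E) (F := F) p (n := ∞)).restrict_scalars ℝ
  exact h3.contDiffAt.comp y ((h.comp y h2).prodMk h1)

lemma delLocal_pullLocal {p : ℕ} {τ : E → E} {η : E → E [⋀^Fin p]→L[ℂ] F} {y : E}
    (hτ : ContDiffAt ℂ ω τ y) (h : DifferentiableAt ℝ η (τ y)) :
    delLocal (pullLocal τ η) y
      = (delLocal η (τ y)).compContinuousLinearMap (fderiv ℂ τ y) := by
  have h1 : HasFDerivAt τ ((fderiv ℂ τ y).restrictScalars ℝ) y :=
    (hτ.differentiableAt (by simp)).hasFDerivAt.restrictScalars ℝ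
  have h2 : HasFDerivAt (fderiv ℂ τ) ((fderiv ℂ (fderiv ℂ τ) y).restrictScalars ℝ) y :=
    ((hτ.fderiv_right (m := ω) (by simp)).differentiableAt (by simp)).hasFDerivAt.restrictScalars ℝ
  have hsymm : IsSymmSndFDerivAt ℂ τ y := hτ.isSymmSndFDerivAt (by simp)
  have h3 := (hasStrictFDerivAt_compContinuousLinearMap
    (η (τ y), fderiv ℂ τ y)).hasFDerivAt.restrictScalars ℝ
  have h4 := h3.comp y ((h.hasFDerivAt.comp y h1).prodMk h2)
  have h5 : HasFDerivAt (pullLocal τ η) _ y := h4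
  rw [delLocal, h5.fderiv]
  set S := fderiv ℂ τ y with hS
  have h6 : linPart (((compContinuousLinearMapCLM S ∘L .fst _ _ _ +
        (η (τ y)).fderivCompContinuousLinearMap S ∘L .snd _ _ _).restrictScalars ℝ).comp
        (((fderiv ℝ η (τ y)).comp (S.restrictScalars ℝ)).prod
          ((fderiv ℂ (fderiv ℂ τ) y).restrictScalars ℝ)))
      = (compContinuousLinearMapCLM S).comp ((linPart (fderiv ℝ η (τ y))).comp S)
        + ((η (τ y)).fderivCompContinuousLinearMap S).comp (fderiv ℂ (fderiv ℂ τ) y) := by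
    ext1 v
    simp only [linPart_apply, ContinuousLinearMap.comp_apply, add_apply, map_smul, map_sub,
      ContinuousLinearMap.coe_restrictScalars', ContinuousLinearMap.prod_apply,
      ContinuousLinearMap.coe_fst', ContinuousLinearMap.coe_snd', smul_add, smul_smul,
      Complex.I_mul_I]
    module
  rw [h6, alternatizeUncurryFin_add, alternatizeUncurryFin_fderivCompContinuousLinearMap_eq_zero
    _ _ hsymm.eq, add_zero]
  ext v
  simp +unfoldPartialApp [delLocal, alternatizeUncurryFin_apply, Fin.removeNth, Function.comp_def]

end LocalCalculus
section Division

variable {E : Type*} [NormedAddCommGroup E] [NormedSpace ℂ E]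

/-- An analytic function vanishing on a hyperplane is divisible by the linear form. -/
lemma exists_div_linear {G : E → ℂ} {w₀ : E} (hG : AnalyticAt ℂ G w₀) (l : E →L[ℂ] ℂ)
    (v : E) (hv : l v = 1) (h0 : l w₀ = 0) (hz : ∀ᶠ w in 𝓝 w₀, l w = 0 → G w = 0) :
    ∃ H : E → ℂ, AnalyticAt ℂ H w₀ ∧ ∀ᶠ w in 𝓝 w₀, G w = l w * H w := by
  obtain ⟨p, r, hp⟩ := hG
  -- projection to the hyperplane along `v`
  let π : E →L[ℂ] E := ContinuousLinearMap.id ℂ E - l.smulRight v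
  have hπ : ∀ y, π y = y - l y • v := fun y => by simp [π]
  have hlπ : ∀ y, l (π y) = 0 := fun y => by simp [hπ, hv]
  let C : ℝ := max 1 ‖π‖
  have hC1 : 1 ≤ C := le_max_left _ _
  let sel : (n : ℕ) → Fin (n + 1) → Fin n → (E →L[ℂ] E) := fun n i j =>
    if j.castSucc < i then π else ContinuousLinearMap.id ℂ E
  let q : FormalMultilinearSeries ℂ E ℂ := fun n =>
    ∑ i : Fin (n + 1), ((p (n + 1)).curryMid i v).compContinuousLinearMap (sel n i)
  have hsel : ∀ n i j, ‖sel n i j‖ ≤ C := by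
    intro n i j
    simp only [sel]
    split_ifs
    · exact le_max_right _ _
    · exact ContinuousLinearMap.norm_id_le.trans hC1
  have hq : ∀ n, ‖q n‖ ≤ (n + 1) * (‖p (n + 1)‖ * ‖v‖ * C ^ n) := by
    intro n
    refine (norm_sum_le _ _).trans ?_
    have : ∀ i ∈ (Finset.univ : Finset (Fin (n + 1))),
        ‖((p (n + 1)).curryMid i v).compContinuousLinearMap (sel n i)‖
          ≤ ‖p (n + 1)‖ * ‖v‖ * C ^ n := by
      intro i _
      refine (ContinuousMultilinearMap.norm_compContinuousLinearMap_le _ _).trans ?_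
      have h1 : ‖(p (n + 1)).curryMid i v‖ ≤ ‖p (n + 1)‖ * ‖v‖ := by
        have := ((p (n + 1)).curryMid i).le_opNorm v
        rwa [ContinuousMultilinearMap.norm_curryMid] at this
      have h2 : ∏ j, ‖sel n i j‖ ≤ C ^ n := by
        calc ∏ j, ‖sel n i j‖ ≤ ∏ _j : Fin n, C :=
              Finset.prod_le_prod (fun _ _ => norm_nonneg _) (fun j _ => hsel n i j)
          _ = C ^ n := by simp
      gcongr
    refine (Finset.sum_le_sum this).trans ?_
    simp
  -- telescoping
  have htel : ∀ n y, (p (n + 1) fun _ => y) - (p (n + 1) fun _ => π y) = l y * (q n fun _ => y) := by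
    intro n y
    let s : ℕ → ℂ := fun i => p (n + 1) fun j => if (j : ℕ) < i then π y else y
    have h1 : (p (n + 1) fun _ => y) = s 0 := by simp [s]
    have h2 : (p (n + 1) fun _ => π y) = s (n + 1) := by
      simp only [s]; congr 1; funext j; simp [j.2]
    have h3 : s 0 - s (n + 1) = ∑ i ∈ Finset.range (n + 1), (s i - s (i + 1)) :=
      (Finset.sum_range_sub' s (n + 1)).symm
    rw [h1, h2, h3, Finset.sum_range]
    simp only [q, sum_apply, Finset.mul_sum]
    refine Finset.sum_congr rfl fun i _ => ?_
    set m : Fin n → E := fun j => if j.castSucc < i then π y else y with hm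
    have e1 : (fun j : Fin (n + 1) => if (j : ℕ) < i then π y else y)
        = i.insertNth (α := fun _ => E) y m := by
      funext j
      cases j using i.succAboveCases with
      | x => simp
      | p j =>
        simp only [Fin.insertNth_apply_succAbove, hm]
        by_cases hj : j.castSucc < i
        · rw [Fin.succAbove_of_castSucc_lt _ _ hj]
          have h' : (j : ℕ) < i := hj
          simp [hj, h']
        · rw [Fin.succAbove_of_le_castSucc _ _ (not_lt.1 hj)]
          have : ¬ ((j : ℕ) + 1 < i) := by
            have := not_lt.1 hj
            have : (i : ℕ) ≤ j := this
            omega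
          simp [hj, this]
    have e2 : (fun j : Fin (n + 1) => if (j : ℕ) < (i : ℕ) + 1 then π y else y)
        = i.insertNth (α := fun _ => E) (π y) m := by
      funext j
      cases j using i.succAboveCases with
      | x => simp
      | p j =>
        simp only [Fin.insertNth_apply_succAbove, hm]
        by_cases hj : j.castSucc < i
        · rw [Fin.succAbove_of_castSucc_lt _ _ hj]
          have h' : (j : ℕ) < i := hj
          have : ((j.castSucc : Fin (n + 1)) : ℕ) < i + 1 := by simp; omega
          simp [hj]
          omega
        · rw [Fin.succAbove_of_le_castSucc _ _ (not_lt.1 hj)]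
          have : ¬ ((j : ℕ) < i) := hj
          simp [hj, this]
    have e3 : (((p (n + 1)).curryMid i v).compContinuousLinearMap (sel n i)) (fun _ => y)
        = p (n + 1) (i.insertNth (α := fun _ => E) v m) := by
      rw [ContinuousMultilinearMap.compContinuousLinearMap_apply,
        ContinuousMultilinearMap.curryMid_apply]
      congr 2
      funext j
      simp only [sel, hm]
      split_ifs <;> simp
    rw [e3]
    simp only [s]
    rw [e1, e2]
    simp only [← ContinuousMultilinearMap.curryMid_apply]
    have : y = π y + l y • v := by rw [hπ]; abel
    conv_lhs => enter [1]; rw [this]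
    simp only [map_add, map_smul, add_apply,
      smul_apply, smul_eq_mul]
    ring
  -- radius of convergence
  have hrad : 0 < q.radius := by
    obtain ⟨ρ, hρ0, hρ⟩ : ∃ ρ : NNReal, 0 < ρ ∧ (ρ : ENNReal) < p.radius := by
      obtain ⟨ρ, h1, h2⟩ := ENNReal.lt_iff_exists_nnreal_btwn.1 (hp.r_pos.trans_le hp.r_le)
      exact ⟨ρ, by exact_mod_cast h1, h2⟩
    obtain ⟨A, hA, hb⟩ := p.norm_le_div_pow_of_pos_of_lt_radius hρ0 hρ
    let R : NNReal := ⟨ρ / (2 * C), by positivity⟩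
    have hR : (R : ℝ) = ρ / (2 * C) := rfl
    have hR0 : 0 < R := by
      rw [← NNReal.coe_pos, hR]; positivity
    refine lt_of_lt_of_le (by exact_mod_cast hR0) (q.le_radius_of_bound (A * ‖v‖ / ρ) (r := R) ?_)
    intro n
    have hn : ((n : ℝ) + 1) ≤ 2 ^ n := by
      have : n < 2 ^ n := Nat.lt_two_pow_self
      exact_mod_cast this
    have hρ' : (0 : ℝ) < ρ := hρ0
    have hCp : 0 < C := by positivity
    calc ‖q n‖ * (R : ℝ) ^ n
        ≤ ((n + 1) * (‖p (n + 1)‖ * ‖v‖ * C ^ n)) * (R : ℝ) ^ n := by gcongr; exact hq n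
      _ ≤ (2 ^ n * (A / ρ ^ (n + 1) * ‖v‖ * C ^ n)) * (ρ / (2 * C)) ^ n := by
          rw [hR]; gcongr; exact hb _
      _ = A * ‖v‖ / ρ := by
          rw [div_pow, mul_pow, pow_succ]; field_simp
  have hqs := q.hasFPowerSeriesOnBall hrad
  refine ⟨fun w => q.sum (w - w₀), ?_, ?_⟩
  · have h1 : AnalyticAt ℂ q.sum (w₀ - w₀) := by
      rw [sub_self]; exact hqs.analyticAt
    exact AnalyticAt.fun_comp (g := q.sum) (f := fun w => w - w₀) h1
      (analyticAt_id.sub analyticAt_const)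
  · have hcont : Tendsto (fun w => w₀ + π (w - w₀)) (𝓝 w₀) (𝓝 w₀) := by
      have : Continuous fun w => w₀ + π (w - w₀) := by fun_prop
      simpa using this.tendsto w₀
    have hcont0 : Tendsto (fun w => w - w₀) (𝓝 w₀) (𝓝 0) := by
      have : Continuous fun w : E => w - w₀ := by fun_prop
      simpa using this.tendsto w₀
    have hcontπ : Tendsto (fun w => π (w - w₀)) (𝓝 w₀) (𝓝 0) := by
      have : Continuous fun w : E => π (w - w₀) := by fun_prop
      simpa using this.tendsto w₀
    have hball := Metric.eball_mem_nhds (0 : E) hp.r_pos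
    have hballq := Metric.eball_mem_nhds (0 : E) hrad
    filter_upwards [hcont.eventually hz, hcont0.eventually hball, hcontπ.eventually hball,
      hcont0.eventually hballq] with w h1 h2 h3 h4
    set y := w - w₀ with hy
    have s1 := hp.hasSum h2
    have s2 := hp.hasSum h3
    rw [h1 (by rw [map_add, h0, hlπ, add_zero])] at s2
    have s3 := s1.sub s2
    have s4 := hqs.hasSum h4
    rw [zero_add] at s4
    have s5 := s4.mul_left (l y)
    have s6 : HasSum (fun n => (p (n + 1) fun _ => y) - (p (n + 1) fun _ => π y))
        (l y * q.sum y) := by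
      simpa only [htel] using s5
    have s7 := (hasSum_nat_add_iff' (f := fun n => (p n fun _ => y) - (p n fun _ => π y)) 1).2 s3
    have s8 := s7.unique s6
    have e0 : (p 0 fun _ => y) = p 0 fun _ => π y := by congr 1; funext j; exact j.elim0
    have e1 : w₀ + y = w := by simp [hy]
    have e2 : l y = l w := by simp [hy, h0]
    simpa [e0, e1, e2] using s8

/-- An analytic function vanishing on the zero set of an analytic submersion `f` is divisible
by `f`. -/
lemma exists_div {f g : E → ℂ} {a : E} [CompleteSpace E] (hf : ContDiffAt ℂ ω f a)
    (hg : ContDiffAt ℂ ω g a) (ha : f a = 0) (hdf : fderiv ℂ f a ≠ 0)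
    (hz : ∀ᶠ y in 𝓝 a, f y = 0 → g y = 0) :
    ∃ h : E → ℂ, ContDiffAt ℂ ω h a ∧ ∀ᶠ y in 𝓝 a, g y = f y * h y := by
  set l := fderiv ℂ f a with hl
  obtain ⟨v, hv⟩ : ∃ v, l v = 1 := by
    obtain ⟨u, hu⟩ : ∃ u, l u ≠ 0 := by
      by_contra! h
      exact hdf (by ext u; simpa using h u)
    exact ⟨(l u)⁻¹ • u, by simp [hu]⟩
  let Φ : E → E := fun z => z + (f z - l z) • v
  have hlΦ : ∀ z, l (Φ z) = f z := fun z => by simp [Φ, hv]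
  have hΦ : ContDiffAt ℂ ω Φ a :=
    contDiffAt_id.add ((hf.sub l.contDiff.contDiffAt).smul contDiffAt_const)
  have hΦ' : HasFDerivAt Φ ((ContinuousLinearEquiv.refl ℂ E : E ≃L[ℂ] E) : E →L[ℂ] E) a := by
    have h1 : HasFDerivAt f l a := (hf.differentiableAt (by simp)).hasFDerivAt
    have h2 := (hasFDerivAt_id (𝕜 := ℂ) a).add ((h1.sub l.hasFDerivAt).smul_const v)
    refine h2.congr_fderiv ?_
    ext u; simp
  let Ψ := hΦ.localInverse hΦ' (by simp)
  have hΨ : ContDiffAt ℂ ω Ψ (Φ a) := hΦ.to_localInverse hΦ' (by simp)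
  have hΨa : Ψ (Φ a) = a := hΦ.localInverse_apply_image hΦ' (by simp)
  have hst := hΦ.hasStrictFDerivAt' hΦ' (by simp)
  have hR : ∀ᶠ w in 𝓝 (Φ a), Φ (Ψ w) = w := hst.eventually_right_inverse
  have hL : ∀ᶠ z in 𝓝 a, Ψ (Φ z) = z := hst.eventually_left_inverse
  have hG : ContDiffAt ℂ ω (g ∘ Ψ) (Φ a) := ContDiffAt.comp _ (by rwa [hΨa]) hΨ
  have hΨt : Tendsto Ψ (𝓝 (Φ a)) (𝓝 a) := by
    have := hΨ.continuousAt.tendsto; rwa [hΨa] at this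
  obtain ⟨H, hH, hH'⟩ := exists_div_linear (G := g ∘ Ψ) (w₀ := Φ a)
    (analyticWithinAt_univ.1 (contDiffWithinAt_omega_iff_analyticWithinAt.1 hG)) l v hv
    (by rw [hlΦ, ha]) (by
      filter_upwards [hR, hΨt.eventually hz] with w h1 h2 h3
      refine h2 ?_
      rw [← hlΦ, h1, h3])
  refine ⟨H ∘ Φ, hH.contDiffAt.comp a hΦ, ?_⟩
  filter_upwards [hΦ.continuousAt.tendsto.eventually hH', hL] with z h1 h2
  rw [hlΦ] at h1
  simpa [h2] using h1

end Division

open ContinuousAlternatingMap (alternatizeUncurryFinCLM alternatizeUncurryFin_add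
  alternatizeUncurryFin_alternatizeUncurryFinCLM_comp_of_symmetric compContinuousLinearMapCLM
  alternatizeUncurryFin_fderivCompContinuousLinearMap_eq_zero alternatizeUncurryFin_apply
  toContinuousMultilinearMapCLM toContinuousMultilinearMapLI
  hasStrictFDerivAt_compContinuousLinearMap)

section LocalCalculus2

variable {E F : Type*} [NormedAddCommGroup E] [NormedSpace ℂ E]
  [NormedAddCommGroup F] [NormedSpace ℂ F] {p : ℕ}

/-- The wedge product `θ ∧ a` of a covector and an alternating form:
`(θ ∧ a)(v₀, …, vₚ) = ∑ i, (-1)ⁱ θ(vᵢ) a(v₀, …, v̂ᵢ, …, vₚ)`. -/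
noncomputable def wedgeOne (θ : E →L[ℂ] ℂ) (a : E [⋀^Fin p]→L[ℂ] ℂ) : E [⋀^Fin (p + 1)]→L[ℂ] ℂ :=
  .alternatizeUncurryFin (θ.smulRight a)

lemma delLocal_add {η θ : E → E [⋀^Fin p]→L[ℂ] F} {y : E} (h : DifferentiableAt ℝ η y)
    (h' : DifferentiableAt ℝ θ y) :
    delLocal (fun z => η z + θ z) y = delLocal η y + delLocal θ y := by
  rw [delLocal, fderiv_fun_add h h', linPart_add, alternatizeUncurryFin_add]; rfl

lemma delLocal_smul {f : E → ℂ} {η : E → E [⋀^Fin p]→L[ℂ] ℂ} {y : E}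
    (hf : DifferentiableAt ℂ f y) (h : DifferentiableAt ℝ η y) :
    delLocal (fun z => f z • η z) y = wedgeOne (fderiv ℂ f y) (η y) + f y • delLocal η y := by
  have h1 : HasFDerivAt f ((fderiv ℂ f y).restrictScalars ℝ) y :=
    hf.hasFDerivAt.restrictScalars ℝ
  have h2 := h1.smul h.hasFDerivAt
  have h3 : HasFDerivAt (fun z => f z • η z) _ y := h2
  rw [delLocal, h3.fderiv, wedgeOne, delLocal, ← ContinuousAlternatingMap.alternatizeUncurryFin_smul,
    ← alternatizeUncurryFin_add]
  congr 1
  ext1 v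
  simp only [linPart_apply, add_apply, smul_apply, ContinuousLinearMap.smulRight_apply,
    ContinuousLinearMap.coe_restrictScalars', map_smul, smul_eq_mul]
  match_scalars
  · ring
  · ring_nf; simp only [Complex.I_sq]; ring
  · ring

lemma delLocal_const_smul (c : ℂ) {η : E → E [⋀^Fin p]→L[ℂ] ℂ} {y : E}
    (h : DifferentiableAt ℝ η y) :
    delLocal (fun z => c • η z) y = c • delLocal η y := by
  rw [delLocal_smul (f := fun _ => c) (differentiableAt_const c) h]
  have : wedgeOne (0 : E →L[ℂ] ℂ) (η y) = 0 := by
    ext v; simp [wedgeOne, alternatizeUncurryFin_apply]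
  simp [this]

end LocalCalculus2

section Manifold

variable {E : Type*} [NormedAddCommGroup E] [NormedSpace ℂ E]
  {X : Type*} [TopologicalSpace X] [ChartedSpace E X] [IsManifold 𝓘(ℂ, E) ω X] {p : ℕ}

/-- The expression of a `(p, 0)`-form in the preferred chart at `x`.

A `(p, 0)`-form on a complex manifold `X` assigns to every point `z` an alternating complex
`p`-linear form on the holomorphic tangent space `TangentSpace 𝓘(ℂ, E) z`, which Mathlib
identifies with the model space `E` through the preferred chart at `z`. In the chart at `x` the
form is thus its pullback under the derivative of the inverse chart, which is
`tangentCoordChange 𝓘(ℂ, E) x z z`. -/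
noncomputable def chartRep (x : X) (α : X → E [⋀^Fin p]→L[ℂ] ℂ) (y : E) : E [⋀^Fin p]→L[ℂ] ℂ :=
  (α ((extChartAt 𝓘(ℂ, E) x).symm y)).compContinuousLinearMap
    (tangentCoordChange 𝓘(ℂ, E) x ((extChartAt 𝓘(ℂ, E) x).symm y)
      ((extChartAt 𝓘(ℂ, E) x).symm y))

/-- Smoothness, in the real sense, of a `(p, 0)`-form at a point. -/
def SmoothFormAt (α : X → E [⋀^Fin p]→L[ℂ] ℂ) (x : X) : Prop :=
  ContDiffAt ℝ ∞ (chartRep x α) (extChartAt 𝓘(ℂ, E) x x)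

/-- The operator `∂` on `(p, 0)`-forms on a complex manifold, computed in charts. -/
noncomputable def del (α : X → E [⋀^Fin p]→L[ℂ] ℂ) (x : X) : E [⋀^Fin (p + 1)]→L[ℂ] ℂ :=
  delLocal (chartRep x α) (extChartAt 𝓘(ℂ, E) x x)

/-- The form `df ∧ α` for a function `f` and a `(p, 0)`-form `α`. -/
noncomputable def dWedge (f : X → ℂ) (α : X → E [⋀^Fin p]→L[ℂ] ℂ) (x : X) :
    E [⋀^Fin (p + 1)]→L[ℂ] ℂ :=
  wedgeOne (mfderiv 𝓘(ℂ, E) 𝓘(ℂ, ℂ) f x : E →L[ℂ] ℂ) (α x)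

/-- The change of coordinates from the chart at `x` to the chart at `z`. -/
noncomputable def coordTrans (x z : X) : E → E :=
  extChartAt 𝓘(ℂ, E) z ∘ (extChartAt 𝓘(ℂ, E) x).symm

lemma coordTrans_contDiffAt {x z w : X} (hx : w ∈ (extChartAt 𝓘(ℂ, E) x).source)
    (hz : w ∈ (extChartAt 𝓘(ℂ, E) z).source) :
    ContDiffAt ℂ ω (coordTrans x z) (extChartAt 𝓘(ℂ, E) x w) := by
  have h : extChartAt 𝓘(ℂ, E) x w ∈
      ((extChartAt 𝓘(ℂ, E) x).symm ≫ (extChartAt 𝓘(ℂ, E) z)).source := by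
    rw [PartialEquiv.trans_source'', PartialEquiv.symm_symm, PartialEquiv.symm_target]
    exact mem_image_of_mem _ ⟨hx, hz⟩
  have := contDiffWithinAt_ext_coord_change (n := ω) (I := 𝓘(ℂ, E)) z x h
  rw [coordTrans, ← contDiffWithinAt_univ]
  simpa using this

lemma tangentCoordChange_eq {x z w : X} :
    tangentCoordChange 𝓘(ℂ, E) x z w = fderiv ℂ (coordTrans x z) (extChartAt 𝓘(ℂ, E) x w) := by
  rw [tangentCoordChange_def]
  simp [coordTrans]

lemma eventually_source (x z : X) {w : X} (hx : w ∈ (extChartAt 𝓘(ℂ, E) x).source)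
    (hz : w ∈ (extChartAt 𝓘(ℂ, E) z).source) :
    ∀ᶠ y in 𝓝 (extChartAt 𝓘(ℂ, E) x w), y ∈ (extChartAt 𝓘(ℂ, E) x).target ∧
      (extChartAt 𝓘(ℂ, E) x).symm y ∈ (extChartAt 𝓘(ℂ, E) z).source := by
  have h1 : (extChartAt 𝓘(ℂ, E) x).target ∈ 𝓝 (extChartAt 𝓘(ℂ, E) x w) :=
    (isOpen_extChartAt_target x).mem_nhds ((extChartAt 𝓘(ℂ, E) x).map_source hx)
  have h2 : Tendsto (extChartAt 𝓘(ℂ, E) x).symm (𝓝 (extChartAt 𝓘(ℂ, E) x w)) (𝓝 w) := by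
    have := (continuousAt_extChartAt_symm' (I := 𝓘(ℂ, E)) hx).tendsto
    rwa [(extChartAt 𝓘(ℂ, E) x).left_inv hx] at this
  exact (Filter.eventually_mem_set.2 h1).and
    (h2.eventually ((isOpen_extChartAt_source z).mem_nhds hz))

/-- Change of charts. -/
lemma chartRep_eventuallyEq (α : X → E [⋀^Fin p]→L[ℂ] ℂ) (x : X) {w : X}
    (hx : w ∈ (extChartAt 𝓘(ℂ, E) x).source) :
    chartRep x α =ᶠ[𝓝 (extChartAt 𝓘(ℂ, E) x w)] pullLocal (coordTrans x w) (chartRep w α) := by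
  filter_upwards [eventually_source x w hx (mem_extChartAt_source w)] with y hy
  obtain ⟨hy1, hy2⟩ := hy
  set u := (extChartAt 𝓘(ℂ, E) x).symm y with hu
  have hyu : extChartAt 𝓘(ℂ, E) x u = y := (extChartAt 𝓘(ℂ, E) x).right_inv hy1
  have hux : u ∈ (extChartAt 𝓘(ℂ, E) x).source := (extChartAt 𝓘(ℂ, E) x).map_target hy1
  have h1 : (extChartAt 𝓘(ℂ, E) w).symm (coordTrans x w y) = u := by
    simp only [coordTrans, Function.comp_apply, ← hu]
    exact (extChartAt 𝓘(ℂ, E) w).left_inv hy2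
  have h2 : fderiv ℂ (coordTrans x w) y = tangentCoordChange 𝓘(ℂ, E) x w u := by
    rw [tangentCoordChange_eq, hyu]
  simp only [chartRep, pullLocal, h1, h2, ← hu]
  ext v
  simp only [ContinuousAlternatingMap.compContinuousLinearMap_apply]
  congr 1
  funext i
  exact (tangentCoordChange_comp ⟨⟨hux, hy2⟩, mem_extChartAt_source u⟩).symm

lemma coordTrans_apply (x w : X) (hx : w ∈ (extChartAt 𝓘(ℂ, E) x).source) :
    coordTrans x w (extChartAt 𝓘(ℂ, E) x w) = extChartAt 𝓘(ℂ, E) w w := by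
  simp only [coordTrans, Function.comp_apply, (extChartAt 𝓘(ℂ, E) x).left_inv hx]

lemma SmoothFormAt.chartRep {α : X → E [⋀^Fin p]→L[ℂ] ℂ} {x w : X} (h : SmoothFormAt α w)
    (hx : w ∈ (extChartAt 𝓘(ℂ, E) x).source) :
    ContDiffAt ℝ ∞ (chartRep x α) (extChartAt 𝓘(ℂ, E) x w) := by
  refine ContDiffAt.congr_of_eventuallyEq ?_ (chartRep_eventuallyEq α x hx)
  refine pullLocal_contDiffAt (coordTrans_contDiffAt hx (mem_extChartAt_source w)) ?_
  rw [coordTrans_apply x w hx]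
  exact h

lemma chartRep_del {α : X → E [⋀^Fin p]→L[ℂ] ℂ} {x w : X} (h : SmoothFormAt α w)
    (hx : w ∈ (extChartAt 𝓘(ℂ, E) x).source) :
    DolbeaultLog.chartRep x (del α) (extChartAt 𝓘(ℂ, E) x w)
      = delLocal (DolbeaultLog.chartRep x α) (extChartAt 𝓘(ℂ, E) x w) := by
  rw [delLocal_congr (chartRep_eventuallyEq α x hx), delLocal_pullLocal
    (coordTrans_contDiffAt hx (mem_extChartAt_source w)) (by
      rw [coordTrans_apply x w hx]; exact ContDiffAt.differentiableAt h (by simp)),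
    coordTrans_apply x w hx, DolbeaultLog.chartRep, (extChartAt 𝓘(ℂ, E) x).left_inv hx,
    tangentCoordChange_eq]
  rfl

lemma eventually_chartRep_del {α : X → E [⋀^Fin p]→L[ℂ] ℂ} {x : X}
    (h : ∀ᶠ y in 𝓝 x, SmoothFormAt α y) :
    chartRep x (del α) =ᶠ[𝓝 (extChartAt 𝓘(ℂ, E) x x)] delLocal (chartRep x α) := by
  have h2 : Tendsto (extChartAt 𝓘(ℂ, E) x).symm (𝓝 (extChartAt 𝓘(ℂ, E) x x)) (𝓝 x) := by
    have := (continuousAt_extChartAt_symm (I := 𝓘(ℂ, E)) x).tendsto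
    rwa [extChartAt_to_inv] at this
  filter_upwards [h2.eventually h, (isOpen_extChartAt_target (I := 𝓘(ℂ, E)) x).mem_nhds
    (mem_extChartAt_target x)] with y hy hy'
  have h3 := chartRep_del hy ((extChartAt 𝓘(ℂ, E) x).map_target hy')
  rwa [(extChartAt 𝓘(ℂ, E) x).right_inv hy'] at h3

lemma smoothFormAt_del {α : X → E [⋀^Fin p]→L[ℂ] ℂ} {x : X}
    (h : ∀ᶠ y in 𝓝 x, SmoothFormAt α y) : SmoothFormAt (del α) x :=
  (delLocal_contDiffAt h.self_of_nhds).congr_of_eventuallyEq (eventually_chartRep_del h)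

lemma del_del {α : X → E [⋀^Fin p]→L[ℂ] ℂ} {x : X}
    (h : ∀ᶠ y in 𝓝 x, SmoothFormAt α y) : del (del α) x = 0 := by
  rw [del, delLocal_congr (eventually_chartRep_del h), delLocal_delLocal h.self_of_nhds]

lemma chartRep_congr {α β : X → E [⋀^Fin p]→L[ℂ] ℂ} {x : X} (h : α =ᶠ[𝓝 x] β) :
    chartRep x α =ᶠ[𝓝 (extChartAt 𝓘(ℂ, E) x x)] chartRep x β := by
  have h2 : Tendsto (extChartAt 𝓘(ℂ, E) x).symm (𝓝 (extChartAt 𝓘(ℂ, E) x x)) (𝓝 x) := by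
    have := (continuousAt_extChartAt_symm (I := 𝓘(ℂ, E)) x).tendsto
    rwa [extChartAt_to_inv] at this
  filter_upwards [h2.eventually h] with y hy
  rw [chartRep, chartRep, hy]

lemma SmoothFormAt.congr {α β : X → E [⋀^Fin p]→L[ℂ] ℂ} {x : X} (hα : SmoothFormAt α x)
    (h : α =ᶠ[𝓝 x] β) : SmoothFormAt β x :=
  ContDiffAt.congr_of_eventuallyEq hα (chartRep_congr h.symm)

lemma del_congr {α β : X → E [⋀^Fin p]→L[ℂ] ℂ} {x : X} (h : α =ᶠ[𝓝 x] β) :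
    del α x = del β x :=
  delLocal_congr (chartRep_congr h)

lemma chartRep_add (x : X) (α β : X → E [⋀^Fin p]→L[ℂ] ℂ) :
    chartRep x (fun y => α y + β y) = fun z => chartRep x α z + chartRep x β z := by
  funext y; ext v; simp [chartRep]

lemma chartRep_smul (x : X) (f : X → ℂ) (α : X → E [⋀^Fin p]→L[ℂ] ℂ) :
    chartRep x (fun y => f y • α y)
      = fun z => (f ∘ (extChartAt 𝓘(ℂ, E) x).symm) z • chartRep x α z := by
  funext y; ext v; simp [chartRep]

lemma SmoothFormAt.add {α β : X → E [⋀^Fin p]→L[ℂ] ℂ} {x : X} (hα : SmoothFormAt α x)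
    (hβ : SmoothFormAt β x) : SmoothFormAt (fun y => α y + β y) x := by
  rw [SmoothFormAt, chartRep_add]
  exact ContDiffAt.add hα hβ

lemma del_add {α β : X → E [⋀^Fin p]→L[ℂ] ℂ} {x : X} (hα : SmoothFormAt α x)
    (hβ : SmoothFormAt β x) : del (fun y => α y + β y) x = del α x + del β x := by
  rw [del, chartRep_add]
  exact delLocal_add (ContDiffAt.differentiableAt hα (by simp))
    (ContDiffAt.differentiableAt hβ (by simp))

lemma holo_contDiffAt {f : X → ℂ} {x : X} (hf : ContMDiffAt 𝓘(ℂ, E) 𝓘(ℂ, ℂ) ω f x) :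
    ContDiffAt ℂ ω (f ∘ (extChartAt 𝓘(ℂ, E) x).symm) (extChartAt 𝓘(ℂ, E) x x) := by
  have := (contMDiffAt_iff.1 hf).2
  rw [← contDiffWithinAt_univ]
  simpa [chartAt_self_eq] using this

lemma holo_mfderiv {f : X → ℂ} {x : X} (hf : ContMDiffAt 𝓘(ℂ, E) 𝓘(ℂ, ℂ) ω f x) :
    (mfderiv 𝓘(ℂ, E) 𝓘(ℂ, ℂ) f x : E →L[ℂ] ℂ)
      = fderiv ℂ (f ∘ (extChartAt 𝓘(ℂ, E) x).symm) (extChartAt 𝓘(ℂ, E) x x) := by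
  have h : MDifferentiableAt 𝓘(ℂ, E) 𝓘(ℂ, ℂ) f x := hf.mdifferentiableAt (by simp)
  refine h.mfderiv.trans ?_
  simp [writtenInExtChartAt, chartAt_self_eq]
  rfl

lemma SmoothFormAt.smul {f : X → ℂ} {α : X → E [⋀^Fin p]→L[ℂ] ℂ} {x : X}
    (hf : ContMDiffAt 𝓘(ℂ, E) 𝓘(ℂ, ℂ) ω f x) (hα : SmoothFormAt α x) :
    SmoothFormAt (fun y => f y • α y) x := by
  rw [SmoothFormAt, chartRep_smul]
  have h1 := ((holo_contDiffAt hf).of_le (m := ∞) (by simp)).restrict_scalars ℝ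
  exact h1.smul hα

/-- The Leibniz rule for a holomorphic factor. -/
lemma del_smul {f : X → ℂ} {α : X → E [⋀^Fin p]→L[ℂ] ℂ} {x : X}
    (hf : ContMDiffAt 𝓘(ℂ, E) 𝓘(ℂ, ℂ) ω f x) (hα : SmoothFormAt α x) :
    del (fun y => f y • α y) x = dWedge f α x + f x • del α x := by
  rw [del, chartRep_smul, delLocal_smul ((holo_contDiffAt hf).differentiableAt (by simp))
    (ContDiffAt.differentiableAt hα (by simp)), dWedge, holo_mfderiv hf]
  have h1 : chartRep x α (extChartAt 𝓘(ℂ, E) x x) = α x := by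
    rw [chartRep, extChartAt_to_inv]
    ext v
    simp only [ContinuousAlternatingMap.compContinuousLinearMap_apply]
    congr 1
    funext i
    exact tangentCoordChange_self (mem_extChartAt_source x)
  rw [h1, Function.comp_apply, extChartAt_to_inv]
  rfl

lemma SmoothFormAt.const_smul (c : ℂ) {α : X → E [⋀^Fin p]→L[ℂ] ℂ} {x : X}
    (hα : SmoothFormAt α x) : SmoothFormAt (fun y => c • α y) x :=
  SmoothFormAt.smul (f := fun _ => c) contMDiffAt_const hα

lemma del_const_smul (c : ℂ) {α : X → E [⋀^Fin p]→L[ℂ] ℂ} {x : X} (hα : SmoothFormAt α x) :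
    del (fun y => c • α y) x = c • del α x := by
  rw [del, chartRep_smul (f := fun _ => c)]
  exact delLocal_const_smul c (ContDiffAt.differentiableAt hα (by simp))

end Manifold

section Hypersurface

variable (E : Type*) [NormedAddCommGroup E] [NormedSpace ℂ E]
  (X : Type*) [TopologicalSpace X] [ChartedSpace E X]

/-- A smooth hypersurface of a complex manifold: a closed complex submanifold of codimension one,
that is, a closed subset which near each of its points is the zero set of a holomorphic function
with nonvanishing differential. -/
structure SmoothHypersurface where
  /-- The underlying set. -/
  carrier : Set X
  isClosed : IsClosed carrier
  exists_submersion : ∀ x ∈ carrier, ∃ f : X → ℂ, ContMDiffAt 𝓘(ℂ, E) 𝓘(ℂ, ℂ) ω f x ∧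
    mfderiv 𝓘(ℂ, E) 𝓘(ℂ, ℂ) f x ≠ 0 ∧ ∀ᶠ y in 𝓝 x, y ∈ carrier ↔ f y = 0

variable {E X}

/-- `f` is a local equation for `D` on the open set `V`: a holomorphic function on `V` which
generates, in the sheaf of holomorphic functions on `V`, the ideal of functions vanishing on
`D ∩ V`. (Values of `f` outside `V` are irrelevant.) -/
structure IsLocalEquation (D : SmoothHypersurface E X) (V : Set X) (f : X → ℂ) : Prop where
  isOpen : IsOpen V
  holo : ∀ x ∈ V, ContMDiffAt 𝓘(ℂ, E) 𝓘(ℂ, ℂ) ω f x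
  vanish : ∀ x ∈ V ∩ D.carrier, f x = 0
  generates : ∀ x ∈ V, ∀ g : X → ℂ, ContMDiffAt 𝓘(ℂ, E) 𝓘(ℂ, ℂ) ω g x →
    (∀ᶠ y in 𝓝 x, y ∈ D.carrier → g y = 0) →
    ∃ h : X → ℂ, ContMDiffAt 𝓘(ℂ, E) 𝓘(ℂ, ℂ) ω h x ∧ ∀ᶠ y in 𝓝 x, g y = f y * h y

lemma IsLocalEquation.mono {D : SmoothHypersurface E X} {V W : Set X} {f : X → ℂ}
    (h : IsLocalEquation D V f) (hW : IsOpen W) (hWV : W ⊆ V) : IsLocalEquation D W f :=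
  ⟨hW, fun x hx => h.holo x (hWV hx), fun x hx => h.vanish x ⟨hWV hx.1, hx.2⟩,
    fun x hx => h.generates x (hWV hx)⟩

variable [IsManifold 𝓘(ℂ, E) ω X]

lemma holo_iff_chart {f : X → ℂ} {x y : X} (hy : y ∈ (chartAt E x).source) :
    ContMDiffAt 𝓘(ℂ, E) 𝓘(ℂ, ℂ) ω f y ↔
      ContDiffAt ℂ ω (f ∘ (extChartAt 𝓘(ℂ, E) x).symm) (extChartAt 𝓘(ℂ, E) x y) := by
  rw [contMDiffAt_iff_source_of_mem_source hy, contMDiffWithinAt_iff_contDiffWithinAt]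
  rw [← contDiffWithinAt_univ]
  simp

/-- Every point of a smooth hypersurface has an open neighbourhood with a local equation. -/
lemma exists_localEquation [CompleteSpace E] (D : SmoothHypersurface E X) {x : X}
    (hx : x ∈ D.carrier) {W : Set X} (hW : IsOpen W) (hxW : x ∈ W) :
    ∃ V ⊆ W, x ∈ V ∧ ∃ f, IsLocalEquation D V f := by
  obtain ⟨f, hf, hdf, hzero⟩ := D.exists_submersion x hx
  have h1 : ∀ᶠ y in 𝓝 x, ContMDiffAt 𝓘(ℂ, E) 𝓘(ℂ, ℂ) ω f y :=
    (contMDiffAt_iff_contMDiffAt_nhds (by simp)).1 hf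
  have h2 : ∀ᶠ y in 𝓝 x,
      fderiv ℂ (f ∘ (extChartAt 𝓘(ℂ, E) x).symm) (extChartAt 𝓘(ℂ, E) x y) ≠ 0 := by
    have hF := holo_contDiffAt hf
    have hc : ContinuousAt (fderiv ℂ (f ∘ (extChartAt 𝓘(ℂ, E) x).symm))
        (extChartAt 𝓘(ℂ, E) x x) := (hF.fderiv_right (m := ω) (by simp)).continuousAt
    have hc' := ContinuousAt.comp (f := extChartAt 𝓘(ℂ, E) x) hc (continuousAt_extChartAt x)
    refine hc'.eventually_ne ?_
    rw [Function.comp_apply, ← holo_mfderiv hf]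
    exact hdf
  have h3 : ∀ᶠ y in 𝓝 x, y ∈ (chartAt E x).source :=
    (chartAt E x).open_source.mem_nhds (mem_chart_source E x)
  obtain ⟨V, hV, hVo, hxV⟩ := eventually_nhds_iff.1
    (((h1.and h2).and (h3.and hzero)).and (hW.mem_nhds hxW))
  refine ⟨V, fun y hy => (hV y hy).2, hxV, f, hVo, fun y hy => (hV y hy).1.1.1,
    fun y hy => (hV y hy.1).1.2.2.1 hy.2, ?_⟩
  intro y hy g hg hgz
  obtain ⟨⟨⟨hfy, hdfy⟩, hys, hyD⟩, -⟩ := hV y hy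
  by_cases hyd : y ∈ D.carrier
  · set φ := extChartAt 𝓘(ℂ, E) x with hφ
    have hyφ : y ∈ φ.source := by rwa [hφ, extChartAt_source]
    have ht : Tendsto φ.symm (𝓝 (φ y)) (𝓝 y) := by
      have := (continuousAt_extChartAt_symm' (I := 𝓘(ℂ, E)) hyφ).tendsto
      rwa [← hφ, φ.left_inv hyφ] at this
    obtain ⟨H, hH, hH'⟩ := exists_div (f := f ∘ φ.symm) (g := g ∘ φ.symm) (a := φ y)
      ((holo_iff_chart hys).1 hfy) ((holo_iff_chart hys).1 hg)
      (by rw [Function.comp_apply, φ.left_inv hyφ]; exact hyD.1 hyd) hdfy (by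
        filter_upwards [ht.eventually hgz, ht.eventually (hVo.mem_nhds hy)] with z hz1 hz2 hz3
        exact hz1 ((hV _ hz2).1.2.2.2 hz3))
    have hφc : Tendsto φ (𝓝 y) (𝓝 (φ y)) := continuousAt_extChartAt' hyφ
    refine ⟨H ∘ φ, (holo_iff_chart hys).2 ?_, ?_⟩
    · refine hH.congr_of_eventuallyEq ?_
      filter_upwards [(isOpen_extChartAt_target (I := 𝓘(ℂ, E)) x).mem_nhds
        (φ.map_source hyφ)] with z hz
      simp only [Function.comp_apply, ← hφ, φ.right_inv hz]
    · filter_upwards [hφc.eventually hH', (isOpen_extChartAt_source (I := 𝓘(ℂ, E)) x).mem_nhds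
        hyφ] with z hz1 hz2
      simpa [φ.left_inv hz2] using hz1
  · have hne : f y ≠ 0 := fun h => hyd (hyD.2 h)
    refine ⟨fun z => g z * (f z)⁻¹, ?_, ?_⟩
    · rw [holo_iff_chart hys] at hfy hg ⊢
      have hne' : (f ∘ (extChartAt 𝓘(ℂ, E) x).symm) (extChartAt 𝓘(ℂ, E) x y) ≠ 0 := by
        rw [Function.comp_apply, PartialEquiv.left_inv]
        · exact hne
        · rwa [extChartAt_source]
      exact hg.mul (hfy.inv hne')
    · filter_upwards [hfy.continuousAt.eventually_ne hne] with z hz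
      field_simp

/-- A `(p, 0)`-form `α`, given off `D`, extends smoothly to a neighbourhood of `x`. Since the
complement of `D` is dense, extensions are unique, so that a form which extends smoothly to a
neighbourhood of each point of an open set `V` extends smoothly to `V`. -/
def ExtendsSmoothlyAt {p : ℕ} (D : SmoothHypersurface E X) (α : X → E [⋀^Fin p]→L[ℂ] ℂ) (x : X) :
    Prop :=
  ∃ β : X → E [⋀^Fin p]→L[ℂ] ℂ, ∀ᶠ y in 𝓝 x, SmoothFormAt β y ∧ (y ∉ D.carrier → β y = α y)

variable {D : SmoothHypersurface E X} {p : ℕ} {α β : X → E [⋀^Fin p]→L[ℂ] ℂ} {x : X}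

lemma holo_eventually {f : X → ℂ} (hf : ContMDiffAt 𝓘(ℂ, E) 𝓘(ℂ, ℂ) ω f x) :
    ∀ᶠ y in 𝓝 x, ContMDiffAt 𝓘(ℂ, E) 𝓘(ℂ, ℂ) ω f y :=
  (contMDiffAt_iff_contMDiffAt_nhds (by simp)).1 hf

lemma ExtendsSmoothlyAt.congr (h : ExtendsSmoothlyAt D α x)
    (hαβ : ∀ᶠ y in 𝓝 x, y ∉ D.carrier → α y = β y) : ExtendsSmoothlyAt D β x := by
  obtain ⟨γ, hγ⟩ := h
  refine ⟨γ, ?_⟩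
  filter_upwards [hγ, hαβ] with y h1 h2
  exact ⟨h1.1, fun hy => (h1.2 hy).trans (h2 hy)⟩

lemma ExtendsSmoothlyAt.add (hα : ExtendsSmoothlyAt D α x) (hβ : ExtendsSmoothlyAt D β x) :
    ExtendsSmoothlyAt D (fun y => α y + β y) x := by
  obtain ⟨γ, hγ⟩ := hα
  obtain ⟨δ, hδ⟩ := hβ
  refine ⟨fun y => γ y + δ y, ?_⟩
  filter_upwards [hγ, hδ] with y h1 h2
  exact ⟨h1.1.add h2.1, fun hy => by rw [h1.2 hy, h2.2 hy]⟩

lemma ExtendsSmoothlyAt.smul {f : X → ℂ} (hf : ContMDiffAt 𝓘(ℂ, E) 𝓘(ℂ, ℂ) ω f x)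
    (hα : ExtendsSmoothlyAt D α x) : ExtendsSmoothlyAt D (fun y => f y • α y) x := by
  obtain ⟨γ, hγ⟩ := hα
  refine ⟨fun y => f y • γ y, ?_⟩
  filter_upwards [hγ, holo_eventually hf] with y h1 h2
  exact ⟨h1.1.smul h2, fun hy => by rw [h1.2 hy]⟩

lemma ExtendsSmoothlyAt.const_smul (c : ℂ) (hα : ExtendsSmoothlyAt D α x) :
    ExtendsSmoothlyAt D (fun y => c • α y) x :=
  ExtendsSmoothlyAt.smul (f := fun _ => c) contMDiffAt_const hα

lemma ExtendsSmoothlyAt.neg (hα : ExtendsSmoothlyAt D α x) :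
    ExtendsSmoothlyAt D (fun y => - α y) x :=
  (hα.const_smul (-1)).congr (Eventually.of_forall fun y _ => neg_one_smul ℂ (α y))

lemma eventually_eq_off (hy : ∀ᶠ y in 𝓝 x, y ∉ D.carrier → β y = α y) :
    ∀ᶠ y in 𝓝 x, y ∉ D.carrier → β =ᶠ[𝓝 y] α := by
  filter_upwards [eventually_eventually_nhds.2 hy] with y h1 h2
  filter_upwards [h1, D.isClosed.isOpen_compl.mem_nhds h2] with z h3 h4
  exact h3 h4

lemma ExtendsSmoothlyAt.del (hα : ExtendsSmoothlyAt D α x) :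
    ExtendsSmoothlyAt D (DolbeaultLog.del α) x := by
  obtain ⟨γ, hγ⟩ := hα
  refine ⟨DolbeaultLog.del γ, ?_⟩
  filter_upwards [eventually_eventually_nhds.2 hγ, eventually_eq_off (hγ.mono fun y h => h.2)]
    with y h1 h2
  exact ⟨smoothFormAt_del (h1.mono fun z h => h.1), fun hy => del_congr (h2 hy)⟩

/-- Off `D`, a form which extends smoothly is smooth. -/
lemma ExtendsSmoothlyAt.eventually_smooth (hα : ExtendsSmoothlyAt D α x) :
    ∀ᶠ y in 𝓝 x, y ∉ D.carrier → SmoothFormAt α y := by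
  obtain ⟨γ, hγ⟩ := hα
  filter_upwards [hγ, eventually_eq_off (hγ.mono fun y h => h.2)] with y h1 h2 hy
  exact h1.1.congr (h2 hy)

lemma ExtendsSmoothlyAt.dWedge {f : X → ℂ} (hf : ContMDiffAt 𝓘(ℂ, E) 𝓘(ℂ, ℂ) ω f x)
    (hα : ExtendsSmoothlyAt D α x) : ExtendsSmoothlyAt D (DolbeaultLog.dWedge f α) x := by
  have h1 := ((hα.smul hf).del).add ((hα.del.smul hf).neg)
  refine h1.congr ?_
  filter_upwards [hα.eventually_smooth, holo_eventually hf] with y h2 h3 hy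
  rw [del_smul h3 (h2 hy)]
  abel

end Hypersurface

open CategoryTheory TopologicalSpace Opposite

section Sheaves

variable {E : Type} [NormedAddCommGroup E] [NormedSpace ℂ E]
  {X : Type} [TopologicalSpace X] [ChartedSpace E X] [IsManifold 𝓘(ℂ, E) ω X]

/-- Arbitrary (not necessarily continuous) `(p, 0)`-forms on `U ∖ D`. -/
abbrev FormOff (D : SmoothHypersurface E X) (p : ℕ) (U : Opens X) : Type :=
  ↥((U : Set X) \ D.carrier) → E [⋀^Fin p]→L[ℂ] ℂ

variable {D : SmoothHypersurface E X} {p : ℕ} {U V : Opens X}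

/-- Extension by zero of a form on `U ∖ D` to a (discontinuous) form on `X`. Only its values near
points of `U ∖ D` matter; it serves to evaluate notions which are defined for forms on `X`. -/
noncomputable def FormOff.ext0 (α : FormOff D p U) : X → E [⋀^Fin p]→L[ℂ] ℂ :=
  Function.extend Subtype.val α 0

/-- Restriction of forms to a smaller open set. -/
def FormOff.restrict (h : V ≤ U) (α : FormOff D p U) : FormOff D p V :=
  fun x => α ⟨x.1, h x.2.1, x.2.2⟩

/-- The operator `∂` on forms on `U ∖ D`. -/
noncomputable def FormOff.del (α : FormOff D p U) : FormOff D (p + 1) U :=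
  fun x => DolbeaultLog.del α.ext0 x.1

lemma smul_zero_form (c : ℂ) : c • (0 : E [⋀^Fin p]→L[ℂ] ℂ) = 0 := by
  ext v; simp

lemma zero_smul_form (a : E [⋀^Fin p]→L[ℂ] ℂ) : (0 : ℂ) • a = 0 := by
  ext v; simp

lemma FormOff.ext0_apply (α : FormOff D p U) {x : X} (hx : x ∈ (U : Set X) \ D.carrier) :
    α.ext0 x = α ⟨x, hx⟩ :=
  Subtype.val_injective.extend_apply α 0 ⟨x, hx⟩

lemma FormOff.ext0_of_notMem (α : FormOff D p U) {x : X} (hx : x ∉ (U : Set X) \ D.carrier) :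
    α.ext0 x = 0 :=
  Function.extend_apply' _ _ _ (by rintro ⟨y, rfl⟩; exact hx y.2)

lemma FormOff.ext0_restrict (h : V ≤ U) (α : FormOff D p U) {x : X} (hx : x ∈ V) :
    (α.restrict h).ext0 x = α.ext0 x := by
  by_cases hD : x ∈ D.carrier
  · rw [ext0_of_notMem _ fun h => h.2 hD, ext0_of_notMem _ fun h => h.2 hD]
  · rw [ext0_apply _ ⟨hx, hD⟩, ext0_apply _ ⟨h hx, hD⟩]; rfl

lemma FormOff.ext0_restrict_eventuallyEq (h : V ≤ U) (α : FormOff D p U) {x : X} (hx : x ∈ V) :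
    (α.restrict h).ext0 =ᶠ[𝓝 x] α.ext0 :=
  Filter.eventuallyEq_of_mem (V.isOpen.mem_nhds hx) fun _ hy => ext0_restrict h α hy

lemma FormOff.ext0_add (α β : FormOff D p U) : (α + β).ext0 = fun x => α.ext0 x + β.ext0 x := by
  funext x
  by_cases hx : x ∈ (U : Set X) \ D.carrier
  · simp only [ext0_apply _ hx]; rfl
  · simp only [ext0_of_notMem _ hx, add_zero]

lemma FormOff.ext0_smul (c : ℂ) (α : FormOff D p U) : (c • α).ext0 = fun x => c • α.ext0 x := by
  funext x
  by_cases hx : x ∈ (U : Set X) \ D.carrier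
  · simp only [ext0_apply _ hx]; rfl
  · simp only [ext0_of_notMem _ hx, smul_zero_form]

lemma FormOff.ext0_zero : (0 : FormOff D p U).ext0 = fun _ => 0 := by
  funext x
  by_cases hx : x ∈ (U : Set X) \ D.carrier
  · simp only [ext0_apply _ hx]; rfl
  · simp only [ext0_of_notMem _ hx]

lemma FormOff.mem_nhds {x : X} (hx : x ∈ (U : Set X) \ D.carrier) :
    (U : Set X) \ D.carrier ∈ 𝓝 x :=
  (U.isOpen.sdiff D.isClosed).mem_nhds hx

lemma FormOff.ext0_del_eventuallyEq (α : FormOff D p U) {x : X} (hx : x ∈ U) :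
    ∀ᶠ y in 𝓝 x, y ∉ D.carrier → α.del.ext0 y = DolbeaultLog.del α.ext0 y := by
  filter_upwards [U.isOpen.mem_nhds hx] with y hy hyD
  rw [ext0_apply _ ⟨hy, hyD⟩]; rfl

lemma FormOff.restrict_del (h : V ≤ U) (α : FormOff D p U) :
    (α.restrict h).del = α.del.restrict h := by
  funext x
  exact del_congr (ext0_restrict_eventuallyEq h α x.2.1)

/-- Smoothness of a form on `U ∖ D`. -/
def FormOff.IsSmooth (α : FormOff D p U) : Prop :=
  ∀ x ∈ (U : Set X) \ D.carrier, SmoothFormAt α.ext0 x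

lemma FormOff.IsSmooth.eventually {α : FormOff D p U} (h : α.IsSmooth) {x : X}
    (hx : x ∈ (U : Set X) \ D.carrier) : ∀ᶠ y in 𝓝 x, SmoothFormAt α.ext0 y :=
  Filter.Eventually.mono (Filter.eventually_mem_set.2 (mem_nhds hx)) h

lemma FormOff.IsSmooth.eventually' {α : FormOff D p U} (h : α.IsSmooth) {x : X}
    (hx : x ∈ U) : ∀ᶠ y in 𝓝 x, y ∉ D.carrier → SmoothFormAt α.ext0 y := by
  filter_upwards [U.isOpen.mem_nhds hx] with y hy hyD
  exact h y ⟨hy, hyD⟩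

lemma smoothFormAt_zero (x : X) : SmoothFormAt (fun _ : X => (0 : E [⋀^Fin p]→L[ℂ] ℂ)) x := by
  have : chartRep x (fun _ : X => (0 : E [⋀^Fin p]→L[ℂ] ℂ)) = fun _ => 0 := by
    funext y; ext v; simp [chartRep]
  rw [SmoothFormAt, this]
  exact contDiffAt_const

lemma extendsSmoothlyAt_zero (x : X) :
    ExtendsSmoothlyAt D (fun _ : X => (0 : E [⋀^Fin p]→L[ℂ] ℂ)) x :=
  ⟨fun _ => 0, Eventually.of_forall fun y => ⟨smoothFormAt_zero y, fun _ => rfl⟩⟩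

lemma FormOff.IsSmooth.zero : (0 : FormOff D p U).IsSmooth := fun x _ => by
  rw [ext0_zero]; exact smoothFormAt_zero x

lemma FormOff.IsSmooth.add {α β : FormOff D p U} (hα : α.IsSmooth) (hβ : β.IsSmooth) :
    (α + β).IsSmooth := fun x hx => by
  rw [ext0_add]; exact (hα x hx).add (hβ x hx)

lemma FormOff.IsSmooth.smul (c : ℂ) {α : FormOff D p U} (hα : α.IsSmooth) :
    (c • α).IsSmooth := fun x hx => by
  rw [ext0_smul]; exact (hα x hx).const_smul c

lemma FormOff.IsSmooth.restrict (h : V ≤ U) {α : FormOff D p U} (hα : α.IsSmooth) :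
    (α.restrict h).IsSmooth := fun x hx =>
  (hα x ⟨h hx.1, hx.2⟩).congr (ext0_restrict_eventuallyEq h α hx.1).symm

lemma FormOff.IsSmooth.del {α : FormOff D p U} (hα : α.IsSmooth) : α.del.IsSmooth := fun x hx => by
  refine (smoothFormAt_del (hα.eventually hx)).congr ?_
  filter_upwards [mem_nhds hx] with y hy
  exact (ext0_apply α.del hy).symm

variable (D) in
/-- A subsheaf of complex vector spaces, stable under `∂`, of the pushforward to `X` of the sheaves
of smooth `(p, 0)`-forms on `X ∖ D`, where `p` varies. -/
structure FormSubsheaf where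
  /-- The space of sections on `U`, consisting of forms on `U ∖ D`. -/
  sec : ∀ (p : ℕ) (U : Opens X), Submodule ℂ (FormOff D p U)
  smooth : ∀ {p U} {α : FormOff D p U}, α ∈ sec p U → α.IsSmooth
  restrict_mem : ∀ {p U V} (h : V ≤ U) {α : FormOff D p U}, α ∈ sec p U → α.restrict h ∈ sec p V
  local_mem : ∀ {p U} {α : FormOff D p U},
    (∀ x ∈ U, ∃ V, ∃ h : V ≤ U, x ∈ V ∧ α.restrict h ∈ sec p V) → α ∈ sec p U
  del_mem : ∀ {p U} {α : FormOff D p U}, α ∈ sec p U → α.del ∈ sec (p + 1) U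

lemma holo_pow {f : X → ℂ} {x : X} (hf : ContMDiffAt 𝓘(ℂ, E) 𝓘(ℂ, ℂ) ω f x) (m : ℕ) :
    ContMDiffAt 𝓘(ℂ, E) 𝓘(ℂ, ℂ) ω (fun z => f z ^ m) x := by
  rw [holo_iff_chart (mem_chart_source E x)] at hf ⊢
  exact hf.pow m

lemma wedgeOne_add (θ : E →L[ℂ] ℂ) (a b : E [⋀^Fin p]→L[ℂ] ℂ) :
    wedgeOne θ (a + b) = wedgeOne θ a + wedgeOne θ b := by
  ext v
  simp [wedgeOne, ContinuousAlternatingMap.alternatizeUncurryFin_apply, mul_add,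
    Finset.sum_add_distrib]

lemma wedgeOne_smul (θ : E →L[ℂ] ℂ) (c : ℂ) (a : E [⋀^Fin p]→L[ℂ] ℂ) :
    wedgeOne θ (c • a) = c • wedgeOne θ a := by
  ext v
  simp only [wedgeOne, ContinuousAlternatingMap.alternatizeUncurryFin_apply,
    ContinuousLinearMap.smulRight_apply, ContinuousAlternatingMap.smul_apply, smul_eq_mul,
    Finset.mul_sum]
  refine Finset.sum_congr rfl fun i _ => ?_
  rw [mul_smul_comm]
  congr 1
  ring

lemma wedgeOne_smul_left (θ : E →L[ℂ] ℂ) (c : ℂ) (a : E [⋀^Fin p]→L[ℂ] ℂ) :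
    wedgeOne (c • θ) a = c • wedgeOne θ a := by
  rw [← wedgeOne_smul, wedgeOne, wedgeOne]
  congr 1
  ext w v
  simp
  ring

lemma dWedge_add (f : X → ℂ) (α β : X → E [⋀^Fin p]→L[ℂ] ℂ) :
    dWedge f (fun x => α x + β x) = fun x => dWedge f α x + dWedge f β x :=
  funext fun _ => wedgeOne_add _ _ _

lemma dWedge_smul (f g : X → ℂ) (α : X → E [⋀^Fin p]→L[ℂ] ℂ) :
    dWedge f (fun x => g x • α x) = fun x => g x • dWedge f α x :=
  funext fun _ => wedgeOne_smul _ _ _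

lemma dWedge_zero (f : X → ℂ) :
    dWedge f (fun _ : X => (0 : E [⋀^Fin p]→L[ℂ] ℂ)) = fun _ => 0 := by
  have h := dWedge_smul f (fun _ => 0) (fun _ : X => (0 : E [⋀^Fin p]→L[ℂ] ℂ))
  simp only [smul_zero_form, zero_smul_form] at h
  exact h

lemma dWedge_pow {f : X → ℂ} {x : X} (hf : ContMDiffAt 𝓘(ℂ, E) 𝓘(ℂ, ℂ) ω f x) (m : ℕ)
    (α : X → E [⋀^Fin p]→L[ℂ] ℂ) :
    dWedge (fun z => f z ^ m) α x = ((m : ℂ) * f x ^ (m - 1)) • dWedge f α x := by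
  rw [dWedge, holo_mfderiv (holo_pow hf m), dWedge, holo_mfderiv hf, ← wedgeOne_smul_left]
  congr 1
  have h := ((holo_contDiffAt hf).differentiableAt (by simp)).hasFDerivAt.pow m
  have h2 := h.fderiv
  rw [Function.comp_apply, extChartAt_to_inv] at h2
  refine Eq.trans ?_ (h2.trans ?_)
  · rfl
  · simp

/-- Forms with poles can be added: a common order of the poles. -/
lemma pole_add {α β : X → E [⋀^Fin p]→L[ℂ] ℂ} {x : X} {V W : Set X} {f g : X → ℂ} {m k : ℕ}
    (hV : IsLocalEquation D V f) (hW : IsLocalEquation D W g) (hxV : x ∈ V) (hxW : x ∈ W)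
    (hα : ∀ y ∈ V, ExtendsSmoothlyAt D (fun z => f z ^ m • α z) y)
    (hβ : ∀ y ∈ W, ExtendsSmoothlyAt D (fun z => g z ^ k • β z) y) :
    ∃ T ⊆ V, x ∈ T ∧ IsLocalEquation D T f ∧
      ∀ y ∈ T, ExtendsSmoothlyAt D (fun z => f z ^ (m + k) • (α z + β z)) y := by
  obtain ⟨h, hh, hfg⟩ := hW.generates x hxW f (hV.holo x hxV) (by
    filter_upwards [hV.isOpen.mem_nhds hxV] with y hy hyD
    exact hV.vanish y ⟨hy, hyD⟩)
  obtain ⟨T, hT, hTo, hxT⟩ := eventually_nhds_iff.1 ((hfg.and (holo_eventually hh)).and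
    ((Filter.eventually_mem_set.2 (hV.isOpen.mem_nhds hxV)).and
      (Filter.eventually_mem_set.2 (hW.isOpen.mem_nhds hxW))))
  refine ⟨T, fun y hy => (hT y hy).2.1, hxT, hV.mono hTo fun y hy => (hT y hy).2.1, ?_⟩
  intro y hy
  obtain ⟨⟨-, hhy⟩, hyV, hyW⟩ := hT y hy
  have hfy := hV.holo y hyV
  have h1 := (hα y hyV).smul (holo_pow hfy k)
  have h2 := ((hβ y hyW).smul (holo_pow hhy k)).smul (holo_pow hfy m)
  refine (h1.add h2).congr ?_
  filter_upwards [hTo.mem_nhds hy] with z hz _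
  have e : f z = g z * h z := (hT z hz).1.1
  have e' : h z ^ k • g z ^ k • β z = f z ^ k • β z := by
    rw [smul_smul, e, mul_pow, mul_comm]
  rw [e', smul_add, smul_smul, smul_smul, pow_add, mul_comm (f z ^ k)]

variable [FiniteDimensional ℂ E]

/-- The sections on `U` of the sheaf `𝒜^{p,0}(*D)`: smooth `(p, 0)`-forms `α` on `U ∖ D` such that,
near every point of `D`, `f ^ m α` extends smoothly for some local equation `f` and some `m`. -/
noncomputable def polarSections (D : SmoothHypersurface E X) (p : ℕ) (U : Opens X) :
    Submodule ℂ (FormOff D p U) where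
  carrier := {α | α.IsSmooth ∧ ∀ x ∈ (U : Set X) ∩ D.carrier,
    ∃ V ⊆ (U : Set X), x ∈ V ∧ ∃ f, IsLocalEquation D V f ∧
      ∃ m : ℕ, ∀ y ∈ V, ExtendsSmoothlyAt D (fun z => f z ^ m • α.ext0 z) y}
  zero_mem' := by
    have := FiniteDimensional.complete ℂ E
    refine ⟨FormOff.IsSmooth.zero, fun x hx => ?_⟩
    obtain ⟨V, hVU, hxV, f, hf⟩ := exists_localEquation D hx.2 U.isOpen hx.1
    refine ⟨V, hVU, hxV, f, hf, 0, fun y _ => ?_⟩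
    rw [FormOff.ext0_zero]
    simp only [smul_zero_form]
    exact extendsSmoothlyAt_zero y
  add_mem' := by
    rintro α β ⟨hα, hα'⟩ ⟨hβ, hβ'⟩
    refine ⟨hα.add hβ, fun x hx => ?_⟩
    obtain ⟨V, hVU, hxV, f, hf, m, hm⟩ := hα' x hx
    obtain ⟨W, hWU, hxW, g, hg, k, hk⟩ := hβ' x hx
    obtain ⟨T, hTV, hxT, hfT, hT⟩ := pole_add hf hg hxV hxW hm hk
    exact ⟨T, hTV.trans hVU, hxT, f, hfT, m + k, by rwa [FormOff.ext0_add]⟩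
  smul_mem' := by
    rintro c α ⟨hα, hα'⟩
    refine ⟨hα.smul c, fun x hx => ?_⟩
    obtain ⟨V, hVU, hxV, f, hf, m, hm⟩ := hα' x hx
    refine ⟨V, hVU, hxV, f, hf, m, fun y hy => ?_⟩
    refine ((hm y hy).const_smul c).congr (Eventually.of_forall fun z _ => ?_)
    rw [FormOff.ext0_smul, smul_comm]

/-- The sections on `U` of the sheaf `𝒜^{p,0}⟨D⟩`: smooth `(p, 0)`-forms `α` on `U ∖ D` such that
`f α` and `df ∧ α` extend smoothly for any local equation `f`. -/
noncomputable def logSections (D : SmoothHypersurface E X) (p : ℕ) (U : Opens X) :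
    Submodule ℂ (FormOff D p U) where
  carrier := {α | α.IsSmooth ∧ ∀ V ⊆ (U : Set X), ∀ f, IsLocalEquation D V f → ∀ x ∈ V,
    ExtendsSmoothlyAt D (fun z => f z • α.ext0 z) x ∧ ExtendsSmoothlyAt D (dWedge f α.ext0) x}
  zero_mem' := by
    refine ⟨FormOff.IsSmooth.zero, fun V _ f hf x _ => ?_⟩
    rw [FormOff.ext0_zero, dWedge_zero]
    simp only [smul_zero_form]
    exact ⟨extendsSmoothlyAt_zero x, extendsSmoothlyAt_zero x⟩
  add_mem' := by
    rintro α β ⟨hα, hα'⟩ ⟨hβ, hβ'⟩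
    refine ⟨hα.add hβ, fun V hV f hf x hx => ?_⟩
    rw [FormOff.ext0_add, dWedge_add]
    simp only [smul_add]
    exact ⟨(hα' V hV f hf x hx).1.add (hβ' V hV f hf x hx).1,
      (hα' V hV f hf x hx).2.add (hβ' V hV f hf x hx).2⟩
  smul_mem' := by
    rintro c α ⟨hα, hα'⟩
    refine ⟨hα.smul c, fun V hV f hf x hx => ?_⟩
    rw [FormOff.ext0_smul, dWedge_smul f (fun _ => c)]
    refine ⟨((hα' V hV f hf x hx).1.const_smul c).congr (Eventually.of_forall fun z _ => ?_),
      (hα' V hV f hf x hx).2.const_smul c⟩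
    rw [smul_comm]

variable (D) in
/-- The sheaves `𝒜^{p,0}(*D)` of smooth `(p, 0)`-forms with arbitrary poles on `D`. -/
noncomputable def polar : FormSubsheaf D where
  sec := polarSections D
  smooth h := h.1
  restrict_mem := by
    rintro p U V h α ⟨hα, hα'⟩
    refine ⟨hα.restrict h, fun x hx => ?_⟩
    obtain ⟨T, hTU, hxT, f, hf, m, hm⟩ := hα' x ⟨h hx.1, hx.2⟩
    refine ⟨T ∩ V, inter_subset_right, ⟨hxT, hx.1⟩, f,
      hf.mono (hf.isOpen.inter V.isOpen) inter_subset_left, m, fun y hy => ?_⟩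
    refine (hm y hy.1).congr ?_
    filter_upwards [FormOff.ext0_restrict_eventuallyEq h α hy.2] with z hz _
    rw [hz]
  local_mem := by
    intro p U α hα
    refine ⟨fun x hx => ?_, fun x hx => ?_⟩
    · obtain ⟨V, h, hxV, hV⟩ := hα x hx.1
      exact (hV.1 x ⟨hxV, hx.2⟩).congr (FormOff.ext0_restrict_eventuallyEq h α hxV)
    · obtain ⟨V, h, hxV, hV⟩ := hα x hx.1
      obtain ⟨T, hTV, hxT, f, hf, m, hm⟩ := hV.2 x ⟨hxV, hx.2⟩
      refine ⟨T, hTV.trans h, hxT, f, hf, m, fun y hy => (hm y hy).congr ?_⟩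
      filter_upwards [FormOff.ext0_restrict_eventuallyEq h α (hTV hy)] with z hz _
      rw [hz]
  del_mem := by
    rintro p U α ⟨hα, hα'⟩
    refine ⟨hα.del, fun x hx => ?_⟩
    obtain ⟨V, hVU, hxV, f, hf, m, hm⟩ := hα' x hx
    refine ⟨V, hVU, hxV, f, hf, m + 1, fun y hy => ?_⟩
    -- `f ^ (m + 1) ∂α = f ∂(f ^ m α) - m df ∧ f ^ m α`
    have hfy := hf.holo y hy
    have h1 := ((hm y hy).del.smul hfy).add (((hm y hy).dWedge hfy).const_smul (-(m : ℂ)))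
    refine h1.congr ?_
    filter_upwards [hα.eventually' (hVU hy), holo_eventually hfy,
      α.ext0_del_eventuallyEq (hVU hy)] with z hz1 hz2 hz3 hzD
    rw [hz3 hzD, del_smul (holo_pow hz2 m) (hz1 hzD), dWedge_smul]
    rw [dWedge_pow hz2]
    rcases m with _ | m
    · simp only [Nat.cast_zero, neg_zero, zero_smul_form, zero_mul, pow_zero, zero_add, one_smul,
        add_zero, pow_one]
    · simp only [Nat.add_sub_cancel, pow_succ]
      module

variable (D) in
/-- The sheaves `𝒜^{p,0}⟨D⟩` of smooth logarithmic `(p, 0)`-forms. -/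
noncomputable def logarithmic : FormSubsheaf D where
  sec := logSections D
  smooth h := h.1
  restrict_mem := by
    rintro p U V h α ⟨hα, hα'⟩
    refine ⟨hα.restrict h, fun T hT f hf x hx => ?_⟩
    have hev := FormOff.ext0_restrict_eventuallyEq h α (hT hx)
    refine ⟨(hα' T (hT.trans h) f hf x hx).1.congr ?_, (hα' T (hT.trans h) f hf x hx).2.congr ?_⟩
    · filter_upwards [hev] with z hz _
      rw [hz]
    · filter_upwards [hev] with z hz _
      rw [dWedge, dWedge, hz]
  local_mem := by
    intro p U α hα
    refine ⟨fun x hx => ?_, fun T hT f hf x hx => ?_⟩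
    · obtain ⟨V, h, hxV, hV⟩ := hα x hx.1
      exact (hV.1 x ⟨hxV, hx.2⟩).congr (FormOff.ext0_restrict_eventuallyEq h α hxV)
    · obtain ⟨V, h, hxV, hV⟩ := hα x (hT hx)
      obtain ⟨h1, h2⟩ := hV.2 (T ∩ V) inter_subset_right f
        (hf.mono (hf.isOpen.inter V.isOpen) inter_subset_left) x ⟨hx, hxV⟩
      have hev := FormOff.ext0_restrict_eventuallyEq h α hxV
      refine ⟨h1.congr ?_, h2.congr ?_⟩
      · filter_upwards [hev] with z hz _
        rw [hz]
      · filter_upwards [hev] with z hz _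
        rw [dWedge, dWedge, hz]
  del_mem := by
    rintro p U α ⟨hα, hα'⟩
    refine ⟨hα.del, fun V hV f hf x hx => ?_⟩
    obtain ⟨h1, h2⟩ := hα' V hV f hf x hx
    have hfx := hf.holo x hx
    -- `f ∂α = ∂(f α) - df ∧ α` and `df ∧ ∂α = -∂(df ∧ α)`
    refine ⟨(h1.del.add h2.neg).congr ?_, h2.del.neg.congr ?_⟩
    · filter_upwards [hα.eventually' (hV hx), holo_eventually hfx,
        α.ext0_del_eventuallyEq (hV hx)] with z hz1 hz2 hz3 hzD
      rw [hz3 hzD, del_smul hz2 (hz1 hzD)]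
      abel
    · filter_upwards [(eventually_eventually_nhds.2 (hα.eventually' (hV hx))),
        eventually_eventually_nhds.2 (holo_eventually hfx),
        α.ext0_del_eventuallyEq (hV hx), eventually_eventually_nhds.2 h2.eventually_smooth]
        with z hz1 hz2 hz3 hz4 hzD
      have hoff : ∀ᶠ w in 𝓝 z, w ∉ D.carrier := D.isClosed.isOpen_compl.mem_nhds hzD
      have hs : ∀ᶠ w in 𝓝 z, SmoothFormAt α.ext0 w := by
        filter_upwards [hz1, hoff] with w h1 h2 using h1 h2
      have hd : ∀ᶠ w in 𝓝 z, SmoothFormAt (DolbeaultLog.del α.ext0) w := by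
        filter_upwards [eventually_eventually_nhds.2 hs] with w hw using smoothFormAt_del hw
      have hfα : ∀ᶠ w in 𝓝 z, SmoothFormAt (fun w => f w • α.ext0 w) w := by
        filter_upwards [hs, hz2] with w h1 h2 using h1.smul h2
      have hw4 : SmoothFormAt (dWedge f α.ext0) z := hz4.self_of_nhds hzD
      have key : (DolbeaultLog.del fun w => f w • α.ext0 w) =ᶠ[𝓝 z]
          fun w => dWedge f α.ext0 w + f w • DolbeaultLog.del α.ext0 w := by
        filter_upwards [hs, hz2] with w h1 h2 using del_smul h2 h1
      have k0 := del_del hfα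
      rw [del_congr key, del_add hw4 (hd.self_of_nhds.smul hz2.self_of_nhds),
        del_smul hz2.self_of_nhds hd.self_of_nhds, del_del hs, smul_zero_form, add_zero] at k0
      rw [dWedge, hz3 hzD, ← dWedge]
      exact neg_eq_of_add_eq_zero_right k0

lemma log_le_polar (p : ℕ) (U : Opens X) : (logarithmic D).sec p U ≤ (polar D).sec p U := by
  have := FiniteDimensional.complete ℂ E
  rintro α ⟨hα, hα'⟩
  refine ⟨hα, fun x hx => ?_⟩
  obtain ⟨V, hVU, hxV, f, hf⟩ := exists_localEquation D hx.2 U.isOpen hx.1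
  refine ⟨V, hVU, hxV, f, hf, 1, fun y hy => ?_⟩
  simpa using (hα' V hVU f hf y hy).1

end Sheaves

section Complexes

variable {E : Type} [NormedAddCommGroup E] [NormedSpace ℂ E]
  {X : Type} [TopologicalSpace X] [ChartedSpace E X] [IsManifold 𝓘(ℂ, E) ω X]
  {D : SmoothHypersurface E X}

lemma FormOff.del_add {p : ℕ} {U : Opens X} {α β : FormOff D p U} (hα : α.IsSmooth)
    (hβ : β.IsSmooth) : (α + β).del = α.del + β.del := by
  funext x
  rw [FormOff.del, ext0_add]
  exact DolbeaultLog.del_add (hα x x.2) (hβ x x.2)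

lemma FormOff.del_smul (c : ℂ) {p : ℕ} {U : Opens X} {α : FormOff D p U} (hα : α.IsSmooth) :
    (c • α).del = c • α.del := by
  funext x
  rw [FormOff.del, ext0_smul]
  exact DolbeaultLog.del_const_smul c (hα x x.2)

lemma FormOff.del_del {p : ℕ} {U : Opens X} {α : FormOff D p U} (hα : α.IsSmooth) :
    α.del.del = 0 := by
  funext x
  have h : α.del.ext0 =ᶠ[𝓝 x.1] DolbeaultLog.del α.ext0 := by
    filter_upwards [mem_nhds x.2] with y hy
    exact ext0_apply _ hy
  exact (del_congr h).trans (DolbeaultLog.del_del (hα.eventually x.2))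

namespace FormSubsheaf

variable (S T : FormSubsheaf D)

/-- `∂` as a linear map between spaces of sections. -/
noncomputable def delLin (p : ℕ) (U : Opens X) : S.sec p U →ₗ[ℂ] S.sec (p + 1) U where
  toFun α := ⟨α.1.del, S.del_mem α.2⟩
  map_add' α β := Subtype.ext (FormOff.del_add (S.smooth α.2) (S.smooth β.2))
  map_smul' c α := Subtype.ext (FormOff.del_smul c (S.smooth α.2))

/-- Restriction as a linear map between spaces of sections. -/
noncomputable def resLin (p : ℕ) {U V : Opens X} (h : V ≤ U) : S.sec p U →ₗ[ℂ] S.sec p V where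
  toFun α := ⟨α.1.restrict h, S.restrict_mem h α.2⟩
  map_add' _ _ := rfl
  map_smul' _ _ := rfl

/-- The presheaf of complex vector spaces in degree `p`. -/
noncomputable def presheaf (p : ℕ) : TopCat.Presheaf (ModuleCat.{0} ℂ) (TopCat.of X) where
  obj U := ModuleCat.of ℂ (S.sec p U.unop)
  map {U V} i := ModuleCat.ofHom (S.resLin p (U := U.unop) (V := V.unop) (leOfHom i.unop))
  map_id _ := rfl
  map_comp _ _ := rfl

lemma isSheaf (p : ℕ) : (S.presheaf p).IsSheaf := by
  rw [TopCat.Presheaf.isSheaf_iff_isSheafUniqueGluing]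
  intro ι U sf hsf
  -- the compatible family, as a family of forms
  let a : ∀ i, FormOff D p (U i) := fun i => (sf i).1
  have ha : ∀ i, a i ∈ S.sec p (U i) := fun i => (sf i).2
  have hcomp : ∀ (i j : ι) (x : X) (hi : x ∈ ((U i : Opens X) : Set X) \ D.carrier)
      (hj : x ∈ ((U j : Opens X) : Set X) \ D.carrier), a i ⟨x, hi⟩ = a j ⟨x, hj⟩ := by
    intro i j x hi hj
    have h := congrArg Subtype.val (hsf i j)
    exact congrFun h ⟨x, ⟨hi.1, hj.1⟩, hi.2⟩
  have hmem : ∀ x : X, x ∈ ((iSup U : Opens X) : Set X) → ∃ i, x ∈ U i := by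
    intro x hx
    simpa using hx
  choose idx hidx using hmem
  let s : FormOff D p (iSup U : Opens X) := fun x => a (idx x x.2.1) ⟨x, hidx x x.2.1, x.2.2⟩
  have hres : ∀ i, s.restrict (le_iSup U i) = a i := by
    intro i
    funext x
    exact hcomp _ _ _ _ _
  have hs : s ∈ S.sec p (iSup U) := by
    refine S.local_mem fun x hx => ?_
    refine ⟨U (idx x hx), le_iSup U _, hidx x hx, ?_⟩
    rw [hres]
    exact ha _
  refine ⟨⟨s, hs⟩, fun i => Subtype.ext (hres i), ?_⟩
  rintro ⟨t, ht⟩ htg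
  refine Subtype.ext ?_
  funext x
  have h := congrArg Subtype.val (htg (idx x x.2.1))
  exact congrFun h ⟨x, hidx x x.2.1, x.2.2⟩

/-- The sheaf of complex vector spaces in degree `p`. -/
noncomputable def sheaf (p : ℕ) : TopCat.Sheaf (ModuleCat.{0} ℂ) (TopCat.of X) :=
  ⟨S.presheaf p, S.isSheaf p⟩

/-- `∂` as a morphism of sheaves. -/
noncomputable def d (p : ℕ) : S.sheaf p ⟶ S.sheaf (p + 1) :=
  ⟨{ app := fun U => ModuleCat.ofHom (S.delLin p U.unop)
     naturality := fun U V i => by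
      ext α
      exact Subtype.ext (FormOff.restrict_del (leOfHom i.unop) α.1) }⟩

/-- The complex of sheaves `(S^•, ∂)`. -/
noncomputable def complex : CochainComplex (TopCat.Sheaf (ModuleCat.{0} ℂ) (TopCat.of X)) ℕ :=
  CochainComplex.of S.sheaf S.d (fun p => by
    apply CategoryTheory.Sheaf.hom_ext
    ext U α
    exact Subtype.ext (FormOff.del_del (S.smooth α.2)))

variable {S T}

/-- The inclusion of complexes of sheaves induced by an inclusion of spaces of sections. -/
noncomputable def incl (h : ∀ p U, S.sec p U ≤ T.sec p U) : S.complex ⟶ T.complex :=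
  CochainComplex.ofHom
    (fun p => (⟨{ app := fun U => ModuleCat.ofHom (Submodule.inclusion (h p U.unop))
                  naturality := fun _ _ _ => rfl }⟩ : S.sheaf p ⟶ T.sheaf p))
    (fun p => by
      simp only [complex, CochainComplex.of_d]
      rfl)

variable (S)

/-- The space of compactly supported sections on `U`: the closure in `X` of the set of points where
the form does not vanish is a compact subset of `U` (it may meet `D`). -/
noncomputable def compactSec (p : ℕ) (U : Opens X) : Submodule ℂ (FormOff D p U) where
  carrier := {α | α ∈ S.sec p U ∧ HasCompactSupport α.ext0 ∧ tsupport α.ext0 ⊆ U}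
  zero_mem' := by
    refine ⟨zero_mem _, ?_, ?_⟩
    · rw [FormOff.ext0_zero]; exact HasCompactSupport.zero
    · rw [FormOff.ext0_zero, tsupport, Function.support_fun_zero, closure_empty]; exact empty_subset _
  add_mem' := by
    rintro α β ⟨h1, h2, h3⟩ ⟨k1, k2, k3⟩
    refine ⟨add_mem h1 k1, ?_, ?_⟩
    · rw [FormOff.ext0_add]; exact h2.add k2
    · rw [FormOff.ext0_add]
      exact (tsupport_add _ _).trans (union_subset h3 k3)
  smul_mem' := by
    rintro c α ⟨h1, h2, h3⟩
    have hs : Function.support (c • α).ext0 ⊆ Function.support α.ext0 := by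
      rw [FormOff.ext0_smul]
      exact Function.support_subset_iff'.2 fun x hx => by
        rw [Function.notMem_support.1 hx, smul_zero_form]
    exact ⟨Submodule.smul_mem _ c h1, h2.mono hs, (closure_mono hs).trans h3⟩

lemma del_mem_compactSec {p : ℕ} {U : Opens X} {α : FormOff D p U} (h : α ∈ S.compactSec p U) :
    α.del ∈ S.compactSec (p + 1) U := by
  obtain ⟨h1, h2, h3⟩ := h
  have hs : Function.support α.del.ext0 ⊆ tsupport α.ext0 := by
    refine Function.support_subset_iff'.2 fun x hx => ?_
    by_cases hxU : x ∈ (U : Set X) \ D.carrier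
    · rw [FormOff.ext0_apply _ hxU]
      refine (del_congr (notMem_tsupport_iff_eventuallyEq.1 hx)).trans ?_
      have := DolbeaultLog.del_const_smul 0 (smoothFormAt_zero (E := E) (p := p) x)
      simp only [smul_zero_form, zero_smul_form] at this
      exact this
    · exact FormOff.ext0_of_notMem _ hxU
  have hs' : tsupport α.del.ext0 ⊆ tsupport α.ext0 := closure_minimal hs (isClosed_tsupport _)
  exact ⟨S.del_mem h1, h2.mono' hs, hs'.trans h3⟩

/-- `∂` as a linear map between spaces of compactly supported sections. -/
noncomputable def compactDel (p : ℕ) (U : Opens X) :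
    S.compactSec p U →ₗ[ℂ] S.compactSec (p + 1) U where
  toFun α := ⟨α.1.del, S.del_mem_compactSec α.2⟩
  map_add' α β := Subtype.ext (FormOff.del_add (S.smooth α.2.1) (S.smooth β.2.1))
  map_smul' c α := Subtype.ext (FormOff.del_smul c (S.smooth α.2.1))

/-- The complex `(Γ_c(U, S^•), ∂)` of compactly supported sections on `U`. -/
noncomputable def compactComplex (U : Opens X) : CochainComplex (ModuleCat.{0} ℂ) ℕ :=
  CochainComplex.of (fun p => ModuleCat.of ℂ (S.compactSec p U))
    (fun p => ModuleCat.ofHom (S.compactDel p U)) (fun _ =>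
      ModuleCat.hom_ext (LinearMap.ext fun α =>
        Subtype.ext (FormOff.del_del (S.smooth α.2.1))))

variable {S}

/-- The inclusion of complexes of compactly supported sections. -/
noncomputable def compactIncl (h : ∀ p U, S.sec p U ≤ T.sec p U) (U : Opens X) :
    S.compactComplex U ⟶ T.compactComplex U :=
  CochainComplex.ofHom
    (fun p => ModuleCat.ofHom (Submodule.inclusion
      (fun _ hα => ⟨h p U hα.1, hα.2⟩ : S.compactSec p U ≤ T.compactSec p U)))
    (fun p => by
      simp only [compactComplex, CochainComplex.of_d]
      rfl)

end FormSubsheaf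

variable [FiniteDimensional ℂ E]

/-- The inclusion `(𝒜^{•,0}⟨D⟩, ∂) → (𝒜^{•,0}(*D), ∂)` of complexes of sheaves of complex vector
spaces on `X`. -/
noncomputable def logToPolar (D : SmoothHypersurface E X) :
    (logarithmic D).complex ⟶ (polar D).complex :=
  FormSubsheaf.incl log_le_polar

/-- The inclusion `(Γ_c(U, 𝒜^{•,0}⟨D⟩), ∂) → (Γ_c(U, 𝒜^{•,0}(*D)), ∂)` of complexes of compactly
supported sections. -/
noncomputable def logToPolarCompact (D : SmoothHypersurface E X) (U : Opens X) :
    (logarithmic D).compactComplex U ⟶ (polar D).compactComplex U :=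
  FormSubsheaf.compactIncl log_le_polar U

end Complexes

end DolbeaultLog

/-!
Near a point of `D` let `f` be a local equation and `u` a smooth vector field of type `(1, 0)` with
`df(u) = 1`. The complex `𝒜(*D)` is the union of the subcomplexes `f⁻ᵏ 𝒜⟨D⟩` (`PoleLE`, which does
not depend on `f` by `PoleLE.change`), and on `f⁻ᵏ 𝒜⟨D⟩ / f⁻ᵏ⁺¹ 𝒜⟨D⟩`, for `k ≥ 1`, the Lie
derivative `∂ ι + ι ∂` along the Euler field `f u` is multiplication by `- k`. Hence if `α` lies in
`f⁻ᵏ 𝒜⟨D⟩` and `∂α` is logarithmic, then `α + k⁻¹ ∂(ι α)` lies in `f⁻ᵏ⁺¹ 𝒜⟨D⟩`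
(`PoleLE.lowering`); in degree `0`, where there is no `ι α`, the form `α` itself does
(`PoleLE.lowering_zero`). The computation uses only the relations between `∂`, the multiplication by
`f`, the wedge product by `df` and the contraction with `u`; no adapted coordinates are needed.

To globalize, `u` is cut off by a bump function (`exists_eulerField`). Contraction with `f u` is then
defined on all of `X`, does not enlarge supports, and preserves each `f⁻ᵏ 𝒜⟨D⟩`, so that
`α + k⁻¹ ∂(ι α)` has no worse a pole than `α` anywhere and a better one where `df(u) = 1`. Applying
this for finitely many Euler fields in turn, and then for decreasing `k`, one writes `α` as the sum of
a logarithmic form and of `∂γ` with `γ` polar and supported in the support of `α`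
(`exists_add_del_mem_logarithmic`): near any given point for arbitrary sections, and globally for
sections with compact support, whose poles have bounded order. So the quotient complexes are acyclic,
which gives both quasi-isomorphisms by `quasiIso_of_epi_relMap`.
-/

set_option linter.unusedSectionVars false

namespace DolbeaultLog

open Set Filter Topology TopologicalSpace
open ContinuousAlternatingMap (alternatizeUncurryFin_apply
  alternatizeUncurryFin_alternatizeUncurryFinCLM_comp_of_symmetric)

/-! ### Exterior algebra -/

section Algebra

variable {E : Type*} [NormedAddCommGroup E] [NormedSpace ℂ E] {p : ℕ}

/-- Contraction with `v` is an antiderivation for the wedge product by a covector `θ`: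
`θ ∧ (ι a) + ι (θ ∧ a) = θ(v) a`. -/
lemma wedgeOne_curryLeft_add (θ : E →L[ℂ] ℂ) (v : E) (a : E [⋀^Fin (p + 1)]→L[ℂ] ℂ) :
    wedgeOne θ (a.curryLeft v) + (wedgeOne θ a).curryLeft v = θ v • a := by
  ext m
  rw [ContinuousAlternatingMap.add_apply, ContinuousAlternatingMap.curryLeft_apply_apply,
    wedgeOne, wedgeOne, alternatizeUncurryFin_apply, alternatizeUncurryFin_apply,
    Fin.sum_univ_succ (n := p + 1)]
  have h : ∀ i : Fin (p + 1), i.succ.removeNth (Matrix.vecCons v m : Fin (p + 2) → E)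
      = Matrix.vecCons v (i.removeNth m) := by
    intro i
    funext j
    refine Fin.cases ?_ (fun j => ?_) j
    · simp [Fin.removeNth]
    · simp [Fin.removeNth]
  have h0 : (0 : Fin (p + 2)).removeNth (Matrix.vecCons v m : Fin (p + 2) → E) = m := by
    funext j; simp [Fin.removeNth]
  simp only [h, h0, ContinuousLinearMap.smulRight_apply, Fin.val_succ, pow_succ,
    Matrix.cons_val_succ, Matrix.cons_val_zero, ContinuousAlternatingMap.smul_apply,
    ContinuousAlternatingMap.curryLeft_apply_apply, mul_neg, mul_one, neg_smul,
    Finset.sum_neg_distrib, Fin.val_zero, pow_zero, one_smul]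
  abel

lemma curryLeft_wedgeOne_zero (θ : E →L[ℂ] ℂ) (v : E) (a : E [⋀^Fin 0]→L[ℂ] ℂ) :
    (wedgeOne θ a).curryLeft v = θ v • a := by
  ext m
  rw [ContinuousAlternatingMap.curryLeft_apply_apply, wedgeOne, alternatizeUncurryFin_apply]
  simp only [Nat.reduceAdd, Finset.univ_unique, Fin.default_eq_zero, Finset.sum_singleton,
    Fin.val_zero, pow_zero, one_smul, ContinuousLinearMap.smulRight_apply, Matrix.cons_val_zero,
    ContinuousAlternatingMap.smul_apply]
  congr 2

lemma wedgeOne_wedgeOne (θ : E →L[ℂ] ℂ) (a : E [⋀^Fin p]→L[ℂ] ℂ) :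
    wedgeOne θ (wedgeOne θ a) = 0 := by
  have h := alternatizeUncurryFin_alternatizeUncurryFinCLM_comp_of_symmetric
    (𝕜 := ℂ) (f := θ.smulRight (θ.smulRight a)) (fun x y => by
      simp only [ContinuousLinearMap.smulRight_apply, smul_apply, smul_smul,
        mul_comm])
  rw [← h, wedgeOne, wedgeOne]
  congr 1
  ext1 v
  simp

lemma wedgeOne_add_left (θ η : E →L[ℂ] ℂ) (a : E [⋀^Fin p]→L[ℂ] ℂ) :
    wedgeOne (θ + η) a = wedgeOne θ a + wedgeOne η a := by
  ext v
  simp [wedgeOne, alternatizeUncurryFin_apply, add_mul, Finset.sum_add_distrib]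

end Algebra

/-! ### Vector fields and contraction -/

section Fields

variable {E : Type*} [NormedAddCommGroup E] [NormedSpace ℂ E]
  {X : Type*} [TopologicalSpace X] [ChartedSpace E X] [IsManifold 𝓘(ℂ, E) ω X] {p : ℕ}

/-- The expression, in the preferred chart at `x`, of a vector field of type `(1, 0)`. As for
forms, `W z` is a vector of the tangent space at `z`, identified with `E` through the preferred
chart at `z`. -/
noncomputable def fieldRep (x : X) (W : X → E) (y : E) : E :=
  tangentCoordChange 𝓘(ℂ, E) ((extChartAt 𝓘(ℂ, E) x).symm y) x
    ((extChartAt 𝓘(ℂ, E) x).symm y) (W ((extChartAt 𝓘(ℂ, E) x).symm y))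

/-- Smoothness, in the real sense, of a vector field of type `(1, 0)` at a point. -/
def SmoothFieldAt (W : X → E) (x : X) : Prop :=
  ContDiffAt ℝ ∞ (fieldRep x W) (extChartAt 𝓘(ℂ, E) x x)

/-- The differential of a function at a point, as a linear form on the model space. -/
noncomputable def differential (f : X → ℂ) (x : X) : E →L[ℂ] ℂ :=
  mfderiv 𝓘(ℂ, E) 𝓘(ℂ, ℂ) f x

/-- The contraction of a form with a vector field. -/
noncomputable def contract (W : X → E) (α : X → E [⋀^Fin (p + 1)]→L[ℂ] ℂ) (x : X) :
    E [⋀^Fin p]→L[ℂ] ℂ :=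
  (α x).curryLeft (W x)

lemma tendsto_extChartAt_symm (x : X) :
    Tendsto (extChartAt 𝓘(ℂ, E) x).symm (𝓝 (extChartAt 𝓘(ℂ, E) x x)) (𝓝 x) := by
  have := (continuousAt_extChartAt_symm (I := 𝓘(ℂ, E)) x).tendsto
  rwa [extChartAt_to_inv] at this

lemma SmoothFieldAt.congr {W W' : X → E} {x : X} (hW : SmoothFieldAt W x) (h : W =ᶠ[𝓝 x] W') :
    SmoothFieldAt W' x := by
  refine ContDiffAt.congr_of_eventuallyEq hW ?_
  filter_upwards [(tendsto_extChartAt_symm x).eventually h] with y hy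
  rw [fieldRep, fieldRep, hy]

lemma smoothFieldAt_zero (x : X) : SmoothFieldAt (fun _ : X => (0 : E)) x := by
  have : fieldRep x (fun _ : X => (0 : E)) = fun _ => 0 := by
    funext y; simp [fieldRep]
  rw [SmoothFieldAt, this]
  exact contDiffAt_const

lemma SmoothFieldAt.smul {f : X → ℂ} {W : X → E} {x : X}
    (hf : ContMDiffAt 𝓘(ℂ, E) 𝓘(ℂ, ℂ) ω f x) (hW : SmoothFieldAt W x) :
    SmoothFieldAt (fun y => f y • W y) x := by
  have : fieldRep x (fun y => f y • W y)
      = fun z => (f ∘ (extChartAt 𝓘(ℂ, E) x).symm) z • fieldRep x W z := by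
    funext y; simp [fieldRep]
  rw [SmoothFieldAt, this]
  exact (((holo_contDiffAt hf).of_le (m := ∞) (by simp)).restrict_scalars ℝ).smul hW

lemma chartRep_contract (x : X) (W : X → E) (α : X → E [⋀^Fin (p + 1)]→L[ℂ] ℂ) {y : E}
    (hy : y ∈ (extChartAt 𝓘(ℂ, E) x).target) :
    chartRep x (contract W α) y = (chartRep x α y).curryLeft (fieldRep x W y) := by
  ext m
  simp only [chartRep, contract, fieldRep, ContinuousAlternatingMap.curryLeft_apply_apply,
    ContinuousAlternatingMap.compContinuousLinearMap_apply]
  congr 1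
  set u := (extChartAt 𝓘(ℂ, E) x).symm y
  have hu : u ∈ (extChartAt 𝓘(ℂ, E) x).source := (extChartAt 𝓘(ℂ, E) x).map_target hy
  funext j
  refine Fin.cases ?_ (fun j => ?_) j
  · simp only [Matrix.cons_val_zero, Function.comp_apply]
    rw [tangentCoordChange_comp ⟨⟨mem_extChartAt_source u, hu⟩, mem_extChartAt_source u⟩,
      tangentCoordChange_self (mem_extChartAt_source u)]
  · simp

lemma isBoundedBilinearMap_curryLeft : IsBoundedBilinearMap ℝ
    (fun q : (E [⋀^Fin (p + 1)]→L[ℂ] ℂ) × E => q.1.curryLeft q.2) where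
  add_left _ _ _ := rfl
  smul_left _ _ _ := rfl
  add_right a v w := map_add _ v w
  smul_right c a v := by
    rw [← Complex.coe_smul, map_smul, Complex.coe_smul]
  bound := ⟨1, one_pos, fun a v => by
    rw [one_mul, ← ContinuousAlternatingMap.norm_curryLeft a]
    exact a.curryLeft.le_opNorm v⟩

lemma SmoothFormAt.contract {W : X → E} {α : X → E [⋀^Fin (p + 1)]→L[ℂ] ℂ} {x : X}
    (hW : SmoothFieldAt W x) (hα : SmoothFormAt α x) :
    SmoothFormAt (DolbeaultLog.contract W α) x := by
  have h : DolbeaultLog.chartRep x (DolbeaultLog.contract W α)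
      =ᶠ[𝓝 (extChartAt 𝓘(ℂ, E) x x)]
        fun y => (DolbeaultLog.chartRep x α y).curryLeft (fieldRep x W y) := by
    filter_upwards [(isOpen_extChartAt_target (I := 𝓘(ℂ, E)) x).mem_nhds
      (mem_extChartAt_target x)] with y hy using chartRep_contract x W α hy
  refine ContDiffAt.congr_of_eventuallyEq ?_ h
  exact (isBoundedBilinearMap_curryLeft.contDiff.contDiffAt).comp _ (ContDiffAt.prodMk hα hW)

lemma contract_smul (W : X → E) (f : X → ℂ) (α : X → E [⋀^Fin (p + 1)]→L[ℂ] ℂ) :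
    contract W (fun x => f x • α x) = fun x => f x • contract W α x := rfl

lemma smul_contract (f : X → ℂ) (W : X → E) (α : X → E [⋀^Fin (p + 1)]→L[ℂ] ℂ) :
    contract (fun x => f x • W x) α = fun x => f x • contract W α x := by
  funext x; ext m; simp [contract]

lemma dWedge_contract_add (f : X → ℂ) (W : X → E) (α : X → E [⋀^Fin (p + 1)]→L[ℂ] ℂ) (x : X) :
    dWedge f (contract W α) x + contract W (dWedge f α) x
      = differential f x (W x) • α x :=
  wedgeOne_curryLeft_add _ _ _

lemma dWedge_dWedge (f : X → ℂ) (α : X → E [⋀^Fin p]→L[ℂ] ℂ) (x : X) :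
    dWedge f (dWedge f α) x = 0 :=
  wedgeOne_wedgeOne _ _

lemma dWedge_congr {f : X → ℂ} {α β : X → E [⋀^Fin p]→L[ℂ] ℂ} {x : X} (h : α x = β x) :
    dWedge f α x = dWedge f β x := by rw [dWedge, dWedge, h]

lemma eventually_del_smul {f : X → ℂ} {α : X → E [⋀^Fin p]→L[ℂ] ℂ} {x : X}
    (hf : ContMDiffAt 𝓘(ℂ, E) 𝓘(ℂ, ℂ) ω f x) (hα : ∀ᶠ y in 𝓝 x, SmoothFormAt α y) :
    ∀ᶠ y in 𝓝 x, dWedge f α y = del (fun z => f z • α z) y + (-1 : ℂ) • (f y • del α y) := by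
  filter_upwards [hα, holo_eventually hf] with y h1 h2
  rw [del_smul h2 h1]
  module

/-- Since `df ∧ α = ∂(f α) - f ∂α`, smoothness of `df ∧ α` follows from that of `α` in a
neighbourhood. -/
lemma SmoothFormAt.dWedge {f : X → ℂ} {α : X → E [⋀^Fin p]→L[ℂ] ℂ} {x : X}
    (hf : ContMDiffAt 𝓘(ℂ, E) 𝓘(ℂ, ℂ) ω f x) (hα : ∀ᶠ y in 𝓝 x, SmoothFormAt α y) :
    SmoothFormAt (DolbeaultLog.dWedge f α) x := by
  have h1 : ∀ᶠ y in 𝓝 x, SmoothFormAt (fun z => f z • α z) y := by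
    filter_upwards [hα, holo_eventually hf] with y h1 h2 using h1.smul h2
  refine SmoothFormAt.congr (.add (smoothFormAt_del h1)
    (((smoothFormAt_del hα).smul hf).const_smul (-1))) ?_
  filter_upwards [eventually_del_smul hf hα] with y hy using hy.symm

/-- `∂` anticommutes with the wedge product by `df` for `f` holomorphic. -/
lemma del_dWedge {f : X → ℂ} {α : X → E [⋀^Fin p]→L[ℂ] ℂ} {x : X}
    (hf : ContMDiffAt 𝓘(ℂ, E) 𝓘(ℂ, ℂ) ω f x) (hα : ∀ᶠ y in 𝓝 x, SmoothFormAt α y) :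
    del (dWedge f α) x = - dWedge f (del α) x := by
  have h1 : ∀ᶠ y in 𝓝 x, SmoothFormAt (fun z => f z • α z) y := by
    filter_upwards [hα, holo_eventually hf] with y h1 h2 using h1.smul h2
  have h2 := smoothFormAt_del hα
  rw [del_congr (eventually_del_smul hf hα),
    del_add (smoothFormAt_del h1) ((h2.smul hf).const_smul (-1)), del_const_smul _ (h2.smul hf),
    del_del h1, del_smul hf h2, del_del hα]
  module

end Fields

/-! ### The order of the pole -/

section Pole

variable {E : Type} [NormedAddCommGroup E] [NormedSpace ℂ E]
  {X : Type} [TopologicalSpace X] [ChartedSpace E X] [IsManifold 𝓘(ℂ, E) ω X]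
  {D : SmoothHypersurface E X} {p : ℕ} {x : X}

lemma holo_mul {f g : X → ℂ} (hf : ContMDiffAt 𝓘(ℂ, E) 𝓘(ℂ, ℂ) ω f x)
    (hg : ContMDiffAt 𝓘(ℂ, E) 𝓘(ℂ, ℂ) ω g x) :
    ContMDiffAt 𝓘(ℂ, E) 𝓘(ℂ, ℂ) ω (fun z => f z * g z) x := by
  rw [holo_iff_chart (mem_chart_source E x)] at hf hg ⊢
  exact hf.mul hg

lemma differential_mul {f g : X → ℂ} (hf : ContMDiffAt 𝓘(ℂ, E) 𝓘(ℂ, ℂ) ω f x)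
    (hg : ContMDiffAt 𝓘(ℂ, E) 𝓘(ℂ, ℂ) ω g x) :
    differential (E := E) (fun z => f z * g z) x
      = g x • differential f x + f x • differential g x := by
  have h1 := ((holo_contDiffAt hf).differentiableAt (by simp)).hasFDerivAt.mul
    ((holo_contDiffAt hg).differentiableAt (by simp)).hasFDerivAt
  simp only [Function.comp_apply, extChartAt_to_inv] at h1
  rw [differential, differential, differential, holo_mfderiv (holo_mul hf hg), holo_mfderiv hf,
    holo_mfderiv hg, add_comm]
  exact h1.fderiv

/-- The pointwise form of `dWedge_smul`. -/
lemma dWedge_smul_apply (f g : X → ℂ) (α : X → E [⋀^Fin p]→L[ℂ] ℂ) (y : X) :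
    dWedge f (fun z => g z • α z) y = g y • dWedge f α y :=
  congrFun (dWedge_smul f g α) y

lemma ExtendsSmoothlyAt.eventually {α : X → E [⋀^Fin p]→L[ℂ] ℂ} (h : ExtendsSmoothlyAt D α x) :
    ∀ᶠ y in 𝓝 x, ExtendsSmoothlyAt D α y := by
  obtain ⟨β, hβ⟩ := h
  filter_upwards [eventually_eventually_nhds.2 hβ] with y hy using ⟨β, hy⟩

lemma ExtendsSmoothlyAt.contract {W : X → E} {α : X → E [⋀^Fin (p + 1)]→L[ℂ] ℂ}
    (hW : ∀ᶠ y in 𝓝 x, SmoothFieldAt W y) (hα : ExtendsSmoothlyAt D α x) :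
    ExtendsSmoothlyAt D (DolbeaultLog.contract W α) x := by
  obtain ⟨β, hβ⟩ := hα
  refine ⟨DolbeaultLog.contract W β, ?_⟩
  filter_upwards [hW, hβ] with y h1 h2
  exact ⟨h2.1.contract h1, fun hy => by
    rw [DolbeaultLog.contract, h2.2 hy, DolbeaultLog.contract]⟩

lemma eventually_eventually_off {P : X → Prop} (h : ∀ᶠ y in 𝓝 x, y ∉ D.carrier → P y) :
    ∀ᶠ y in 𝓝 x, y ∉ D.carrier → ∀ᶠ z in 𝓝 y, P z := by
  filter_upwards [eventually_eventually_nhds.2 h] with y h1 h2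
  filter_upwards [h1, D.isClosed.isOpen_compl.mem_nhds h2] with z h3 h4
  exact h3 h4

/-- The form `α` belongs to `f⁻ᵏ 𝒜⟨D⟩` near `x`, where `f` is a local equation for `D`: both
`f ^ (k + 1) α` and `f ^ k df ∧ α` extend smoothly. -/
def PoleLE (D : SmoothHypersurface E X) (f : X → ℂ) (k : ℕ) (α : X → E [⋀^Fin p]→L[ℂ] ℂ)
    (x : X) : Prop :=
  ExtendsSmoothlyAt D (fun z => f z ^ (k + 1) • α z) x ∧
    ExtendsSmoothlyAt D (fun z => f z ^ k • dWedge f α z) x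

variable {f g : X → ℂ} {k : ℕ} {α β : X → E [⋀^Fin p]→L[ℂ] ℂ}

lemma PoleLE.eventually (h : PoleLE D f k α x) : ∀ᶠ y in 𝓝 x, PoleLE D f k α y :=
  h.1.eventually.and h.2.eventually

lemma PoleLE.congr (h : PoleLE D f k α x) (hαβ : ∀ᶠ y in 𝓝 x, y ∉ D.carrier → α y = β y) :
    PoleLE D f k β x := by
  refine ⟨h.1.congr ?_, h.2.congr ?_⟩
  · filter_upwards [hαβ] with y h1 h2
    rw [h1 h2]
  · filter_upwards [hαβ] with y h1 h2
    rw [dWedge_congr (h1 h2)]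

lemma PoleLE.add (hα : PoleLE D f k α x) (hβ : PoleLE D f k β x) :
    PoleLE D f k (fun z => α z + β z) x := by
  refine ⟨(hα.1.add hβ.1).congr (Eventually.of_forall fun y _ => ?_),
    (hα.2.add hβ.2).congr (Eventually.of_forall fun y _ => ?_)⟩
  · rw [smul_add]
  · rw [dWedge_add, smul_add]

lemma PoleLE.const_smul (c : ℂ) (hα : PoleLE D f k α x) :
    PoleLE D f k (fun z => c • α z) x := by
  refine ⟨(hα.1.const_smul c).congr (Eventually.of_forall fun y _ => ?_),
    (hα.2.const_smul c).congr (Eventually.of_forall fun y _ => ?_)⟩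
  · rw [smul_comm]
  · rw [dWedge_smul f (fun _ => c), smul_comm]

lemma PoleLE.mono (hf : ContMDiffAt 𝓘(ℂ, E) 𝓘(ℂ, ℂ) ω f x) {l : ℕ} (hkl : k ≤ l)
    (hα : PoleLE D f k α x) : PoleLE D f l α x := by
  obtain ⟨m, rfl⟩ := Nat.exists_eq_add_of_le hkl
  refine ⟨(hα.1.smul (holo_pow hf m)).congr (Eventually.of_forall fun y _ => ?_),
    (hα.2.smul (holo_pow hf m)).congr (Eventually.of_forall fun y _ => ?_)⟩
  · rw [smul_smul]; ring_nf
  · rw [smul_smul]; ring_nf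

lemma PoleLE.of_extends (hf : ContMDiffAt 𝓘(ℂ, E) 𝓘(ℂ, ℂ) ω f x)
    (h : ExtendsSmoothlyAt D (fun z => f z ^ k • α z) x) : PoleLE D f k α x := by
  refine ⟨(h.smul hf).congr (Eventually.of_forall fun y _ => ?_),
    (h.dWedge hf).congr (Eventually.of_forall fun y _ => ?_)⟩
  · rw [smul_smul, pow_succ']
  · rw [dWedge_smul f (fun z => f z ^ k)]

lemma ExtendsSmoothlyAt.of_smooth (h : ∀ᶠ y in 𝓝 x, SmoothFormAt α y) :
    ExtendsSmoothlyAt D α x :=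
  ⟨α, h.mono fun _ hy => ⟨hy, fun _ => rfl⟩⟩

lemma PoleLE.of_smooth (hf : ContMDiffAt 𝓘(ℂ, E) 𝓘(ℂ, ℂ) ω f x)
    (h : ∀ᶠ y in 𝓝 x, SmoothFormAt α y) : PoleLE D f k α x :=
  .mono hf (Nat.zero_le k) (.of_extends hf (by simpa using .of_smooth h))

/-- The order of the pole does not depend on the local equation. -/
lemma PoleLE.change {V : Set X} (hf : IsLocalEquation D V f) (hx : x ∈ V)
    (hg : ContMDiffAt 𝓘(ℂ, E) 𝓘(ℂ, ℂ) ω g x) (hg0 : ∀ᶠ y in 𝓝 x, y ∈ D.carrier → g y = 0)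
    (hα : PoleLE D f k α x) : PoleLE D g k α x := by
  obtain ⟨h, hh, hgf⟩ := hf.generates x hx g hg hg0
  have hfx := hf.holo x hx
  -- `gᵏ dg ∧ α = hᵏ⁺¹ (fᵏ df ∧ α) + hᵏ dh ∧ (fᵏ⁺¹ α)` for `g = f h`
  refine ⟨(hα.1.smul (holo_pow hh (k + 1))).congr ?_,
    ((hα.2.smul (holo_pow hh (k + 1))).add ((hα.1.dWedge hh).smul (holo_pow hh k))).congr ?_⟩
  · filter_upwards [hgf] with y hy _
    rw [hy, smul_smul, mul_pow, mul_comm]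
  · filter_upwards [eventually_eventually_nhds.2 hgf, holo_eventually hfx,
      holo_eventually hh] with y hy hfy hhy _
    have key : dWedge g α y = h y • dWedge f α y + f y • dWedge h α y := by
      have e : differential (E := E) g y = differential (fun z => f z * h z) y :=
        Filter.EventuallyEq.mfderiv_eq hy
      have hd : differential (E := E) g y = h y • differential f y + f y • differential h y :=
        e.trans (differential_mul hfy hhy)
      change wedgeOne (differential g y) _ = _
      rw [hd, wedgeOne_add_left, wedgeOne_smul_left, wedgeOne_smul_left]
      rfl
    rw [dWedge_smul, key, hy.self_of_nhds, mul_pow, smul_add, smul_smul, smul_smul, smul_smul,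
      smul_smul]
    congr 2 <;> ring

/-- `∂` does not increase the order of the pole, in the sense of `PoleLE`. -/
lemma PoleLE.del (hf : ContMDiffAt 𝓘(ℂ, E) 𝓘(ℂ, ℂ) ω f x)
    (hs : ∀ᶠ y in 𝓝 x, y ∉ D.carrier → SmoothFormAt α y) (hα : PoleLE D f k α x) :
    PoleLE D f k (DolbeaultLog.del α) x := by
  refine ⟨(hα.1.del.add (hα.2.const_smul (-(k + 1 : ℂ)))).congr ?_,
    (hα.2.del.const_smul (-1)).congr ?_⟩
  · filter_upwards [hs, holo_eventually hf] with y hy hfy hyD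
    rw [del_smul (holo_pow hfy _) (hy hyD), dWedge_pow hfy]
    simp only [Nat.add_sub_cancel]
    push_cast
    module
  · filter_upwards [eventually_eventually_off hs, holo_eventually hf] with y hy hfy hyD
    rw [del_smul (holo_pow hfy _) (SmoothFormAt.dWedge hfy (hy hyD)), dWedge_pow hfy,
      dWedge_dWedge, del_dWedge hfy (hy hyD)]
    module

/-- Contraction with `f u` does not increase the order of the pole, in the sense of `PoleLE`: the
factor `f` even makes `f ^ k` times the contraction extend smoothly. -/
lemma PoleLE.contract {u : X → E} (hf : ContMDiffAt 𝓘(ℂ, E) 𝓘(ℂ, ℂ) ω f x)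
    (hu : ∀ᶠ y in 𝓝 x, SmoothFieldAt u y) {α : X → E [⋀^Fin (p + 1)]→L[ℂ] ℂ}
    (hα : PoleLE D f k α x) :
    PoleLE D f k (DolbeaultLog.contract (fun y => f y • u y) α) x := by
  refine .of_extends hf ((hα.1.contract hu).congr (Eventually.of_forall fun y _ => ?_))
  rw [contract_smul, smul_contract]
  beta_reduce
  rw [smul_smul, pow_succ]

/-- With `ι` the contraction with `u`, `L = ∂ ι + ι ∂` the Lie derivative along `u`, `k = m + 1`,
`A = fᵏ⁺¹ α` and `B = fᵏ df ∧ α`, the identity reads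
`fᵏ (k α + ∂(f ι α)) = L A - ι B - fᵏ⁺¹ ι ∂α`. -/
lemma pow_smul_lowering {u : X → E} {α : X → E [⋀^Fin (p + 1)]→L[ℂ] ℂ} {z : X} (m : ℕ)
    (hf : ContMDiffAt 𝓘(ℂ, E) 𝓘(ℂ, ℂ) ω f z) (hu : ∀ᶠ y in 𝓝 z, SmoothFieldAt u y)
    (hfu : ∀ᶠ y in 𝓝 z, differential f y (u y) = 1) (hα : ∀ᶠ y in 𝓝 z, SmoothFormAt α y) :
    f z ^ (m + 1) • ((m + 1 : ℂ) • α z + del (contract (fun y => f y • u y) α) z)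
      = del (contract u fun y => f y ^ (m + 2) • α y) z
        + contract u (del fun y => f y ^ (m + 2) • α y) z
        + (-1 : ℂ) • contract u (fun y => f y ^ (m + 1) • dWedge f α y) z
        + (-1 : ℂ) • (f z ^ (m + 2) • contract u (del α) z) := by
  have hι := hα.self_of_nhds.contract hu.self_of_nhds
  have h1 : (contract u fun y => f y ^ (m + 2) • α y)
      = fun y => f y ^ (m + 1) • f y • contract u α y := by
    funext y; rw [contract_smul, smul_smul, ← pow_succ]
  have h2 : dWedge f (contract u α) z = α z + (-1 : ℂ) • contract u (dWedge f α) z := by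
    have := dWedge_contract_add f u α z
    rw [hfu.self_of_nhds, one_smul] at this
    rw [← this]; module
  have h3 : contract u (del fun y => f y ^ (m + 2) • α y) z
      = ((m + 2 : ℂ) * f z ^ (m + 1)) • contract u (dWedge f α) z
        + f z ^ (m + 2) • contract u (del α) z := by
    rw [contract, del_smul (holo_pow hf _) hα.self_of_nhds, dWedge_pow hf]
    simp only [Nat.add_succ_sub_one]
    push_cast
    rfl
  rw [smul_contract, h3, h1, del_smul (holo_pow hf _) (hι.smul hf), dWedge_pow hf,
    dWedge_smul_apply, h2, contract_smul]
  simp only [Nat.add_sub_cancel]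
  push_cast
  module

/-- In the notation of `pow_smul_lowering`, the identity reads
`fᵏ⁻¹ df ∧ (k α + ∂(f ι α)) = L B - fᵏ df ∧ ι ∂α`. -/
lemma pow_smul_dWedge_lowering {u : X → E} {α : X → E [⋀^Fin (p + 1)]→L[ℂ] ℂ} {z : X} (m : ℕ)
    (hf : ContMDiffAt 𝓘(ℂ, E) 𝓘(ℂ, ℂ) ω f z) (hu : ∀ᶠ y in 𝓝 z, SmoothFieldAt u y)
    (hfu : ∀ᶠ y in 𝓝 z, differential f y (u y) = 1) (hα : ∀ᶠ y in 𝓝 z, SmoothFormAt α y) :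
    f z ^ m • dWedge f (fun y => (m + 1 : ℂ) • α y
        + del (contract (fun y => f y • u y) α) y) z
      = del (contract u fun y => f y ^ (m + 1) • dWedge f α y) z
        + contract u (del fun y => f y ^ (m + 1) • dWedge f α y) z
        + (-1 : ℂ) • (f z ^ (m + 1) • dWedge f (contract u (del α)) z) := by
  have hfe := holo_eventually hf
  have heα : ∀ᶠ y in 𝓝 z, SmoothFormAt (dWedge f α) y := by
    filter_upwards [eventually_eventually_nhds.2 hα, hfe] with y h1 h2
      using SmoothFormAt.dWedge h2 h1
  have hι : ∀ᶠ y in 𝓝 z, SmoothFormAt (contract u α) y := by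
    filter_upwards [hα, hu] with y h1 h2 using h1.contract h2
  have hιe : ∀ᶠ y in 𝓝 z, SmoothFormAt (contract u (dWedge f α)) y := by
    filter_upwards [heα, hu] with y h1 h2 using h1.contract h2
  have hfι : ∀ᶠ y in 𝓝 z, SmoothFormAt (fun y => f y • contract u α y) y := by
    filter_upwards [hι, hfe] with y h1 h2 using h1.smul h2
  have hfα := hα.self_of_nhds.smul hf
  have hfιe := hιe.self_of_nhds.smul hf
  have h2 : ∀ᶠ y in 𝓝 z, dWedge f (contract u α) y
      = α y + (-1 : ℂ) • contract u (dWedge f α) y := by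
    filter_upwards [hfu] with y hy
    have := dWedge_contract_add f u α y
    rw [hy, one_smul] at this
    rw [← this]; module
  -- `df ∧ ∂(f ι α) = - df ∧ α - f ∂α + ∂(f ι (df ∧ α))`
  have h4 : dWedge f (del fun y => f y • contract u α y) z
      = (-1 : ℂ) • (dWedge f α z + f z • del α z)
        + del (fun y => f y • contract u (dWedge f α) y) z := by
    have e1 := del_dWedge hf hfι
    have e2 : dWedge f (fun y => f y • contract u α y) =ᶠ[𝓝 z]
        fun y => f y • α y + (-1 : ℂ) • (f y • contract u (dWedge f α) y) := by
      filter_upwards [h2] with y hy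
      rw [dWedge_smul_apply, hy]; module
    rw [del_congr e2, del_add hfα (hfιe.const_smul _), del_const_smul _ hfιe,
      del_smul hf hα.self_of_nhds] at e1
    rw [← neg_eq_iff_eq_neg.2 e1]
    module
  have h5 : dWedge f (contract u (dWedge f α)) z = dWedge f α z := by
    have := dWedge_contract_add f u (dWedge f α) z
    rw [hfu.self_of_nhds, one_smul] at this
    rw [← this]
    have h0 : contract u (dWedge f (dWedge f α)) z = 0 := by
      rw [contract, dWedge_dWedge]; rfl
    rw [h0, add_zero]
  have h6 : dWedge f (contract u (del α)) z
      = del α z + (-1 : ℂ) • contract u (dWedge f (del α)) z := by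
    have := dWedge_contract_add f u (del α) z
    rw [hfu.self_of_nhds, one_smul] at this
    rw [← this]; module
  have h7 : contract u (del fun y => f y ^ (m + 1) • dWedge f α y) z
      = (-1 : ℂ) • (f z ^ (m + 1) • contract u (dWedge f (del α)) z) := by
    rw [contract, del_smul (holo_pow hf _) heα.self_of_nhds, dWedge_pow hf, dWedge_dWedge,
      del_dWedge hf hα, smul_zero_form, zero_add]
    rw [smul_neg, ← neg_one_smul ℂ]
    rfl
  have h8 : (contract u fun y => f y ^ (m + 1) • dWedge f α y)
      = fun y => f y ^ m • f y • contract u (dWedge f α) y := by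
    funext y; rw [contract_smul, smul_smul, ← pow_succ]
  have h9 : dWedge f (fun y => (m + 1 : ℂ) • α y
      + del (contract (fun y => f y • u y) α) y) z = (m + 1 : ℂ) • dWedge f α z
      + dWedge f (del fun y => f y • contract u α y) z := by
    rw [dWedge_add, dWedge_smul f (fun _ => (m + 1 : ℂ)), smul_contract]
  rw [h9, h4, h8, h7, h6, del_smul (holo_pow hf _) hfιe, dWedge_pow hf,
    dWedge_smul_apply, h5]
  rcases m with _ | m
  · simp only [Nat.cast_zero, pow_zero, zero_mul, zero_add, pow_one]
    module
  · simp only [Nat.add_sub_cancel]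
    push_cast
    module

/-- Lowering of the order of the pole. On `f⁻ᵏ 𝒜⟨D⟩ / f⁻ᵏ⁺¹ 𝒜⟨D⟩`, where `k = m + 1`, the Lie
derivative along the Euler field `f u` is multiplication by `- k`. -/
lemma PoleLE.lowering {u : X → E} {α : X → E [⋀^Fin (p + 1)]→L[ℂ] ℂ} {m : ℕ}
    (hf : ContMDiffAt 𝓘(ℂ, E) 𝓘(ℂ, ℂ) ω f x) (hu : ∀ᶠ y in 𝓝 x, SmoothFieldAt u y)
    (hfu : ∀ᶠ y in 𝓝 x, differential f y (u y) = 1)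
    (hs : ∀ᶠ y in 𝓝 x, y ∉ D.carrier → SmoothFormAt α y) (hα : PoleLE D f (m + 1) α x)
    (hdα : PoleLE D f 0 (DolbeaultLog.del α) x) :
    PoleLE D f m (fun z => (m + 1 : ℂ) • α z
      + DolbeaultLog.del (DolbeaultLog.contract (fun y => f y • u y) α) z) x := by
  obtain ⟨hA, hB⟩ := hα
  obtain ⟨hd, hed⟩ := hdα
  have hA' : ExtendsSmoothlyAt D (fun z => f z ^ (m + 2) • α z) x := hA
  have hιd : ExtendsSmoothlyAt D (fun z => f z ^ (m + 1) •
      DolbeaultLog.contract u (DolbeaultLog.del α) z) x := by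
    refine ((hd.contract hu).smul (holo_pow hf m)).congr (Eventually.of_forall fun y _ => ?_)
    rw [contract_smul, smul_smul, zero_add, pow_one, pow_succ]
  have hev := (eventually_eventually_nhds.2 hu).and (eventually_eventually_nhds.2 hfu)
  constructor
  · refine ((((hA'.contract hu).del.add (hA'.del.contract hu)).add
      ((hB.contract hu).const_smul (-1))).add ((hιd.smul hf).const_smul (-1))).congr ?_
    filter_upwards [hev, holo_eventually hf, eventually_eventually_off hs] with y hy hfy hsy hyD
    rw [pow_smul_lowering m hfy hy.1 hy.2 (hsy hyD), smul_smul (f y), ← pow_succ']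
  · refine ((((hB.contract hu).del.add (hB.del.contract hu))).add
      ((hιd.dWedge hf).const_smul (-1))).congr ?_
    filter_upwards [hev, holo_eventually hf, eventually_eventually_off hs] with y hy hfy hsy hyD
    rw [pow_smul_dWedge_lowering m hfy hy.1 hy.2 (hsy hyD), dWedge_smul]

/-- In degree `0` no correction is needed: `df` spans a direct summand, so that the order of the
pole of a function can be read off from that of its differential. -/
lemma PoleLE.lowering_zero {u : X → E} {α : X → E [⋀^Fin 0]→L[ℂ] ℂ} {m : ℕ}
    (hf : ContMDiffAt 𝓘(ℂ, E) 𝓘(ℂ, ℂ) ω f x) (hu : ∀ᶠ y in 𝓝 x, SmoothFieldAt u y)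
    (hfu : ∀ᶠ y in 𝓝 x, differential f y (u y) = 1)
    (hs : ∀ᶠ y in 𝓝 x, y ∉ D.carrier → SmoothFormAt α y) (hα : PoleLE D f (m + 1) α x)
    (hdα : PoleLE D f 0 (DolbeaultLog.del α) x) : PoleLE D f m α x := by
  have extend_of : ∀ n : ℕ, ExtendsSmoothlyAt D (fun z => f z ^ n • dWedge f α z) x →
      ExtendsSmoothlyAt D (fun z => f z ^ n • α z) x := by
    intro n hn
    refine (hn.contract hu).congr ?_
    filter_upwards [hfu] with y hy _
    rw [contract_smul]
    change f y ^ n • (wedgeOne (differential f y) (α y)).curryLeft (u y) = _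
    rw [curryLeft_wedgeOne_zero, hy, one_smul]
  -- `∂(fᵐ⁺¹ α) = (m + 1) fᵐ df ∧ α + fᵐ⁺¹ ∂α`
  have h1 := extend_of _ hα.2
  have h2 := (h1.del.add ((hdα.1.smul (holo_pow hf m)).const_smul (-1))).const_smul
    ((m + 1 : ℂ)⁻¹)
  refine .of_extends hf (extend_of m (h2.congr ?_))
  filter_upwards [hs, holo_eventually hf] with y hy hfy hyD
  have hm : (m + 1 : ℂ) ≠ 0 := by exact_mod_cast m.succ_ne_zero
  rw [del_smul (holo_pow hfy _) (hy hyD), dWedge_pow hfy, smul_smul (f y ^ m)]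
  simp only [Nat.add_sub_cancel, zero_add, pow_one, ← pow_succ]
  push_cast
  match_scalars
  · field_simp
  · ring

end Pole

/-! ### Euler fields -/

section Euler

variable {E : Type} [NormedAddCommGroup E] [NormedSpace ℂ E]
  {X : Type} [TopologicalSpace X] [ChartedSpace E X] [IsManifold 𝓘(ℂ, E) ω X]
  {D : SmoothHypersurface E X} {x : X}

/-- A submersion `g` defining `D` is a multiple `f h` of `f`, so that `dg = h df` on `D`. -/
lemma IsLocalEquation.differential_ne_zero {V : Set X} {f : X → ℂ} (hf : IsLocalEquation D V f)
    (hxV : x ∈ V) (hxD : x ∈ D.carrier) : differential (E := E) f x ≠ 0 := by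
  obtain ⟨g, hg, hdg, hzero⟩ := D.exists_submersion x hxD
  obtain ⟨h, hh, hgf⟩ := hf.generates x hxV g hg (hzero.mono fun y hy => hy.1)
  intro h0
  apply hdg
  have e : differential (E := E) g x = differential (fun z => f z * h z) x :=
    Filter.EventuallyEq.mfderiv_eq hgf
  rw [differential_mul (hf.holo x hxV) hh, h0, hf.vanish x ⟨hxV, hxD⟩] at e
  have e0 : h x • (0 : E →L[ℂ] ℂ) + (0 : ℂ) • differential h x = 0 := by ext v; simp
  exact e.trans e0

/-- The vector field on `X` whose expression in the preferred chart at `x` is `w`, extended by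
zero. -/
noncomputable def fieldOfChart (x : X) (w : E → E) (z : X) : E :=
  open Classical in
  if z ∈ (extChartAt 𝓘(ℂ, E) x).source then
    tangentCoordChange 𝓘(ℂ, E) x z z (w (extChartAt 𝓘(ℂ, E) x z)) else 0

lemma smoothFieldAt_fieldOfChart {w : E → E} {z : X}
    (hz : z ∈ (extChartAt 𝓘(ℂ, E) x).source)
    (hw : ContDiffAt ℝ ∞ w (extChartAt 𝓘(ℂ, E) x z)) :
    SmoothFieldAt (fieldOfChart x w) z := by
  have hzz : z ∈ (extChartAt 𝓘(ℂ, E) z).source := mem_extChartAt_source z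
  have hT : ContDiffAt ℝ ∞ (fderiv ℂ (coordTrans x z)) (extChartAt 𝓘(ℂ, E) x z) :=
    ((coordTrans_contDiffAt hz hzz).fderiv_right (m := ∞) (by simp)).restrict_scalars ℝ
  have hS : ContDiffAt ℝ ∞ (coordTrans z x) (extChartAt 𝓘(ℂ, E) z z) :=
    ((coordTrans_contDiffAt hzz hz).of_le (by simp)).restrict_scalars ℝ
  have happ : ContDiff ℝ ∞ (fun q : (E →L[ℂ] E) × E => q.1 q.2) :=
    (isBoundedBilinearMap_apply (𝕜 := ℂ)).contDiff.restrict_scalars ℝ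
  have hev : coordTrans z x (extChartAt 𝓘(ℂ, E) z z) = extChartAt 𝓘(ℂ, E) x z := by
    rw [coordTrans, Function.comp_apply, extChartAt_to_inv]
  have h1 : ContDiffAt ℝ ∞ (fun q => fderiv ℂ (coordTrans x z) q (w q))
      (coordTrans z x (extChartAt 𝓘(ℂ, E) z z)) := by
    rw [hev]
    exact happ.contDiffAt.comp _ (hT.prodMk hw)
  refine ContDiffAt.congr_of_eventuallyEq (h1.comp _ hS) ?_
  filter_upwards [eventually_source z x hzz hz] with y hy
  obtain ⟨hy1, hy2⟩ := hy
  set t := (extChartAt 𝓘(ℂ, E) z).symm y with ht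
  have htz : t ∈ (extChartAt 𝓘(ℂ, E) z).source := (extChartAt 𝓘(ℂ, E) z).map_target hy1
  rw [fieldRep, ← ht, fieldOfChart, if_pos hy2,
    tangentCoordChange_comp ⟨⟨hy2, mem_extChartAt_source t⟩, htz⟩, tangentCoordChange_eq]
  rfl

/-- The derivative of `f` along a field given in the chart at `x` is computed in that chart. -/
lemma differential_fieldOfChart {w : E → E} {z : X} {f : X → ℂ}
    (hz : z ∈ (extChartAt 𝓘(ℂ, E) x).source) (hf : ContMDiffAt 𝓘(ℂ, E) 𝓘(ℂ, ℂ) ω f z) :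
    differential f z (fieldOfChart x w z)
      = fderiv ℂ (f ∘ (extChartAt 𝓘(ℂ, E) x).symm) (extChartAt 𝓘(ℂ, E) x z)
        (w (extChartAt 𝓘(ℂ, E) x z)) := by
  have hzz : z ∈ (extChartAt 𝓘(ℂ, E) z).source := mem_extChartAt_source z
  have h1 : f ∘ (extChartAt 𝓘(ℂ, E) x).symm =ᶠ[𝓝 (extChartAt 𝓘(ℂ, E) x z)]
      (f ∘ (extChartAt 𝓘(ℂ, E) z).symm) ∘ coordTrans x z := by
    filter_upwards [eventually_source x z hz hzz] with y hy
    simp only [Function.comp_apply, coordTrans, (extChartAt 𝓘(ℂ, E) z).left_inv hy.2]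
  have hev : coordTrans x z (extChartAt 𝓘(ℂ, E) x z) = extChartAt 𝓘(ℂ, E) z z :=
    coordTrans_apply x z hz
  rw [h1.fderiv_eq, fderiv_comp _ (by
      rw [hev]; exact (holo_contDiffAt hf).differentiableAt (by simp))
    ((coordTrans_contDiffAt hz hzz).differentiableAt (by simp)), hev, differential,
    holo_mfderiv hf, fieldOfChart, if_pos hz, tangentCoordChange_eq]
  rfl

variable (D) in
/-- A local equation `f` for `D` on `V` with a smooth vector field `u` of type `(1, 0)` on `X`,
supported in `V`, such that `df(u) = 1` on an open set `N`. The product `f u` is then a smooth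
vector field on `X` which is tangent to `D`, and on `N` it is an Euler field. -/
structure EulerField where
  /-- The domain of the local equation. -/
  V : Set X
  /-- The local equation. -/
  f : X → ℂ
  /-- The vector field. -/
  u : X → E
  /-- A closed set which contains the support of the field. -/
  K : Set X
  /-- The set on which the field is normalized. -/
  N : Set X
  eqn : IsLocalEquation D V f
  isClosed : IsClosed K
  subset : K ⊆ V
  zero : ∀ y ∉ K, u y = 0
  smooth : ∀ y, SmoothFieldAt u y
  isOpen : IsOpen N
  subset' : N ⊆ V
  one : ∀ y ∈ N, differential f y (u y) = 1

/-- In the chart at `x`, the vector field is a constant vector `v`, divided by `df(v)` and multiplied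
by a bump function. -/
lemma exists_eulerField [FiniteDimensional ℂ E] [T2Space X] (hx : x ∈ D.carrier) :
    ∃ e : EulerField D, x ∈ e.N := by
  have := FiniteDimensional.complete ℂ E
  have : FiniteDimensional ℝ E := FiniteDimensional.complexToReal E
  obtain ⟨V, -, hxV, f, hf⟩ := exists_localEquation D hx isOpen_univ (mem_univ x)
  set φ := extChartAt 𝓘(ℂ, E) x with hφ
  set F := f ∘ φ.symm with hF
  have hfx := hf.holo x hxV
  have hd := hf.differential_ne_zero hxV hx
  obtain ⟨v, hv⟩ : ∃ v, fderiv ℂ F (φ x) v ≠ 0 := by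
    by_contra! h
    refine hd ?_
    rw [differential, holo_mfderiv hfx]
    ext v
    exact h v
  -- a ball in the chart on which `df(v)` does not vanish
  have hFx : ContDiffAt ℂ ω F (φ x) := holo_contDiffAt hfx
  have h1 : ∀ᶠ y in 𝓝 (φ x), ContDiffAt ℂ ω F y := hFx.eventually (by simp)
  have h2 : ∀ᶠ y in 𝓝 (φ x), fderiv ℂ F y v ≠ 0 := by
    have : ContinuousAt (fun y => fderiv ℂ F y v) (φ x) :=
      ((hFx.fderiv_right (m := ω) (by simp)).continuousAt).clm_apply continuousAt_const
    exact this.eventually_ne hv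
  have h3 : ∀ᶠ y in 𝓝 (φ x), y ∈ φ.target :=
    (isOpen_extChartAt_target (I := 𝓘(ℂ, E)) x).mem_nhds (mem_extChartAt_target x)
  have h4 : ∀ᶠ y in 𝓝 (φ x), φ.symm y ∈ V :=
    (tendsto_extChartAt_symm x).eventually (hf.isOpen.mem_nhds hxV)
  obtain ⟨r, hr, hball⟩ := Metric.eventually_nhds_iff_ball.1 ((h1.and h2).and (h3.and h4))
  let χ : ContDiffBump (φ x) := ⟨r / 3, r / 2, by linarith, by linarith⟩
  have hsub : Metric.closedBall (φ x) (r / 2) ⊆ Metric.ball (φ x) r :=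
    Metric.closedBall_subset_ball (by linarith)
  let w : E → E := fun y => ((χ y : ℂ) * (fderiv ℂ F y v)⁻¹) • v
  have hw0 : ∀ y ∉ Metric.closedBall (φ x) (r / 2), w y = 0 := by
    intro y hy
    have : χ y = 0 := χ.zero_of_le_dist (by
      rw [Metric.mem_closedBall, not_le] at hy; exact hy.le)
    simp [w, this]
  have hw : ∀ y, ContDiffAt ℝ ∞ w y := by
    intro y
    by_cases hy : y ∈ Metric.closedBall (φ x) (r / 2)
    · obtain ⟨⟨k1, k2⟩, -⟩ := hball y (hsub hy)
      have e1 : ContDiffAt ℂ ∞ (fun y => (fderiv ℂ F y v)⁻¹) y :=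
        ((k1.fderiv_right (m := ∞) (by simp)).clm_apply contDiffAt_const).inv k2
      have e2 : ContDiffAt ℝ ∞ (fun y => (χ y : ℂ)) y :=
        Complex.ofRealCLM.contDiff.contDiffAt.comp y χ.contDiffAt
      exact (e2.mul (e1.restrict_scalars ℝ)).smul contDiffAt_const
    · refine contDiffAt_const (c := (0 : E)) |>.congr_of_eventuallyEq ?_
      filter_upwards [Metric.isClosed_closedBall.isOpen_compl.mem_nhds hy] with z hz
        using hw0 z hz
  have htarget : Metric.closedBall (φ x) (r / 2) ⊆ φ.target := fun y hy =>
    (hball y (hsub hy)).2.1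
  have hK : IsCompact (φ.symm '' Metric.closedBall (φ x) (r / 2)) :=
    (isCompact_closedBall _ _).image_of_continuousOn
      ((continuousOn_extChartAt_symm x).mono htarget)
  have hu0 : ∀ y ∉ φ.symm '' Metric.closedBall (φ x) (r / 2), fieldOfChart x w y = 0 := by
    intro y hy
    rw [fieldOfChart]
    split_ifs with hys
    · rw [← hφ, hw0 _ fun h => hy ⟨φ y, h, φ.left_inv hys⟩, map_zero]
    · rfl
  have hNs : ∀ y ∈ φ.source ∩ φ ⁻¹' Metric.ball (φ x) (r / 3), φ y ∈ Metric.ball (φ x) r :=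
    fun y hy => Metric.ball_subset_ball (by linarith) hy.2
  have hNV : φ.source ∩ φ ⁻¹' Metric.ball (φ x) (r / 3) ⊆ V := by
    intro y hy
    have := (hball _ (hNs y hy)).2.2
    rwa [φ.left_inv hy.1] at this
  refine ⟨⟨V, f, fieldOfChart x w, φ.symm '' Metric.closedBall (φ x) (r / 2),
    φ.source ∩ φ ⁻¹' Metric.ball (φ x) (r / 3), hf, hK.isClosed, ?_, hu0, ?_, ?_, hNV, ?_⟩, ?_⟩
  · rintro _ ⟨y, hy, rfl⟩
    exact (hball y (hsub hy)).2.2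
  · intro y
    by_cases hy : y ∈ φ.source
    · exact smoothFieldAt_fieldOfChart hy (hw _)
    · refine (smoothFieldAt_zero y).congr ?_
      have : y ∉ φ.symm '' Metric.closedBall (φ x) (r / 2) := by
        rintro ⟨z, hz, rfl⟩
        exact hy (φ.map_target (htarget hz))
      filter_upwards [hK.isClosed.isOpen_compl.mem_nhds this] with z hz using (hu0 z hz).symm
  · exact (continuousOn_extChartAt x).isOpen_inter_preimage (isOpen_extChartAt_source x)
      Metric.isOpen_ball
  · intro y hy
    rw [differential_fieldOfChart hy.1 (hf.holo y (hNV hy))]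
    have k2 := (hball _ (hNs y hy)).1.2
    have k3 : χ (φ y) = 1 := χ.one_of_mem_closedBall (Metric.ball_subset_closedBall hy.2)
    simp only [w, ← hφ, ← hF, k3, map_smul, smul_eq_mul]
    simp [k2]
  · exact ⟨mem_extChartAt_source x, Metric.mem_ball_self (by linarith)⟩

end Euler

/-! ### The order of the pole, without reference to a local equation -/

section Reduction

variable {E : Type} [NormedAddCommGroup E] [NormedSpace ℂ E]
  {X : Type} [TopologicalSpace X] [ChartedSpace E X] [IsManifold 𝓘(ℂ, E) ω X]
  {D : SmoothHypersurface E X} {p k : ℕ} {x : X} {U : Opens X}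

/-- `PoleLE` for some, equivalently any, local equation at `x`. -/
def HasPoleLE (D : SmoothHypersurface E X) (k : ℕ) (α : X → E [⋀^Fin p]→L[ℂ] ℂ) (x : X) : Prop :=
  ∃ V f, IsLocalEquation D V f ∧ x ∈ V ∧ PoleLE D f k α x

variable {α β : X → E [⋀^Fin p]→L[ℂ] ℂ}

lemma HasPoleLE.poleLE (h : HasPoleLE D k α x) {V : Set X} {f : X → ℂ}
    (hf : IsLocalEquation D V f) (hx : x ∈ V) : PoleLE D f k α x := by
  obtain ⟨W, g, hg, hxW, hα⟩ := h
  refine hα.change hg hxW (hf.holo x hx) ?_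
  filter_upwards [hf.isOpen.mem_nhds hx] with y hy hyD using hf.vanish y ⟨hy, hyD⟩

lemma HasPoleLE.eventually (h : HasPoleLE D k α x) : ∀ᶠ y in 𝓝 x, HasPoleLE D k α y := by
  obtain ⟨W, g, hg, hxW, hα⟩ := h
  filter_upwards [hα.eventually, hg.isOpen.mem_nhds hxW] with y h1 h2 using ⟨W, g, hg, h2, h1⟩

lemma HasPoleLE.congr (h : HasPoleLE D k α x) (hαβ : ∀ᶠ y in 𝓝 x, y ∉ D.carrier → α y = β y) :
    HasPoleLE D k β x := by
  obtain ⟨W, g, hg, hxW, hα⟩ := h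
  exact ⟨W, g, hg, hxW, hα.congr hαβ⟩

lemma HasPoleLE.mono (h : HasPoleLE D k α x) {l : ℕ} (hkl : k ≤ l) : HasPoleLE D l α x := by
  obtain ⟨W, g, hg, hxW, hα⟩ := h
  exact ⟨W, g, hg, hxW, hα.mono (hg.holo x hxW) hkl⟩

lemma HasPoleLE.const_smul (h : HasPoleLE D k α x) (c : ℂ) :
    HasPoleLE D k (fun y => c • α y) x := by
  obtain ⟨W, g, hg, hxW, hα⟩ := h
  exact ⟨W, g, hg, hxW, hα.const_smul c⟩

lemma HasPoleLE.add (h : HasPoleLE D k α x) (h' : HasPoleLE D k β x) :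
    HasPoleLE D k (fun y => α y + β y) x := by
  obtain ⟨W, g, hg, hxW, hα⟩ := h
  exact ⟨W, g, hg, hxW, hα.add (h'.poleLE hg hxW)⟩

lemma HasPoleLE.del (h : HasPoleLE D k α x)
    (hs : ∀ᶠ y in 𝓝 x, y ∉ D.carrier → SmoothFormAt α y) :
    HasPoleLE D k (DolbeaultLog.del α) x := by
  obtain ⟨W, g, hg, hxW, hα⟩ := h
  exact ⟨W, g, hg, hxW, hα.del (hg.holo x hxW) hs⟩

lemma HasPoleLE.of_eventually_zero {V : Set X} {f : X → ℂ} (hf : IsLocalEquation D V f)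
    (hx : x ∈ V) (h : ∀ᶠ y in 𝓝 x, α y = 0) : HasPoleLE D k α x := by
  refine ⟨V, f, hf, hx, (PoleLE.of_smooth (hf.holo x hx)
    (Eventually.of_forall smoothFormAt_zero)).congr ?_⟩
  filter_upwards [h] with y hy _ using hy.symm

/-! ### Euler fields acting on sections -/

/-- The Euler field itself. -/
noncomputable def EulerField.field (e : EulerField D) (y : X) : E := e.f y • e.u y

lemma EulerField.field_smooth (e : EulerField D) (y : X) : SmoothFieldAt e.field y := by
  by_cases hy : y ∈ e.K
  · exact (e.smooth y).smul (e.eqn.holo y (e.subset hy))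
  · refine (smoothFieldAt_zero y).congr ?_
    filter_upwards [e.isClosed.isOpen_compl.mem_nhds hy] with z hz
    rw [EulerField.field, e.zero z hz, smul_zero]

lemma HasPoleLE.contract (e : EulerField D) {α : X → E [⋀^Fin (p + 1)]→L[ℂ] ℂ}
    (h : HasPoleLE D k α x) : HasPoleLE D k (DolbeaultLog.contract e.field α) x := by
  by_cases hx : x ∈ e.V
  · exact ⟨e.V, e.f, e.eqn, hx, (h.poleLE e.eqn hx).contract (e.eqn.holo x hx)
      (Eventually.of_forall e.smooth)⟩
  · obtain ⟨W, g, hg, hxW, -⟩ := h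
    refine .of_eventually_zero hg hxW ?_
    filter_upwards [e.isClosed.isOpen_compl.mem_nhds fun h => hx (e.subset h)] with y hy
    rw [DolbeaultLog.contract, EulerField.field, e.zero y hy, smul_zero, map_zero]

/-- The contraction of a form on `U ∖ D` with a vector field on `X`. -/
noncomputable def FormOff.contract (W : X → E) (α : FormOff D (p + 1) U) : FormOff D p U :=
  fun x => (α x).curryLeft (W x)

lemma FormOff.ext0_contract (W : X → E) (α : FormOff D (p + 1) U) :
    (α.contract W).ext0 = DolbeaultLog.contract W α.ext0 := by
  funext x
  by_cases hx : x ∈ (U : Set X) \ D.carrier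
  · rw [ext0_apply _ hx, DolbeaultLog.contract, ext0_apply _ hx]; rfl
  · rw [ext0_of_notMem _ hx, DolbeaultLog.contract, ext0_of_notMem _ hx]; rfl

lemma FormOff.IsSmooth.contract {W : X → E} (hW : ∀ y, SmoothFieldAt W y)
    {α : FormOff D (p + 1) U} (hα : α.IsSmooth) : (α.contract W).IsSmooth := fun x hx => by
  rw [FormOff.ext0_contract]
  exact (hα x hx).contract (hW x)

lemma FormOff.support_contract (W : X → E) (α : FormOff D (p + 1) U) :
    Function.support (α.contract W).ext0 ⊆ Function.support α.ext0 := by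
  refine Function.support_subset_iff'.2 fun x hx => ?_
  rw [FormOff.ext0_contract, DolbeaultLog.contract, Function.notMem_support.1 hx]
  rfl

lemma FormOff.support_smul (c : ℂ) (α : FormOff D p U) :
    Function.support (c • α).ext0 ⊆ Function.support α.ext0 := by
  refine Function.support_subset_iff'.2 fun x hx => ?_
  rw [FormOff.ext0_smul]
  beta_reduce
  rw [Function.notMem_support.1 hx, smul_zero_form]

lemma FormOff.support_add {S : Set X} {α β : FormOff D p U} (hα : Function.support α.ext0 ⊆ S)
    (hβ : Function.support β.ext0 ⊆ S) : Function.support (α + β).ext0 ⊆ S := by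
  rw [FormOff.ext0_add]
  exact (Function.support_add _ _).trans (union_subset hα hβ)

lemma FormOff.support_del {S : Set X} (hS : IsClosed S) {α : FormOff D p U}
    (hα : Function.support α.ext0 ⊆ S) : Function.support α.del.ext0 ⊆ S := by
  refine Function.support_subset_iff'.2 fun x hx => ?_
  by_cases hxU : x ∈ (U : Set X) \ D.carrier
  · rw [FormOff.ext0_apply _ hxU]
    have h0 : α.ext0 =ᶠ[𝓝 x] fun _ => (0 : ℂ) • (0 : E [⋀^Fin p]→L[ℂ] ℂ) := by
      filter_upwards [hS.isOpen_compl.mem_nhds hx] with y hy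
      rw [smul_zero_form]
      exact Function.notMem_support.1 fun h => hy (hα h)
    refine (del_congr h0).trans ?_
    rw [DolbeaultLog.del_const_smul 0 (smoothFormAt_zero (E := E) (p := p) x), zero_smul_form]
  · exact FormOff.ext0_of_notMem _ hxU

variable [FiniteDimensional ℂ E]

lemma FormOff.del_zero : (0 : FormOff D p U).del = 0 :=
  congrArg Subtype.val (((polar D).delLin p U).map_zero)

lemma mem_logarithmic_iff {α : FormOff D p U} : α ∈ (logarithmic D).sec p U ↔
    α.IsSmooth ∧ ∀ x ∈ (U : Set X) ∩ D.carrier, HasPoleLE D 0 α.ext0 x := by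
  have := FiniteDimensional.complete ℂ E
  constructor
  · rintro ⟨hs, hα⟩
    refine ⟨hs, fun x hx => ?_⟩
    obtain ⟨V, hVU, hxV, f, hf⟩ := exists_localEquation D hx.2 U.isOpen hx.1
    obtain ⟨h1, h2⟩ := hα V hVU f hf x hxV
    refine ⟨V, f, hf, hxV, ?_, ?_⟩
    · simpa only [zero_add, pow_one] using h1
    · simpa only [pow_zero, one_smul] using h2
  · rintro ⟨hs, hα⟩
    refine ⟨hs, fun V hVU f hf x hxV => ?_⟩
    by_cases hx : x ∈ D.carrier
    · obtain ⟨h1, h2⟩ := (hα x ⟨hVU hxV, hx⟩).poleLE hf hxV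
      exact ⟨by simpa only [zero_add, pow_one] using h1,
        by simpa only [pow_zero, one_smul] using h2⟩
    · have h : ExtendsSmoothlyAt D α.ext0 x := .of_smooth (hs.eventually ⟨hVU hxV, hx⟩)
      exact ⟨h.smul (hf.holo x hxV), h.dWedge (hf.holo x hxV)⟩

lemma mem_polar_iff {α : FormOff D p U} : α ∈ (polar D).sec p U ↔
    α.IsSmooth ∧ ∀ x ∈ (U : Set X) ∩ D.carrier, ∃ k, HasPoleLE D k α.ext0 x := by
  constructor
  · rintro ⟨hs, hα⟩
    refine ⟨hs, fun x hx => ?_⟩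
    obtain ⟨V, -, hxV, f, hf, m, hm⟩ := hα x hx
    exact ⟨m, V, f, hf, hxV, .of_extends (hf.holo x hxV) (hm x hxV)⟩
  · rintro ⟨hs, hα⟩
    refine ⟨hs, fun x hx => ?_⟩
    obtain ⟨k, V, f, hf, hxV, h, -⟩ := hα x hx
    obtain ⟨T, hT, hTo, hxT⟩ := eventually_nhds_iff.1
      ((h.eventually.and (hf.isOpen.mem_nhds hxV)).and (U.isOpen.mem_nhds hx.1))
    exact ⟨T, fun y hy => (hT y hy).2, hxT, f, hf.mono hTo fun y hy => (hT y hy).1.2, k + 1,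
      fun y hy => (hT y hy).1.1⟩

/-! ### Lowering the order of the pole of a section -/

lemma contract_mem_polar (e : EulerField D) {α : FormOff D (p + 1) U}
    (hα : α ∈ (polar D).sec (p + 1) U) : α.contract e.field ∈ (polar D).sec p U := by
  rw [mem_polar_iff] at hα ⊢
  refine ⟨hα.1.contract e.field_smooth, fun x hx => ?_⟩
  obtain ⟨k, hk⟩ := hα.2 x hx
  exact ⟨k, by rw [FormOff.ext0_contract]; exact hk.contract e⟩

lemma FormOff.ext0_add_del_smul_contract (e : EulerField D) (c : ℂ) {α : FormOff D (p + 1) U}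
    (hα : α.IsSmooth) (hx : x ∈ U) : ∀ᶠ y in 𝓝 x, y ∉ D.carrier →
      α.ext0 y + c • DolbeaultLog.del (DolbeaultLog.contract e.field α.ext0) y
        = (α + (c • α.contract e.field).del).ext0 y := by
  filter_upwards [FormOff.ext0_del_eventuallyEq (c • α.contract e.field) hx,
    U.isOpen.mem_nhds hx] with y hy hyU hyD
  rw [FormOff.ext0_add]
  beta_reduce
  rw [hy hyD, FormOff.ext0_smul, FormOff.ext0_contract,
    DolbeaultLog.del_const_smul _ ((hα y ⟨hyU, hyD⟩).contract (e.field_smooth y))]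

lemma hasPoleLE_add_del_contract (e : EulerField D) (c : ℂ) {α : FormOff D (p + 1) U}
    (hα : α.IsSmooth) (hx : x ∈ U) (h : HasPoleLE D k α.ext0 x) :
    HasPoleLE D k (α + (c • α.contract e.field).del).ext0 x := by
  refine (h.add (((h.contract e).del ?_).const_smul c)).congr
    (FormOff.ext0_add_del_smul_contract e c hα hx)
  filter_upwards [hα.eventually' hx] with y hy hyD
  exact (hy hyD).contract (e.field_smooth y)

/-- The pole of a form `α` with `∂α` logarithmic is lowered, on the set where the Euler field is
normalized, by adding a suitable multiple of `∂ ι α`. -/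
lemma hasPoleLE_lowering (e : EulerField D) {α : FormOff D (p + 1) U} (hα : α.IsSmooth)
    (hdα : α.del ∈ (logarithmic D).sec (p + 2) U) (hxU : x ∈ U) (hxD : x ∈ D.carrier)
    (hx : x ∈ e.N) (h : HasPoleLE D (k + 1) α.ext0 x) :
    HasPoleLE D k (α + ((k + 1 : ℂ)⁻¹ • α.contract e.field).del).ext0 x := by
  have hxV := e.subset' hx
  have hd : PoleLE D e.f 0 (DolbeaultLog.del α.ext0) x :=
    (((mem_logarithmic_iff.1 hdα).2 x ⟨hxU, hxD⟩).poleLE e.eqn hxV).congr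
      (α.ext0_del_eventuallyEq hxU)
  have h1 := (h.poleLE e.eqn hxV).lowering (e.eqn.holo x hxV) (Eventually.of_forall e.smooth)
    (by filter_upwards [e.isOpen.mem_nhds hx] with y hy using e.one y hy)
    (hα.eventually' hxU) hd
  refine ⟨e.V, e.f, e.eqn, hxV, (h1.const_smul (k + 1 : ℂ)⁻¹).congr ?_⟩
  filter_upwards [FormOff.ext0_add_del_smul_contract e (k + 1 : ℂ)⁻¹ hα hxU] with y hy hyD
  have hk : (k + 1 : ℂ) ≠ 0 := by exact_mod_cast k.succ_ne_zero
  rw [← hy hyD, smul_add, smul_smul, inv_mul_cancel₀ hk, one_smul]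
  rfl

/-- One unit of the order of the pole is removed on the union of finitely many sets on which Euler
fields are normalized, one after the other: the order of the pole does not increase on the way. -/
lemma exists_hasPoleLE_add_del {S : Set X} (hS : IsClosed S) (k : ℕ) (l : List (EulerField D))
    {α : FormOff D (p + 1) U} (hα : α ∈ (polar D).sec (p + 1) U)
    (hdα : α.del ∈ (logarithmic D).sec (p + 2) U) (hαS : Function.support α.ext0 ⊆ S)
    (h : ∀ x ∈ (U : Set X) ∩ D.carrier, HasPoleLE D (k + 1) α.ext0 x) :
    ∃ γ ∈ (polar D).sec p U, Function.support γ.ext0 ⊆ S ∧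
      ∀ x ∈ (U : Set X) ∩ D.carrier, HasPoleLE D (k + 1) (α + γ.del).ext0 x ∧
        ((HasPoleLE D k α.ext0 x ∨ ∃ e ∈ l, x ∈ e.N) → HasPoleLE D k (α + γ.del).ext0 x) := by
  induction l generalizing α with
  | nil =>
    refine ⟨0, zero_mem _, by rw [FormOff.ext0_zero]; simp, fun x hx => ?_⟩
    rw [FormOff.del_zero, add_zero]
    exact ⟨h x hx, by simp⟩
  | cons e l ih =>
    set γ₁ : FormOff D p U := (k + 1 : ℂ)⁻¹ • α.contract e.field with hγ₁
    have hs : α.IsSmooth := (polar D).smooth hα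
    have hγ₁m : γ₁ ∈ (polar D).sec p U := Submodule.smul_mem _ _ (contract_mem_polar e hα)
    have hγ₁s := (polar D).smooth hγ₁m
    have hγ₁S : Function.support γ₁.ext0 ⊆ S :=
      ((FormOff.support_smul _ _).trans (FormOff.support_contract _ _)).trans hαS
    have hd : (α + γ₁.del).del = α.del := by
      rw [FormOff.del_add hs hγ₁s.del, FormOff.del_del hγ₁s, add_zero]
    obtain ⟨γ₂, hγ₂m, hγ₂S, hγ₂⟩ := ih (α := α + γ₁.del)
      (add_mem hα ((polar D).del_mem hγ₁m)) (by rwa [hd])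
      (FormOff.support_add hαS (FormOff.support_del hS hγ₁S))
      (fun x hx => hasPoleLE_add_del_contract e _ hs hx.1 (h x hx))
    refine ⟨γ₁ + γ₂, add_mem hγ₁m hγ₂m, FormOff.support_add hγ₁S hγ₂S, fun x hx => ?_⟩
    rw [FormOff.del_add hγ₁s ((polar D).smooth hγ₂m), ← add_assoc]
    refine ⟨(hγ₂ x hx).1, fun hor => (hγ₂ x hx).2 ?_⟩
    rcases hor with h1 | ⟨e', he', hxe⟩
    · exact .inl (hasPoleLE_add_del_contract e _ hs hx.1 h1)
    · rcases List.mem_cons.1 he' with rfl | hel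
      · exact .inl (hasPoleLE_lowering e' hs hdα hx.1 hx.2 hxe (h x hx))
      · exact .inr ⟨e', hel, hxe⟩

/-- A form with poles of bounded order whose `∂` is logarithmic is logarithmic up to an exact form.
The primitive may be chosen with support in any closed set which contains the support of the
form. -/
lemma exists_add_del_mem_logarithmic {S : Set X} (hS : IsClosed S) (l : List (EulerField D))
    (hl : ∀ x ∈ (U : Set X) ∩ D.carrier, x ∈ S → ∃ e ∈ l, x ∈ e.N) (k : ℕ)
    {α : FormOff D (p + 1) U} (hα : α ∈ (polar D).sec (p + 1) U)
    (hdα : α.del ∈ (logarithmic D).sec (p + 2) U) (hαS : Function.support α.ext0 ⊆ S)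
    (h : ∀ x ∈ (U : Set X) ∩ D.carrier, HasPoleLE D k α.ext0 x) :
    ∃ γ ∈ (polar D).sec p U, Function.support γ.ext0 ⊆ S ∧
      α + γ.del ∈ (logarithmic D).sec (p + 1) U := by
  induction k generalizing α with
  | zero =>
    refine ⟨0, zero_mem _, by rw [FormOff.ext0_zero]; simp, ?_⟩
    rw [FormOff.del_zero, add_zero, mem_logarithmic_iff]
    exact ⟨(polar D).smooth hα, h⟩
  | succ k ih =>
    obtain ⟨γ₁, hγ₁m, hγ₁S, hγ₁⟩ := exists_hasPoleLE_add_del hS k l hα hdα hαS h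
    have hγ₁s := (polar D).smooth hγ₁m
    have hd : (α + γ₁.del).del = α.del := by
      rw [FormOff.del_add ((polar D).smooth hα) hγ₁s.del, FormOff.del_del hγ₁s, add_zero]
    obtain ⟨γ₂, hγ₂m, hγ₂S, hγ₂⟩ := ih (α := α + γ₁.del)
      (add_mem hα ((polar D).del_mem hγ₁m)) (by rwa [hd])
      (FormOff.support_add hαS (FormOff.support_del hS hγ₁S)) (fun x hx => by
        refine (hγ₁ x hx).2 ?_
        by_cases hxS : x ∈ S
        · exact .inr (hl x hx hxS)
        · obtain ⟨V, f, hf, hxV, -⟩ := h x hx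
          refine .inl (.of_eventually_zero hf hxV ?_)
          filter_upwards [hS.isOpen_compl.mem_nhds hxS] with y hy
          exact Function.notMem_support.1 fun h => hy (hαS h))
    refine ⟨γ₁ + γ₂, add_mem hγ₁m hγ₂m, FormOff.support_add hγ₁S hγ₂S, ?_⟩
    rwa [FormOff.del_add hγ₁s ((polar D).smooth hγ₂m), ← add_assoc]

variable [T2Space X]

/-- In degree `0` the poles of a function are controlled by those of its differential, without any
correction. -/
lemma mem_logarithmic_of_del {α : FormOff D 0 U} (hα : α ∈ (polar D).sec 0 U)
    (hdα : α.del ∈ (logarithmic D).sec 1 U) : α ∈ (logarithmic D).sec 0 U := by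
  refine mem_logarithmic_iff.2 ⟨(polar D).smooth hα, fun x hx => ?_⟩
  obtain ⟨e, he⟩ := exists_eulerField hx.2
  have hxV := e.subset' he
  have hd : PoleLE D e.f 0 (DolbeaultLog.del α.ext0) x :=
    (((mem_logarithmic_iff.1 hdα).2 x hx).poleLE e.eqn hxV).congr
      (α.ext0_del_eventuallyEq hx.1)
  obtain ⟨k, hk⟩ := (mem_polar_iff.1 hα).2 x hx
  induction k with
  | zero => exact hk
  | succ k ih =>
    refine ih ⟨e.V, e.f, e.eqn, hxV, (hk.poleLE e.eqn hxV).lowering_zero (e.eqn.holo x hxV)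
      (Eventually.of_forall e.smooth)
      (by filter_upwards [e.isOpen.mem_nhds he] with y hy using e.one y hy)
      (((polar D).smooth hα).eventually' hx.1) hd⟩

/-- Near `x` a single Euler field and a single bound for the order of the pole suffice; off `D` there
is no pole, and no Euler field is needed. -/
lemma exists_local_primitive {α : FormOff D (p + 1) U} (hα : α ∈ (polar D).sec (p + 1) U)
    (hdα : α.del ∈ (logarithmic D).sec (p + 2) U) (hx : x ∈ U) :
    ∃ (V : Opens X) (h : V ≤ U), x ∈ V ∧ ∃ γ ∈ (polar D).sec p V,
      α.restrict h + γ.del ∈ (logarithmic D).sec (p + 1) V := by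
  by_cases hxD : x ∈ D.carrier
  · obtain ⟨e, he⟩ := exists_eulerField hxD
    obtain ⟨k, hk⟩ := (mem_polar_iff.1 hα).2 x ⟨hx, hxD⟩
    obtain ⟨T, hT, hTo, hxT⟩ := eventually_nhds_iff.1
      ((hk.eventually.and (e.isOpen.mem_nhds he)).and (U.isOpen.mem_nhds hx))
    have hTU : (⟨T, hTo⟩ : Opens X) ≤ U := fun y hy => (hT y hy).2
    obtain ⟨γ, h1, -, h2⟩ := exists_add_del_mem_logarithmic isClosed_univ [e]
      (fun y hy _ => ⟨e, by simp, (hT y hy.1).1.2⟩) k ((polar D).restrict_mem hTU hα)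
      (by rw [FormOff.restrict_del]; exact (logarithmic D).restrict_mem hTU hdα)
      (subset_univ _) (fun y hy => (hT y hy.1).1.1.congr (by
        filter_upwards [FormOff.ext0_restrict_eventuallyEq hTU α hy.1] with z hz _ using hz.symm))
    exact ⟨_, hTU, hxT, γ, h1, h2⟩
  · let V : Opens X := ⟨(U : Set X) \ D.carrier, U.isOpen.sdiff D.isClosed⟩
    have hVU : V ≤ U := fun y hy => hy.1
    obtain ⟨γ, h1, -, h2⟩ := exists_add_del_mem_logarithmic isClosed_univ []
      (fun y (hy : y ∈ (V : Set X) ∩ D.carrier) _ => (hy.1.2 hy.2).elim) 0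
      ((polar D).restrict_mem hVU hα)
      (by rw [FormOff.restrict_del]; exact (logarithmic D).restrict_mem hVU hdα)
      (subset_univ _) (fun y hy => (hy.1.2 hy.2).elim)
    exact ⟨V, hVU, ⟨hx, hxD⟩, γ, h1, h2⟩

lemma exists_compact_primitive {α : FormOff D (p + 1) U}
    (hα : α ∈ (polar D).compactSec (p + 1) U)
    (hdα : α.del ∈ (logarithmic D).sec (p + 2) U) :
    ∃ γ ∈ (polar D).compactSec p U, α + γ.del ∈ (logarithmic D).compactSec (p + 1) U := by
  obtain ⟨hαm, hαc, hαU⟩ := hα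
  have hcomp : IsCompact (tsupport α.ext0 ∩ D.carrier) :=
    IsCompact.inter_right hαc D.isClosed
  -- finitely many Euler fields and one bound for the order of the pole suffice
  have hloc : ∀ x : ↥(tsupport α.ext0 ∩ D.carrier), ∃ (e : EulerField D) (k : ℕ) (T : Set X),
      IsOpen T ∧ x.1 ∈ T ∧ T ⊆ e.N ∧ ∀ y ∈ T, HasPoleLE D k α.ext0 y := by
    rintro ⟨x, hx, hxD⟩
    obtain ⟨e, he⟩ := exists_eulerField hxD
    obtain ⟨k, hk⟩ := (mem_polar_iff.1 hαm).2 x ⟨hαU hx, hxD⟩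
    obtain ⟨T, hT, hTo, hxT⟩ := eventually_nhds_iff.1
      (hk.eventually.and (e.isOpen.mem_nhds he))
    exact ⟨e, k, T, hTo, hxT, fun y hy => (hT y hy).2, fun y hy => (hT y hy).1⟩
  choose e k T hTo hxT hTN hTk using hloc
  obtain ⟨t, ht⟩ := hcomp.elim_finite_subcover T hTo fun x hx => mem_iUnion.2 ⟨⟨x, hx⟩, hxT _⟩
  have hcov : ∀ x ∈ tsupport α.ext0 ∩ D.carrier, ∃ i ∈ t, x ∈ T i := fun x hx => by
    simpa using ht hx
  have hpole : ∀ x ∈ (U : Set X) ∩ D.carrier, HasPoleLE D (t.sup k) α.ext0 x := by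
    intro x hx
    by_cases hxS : x ∈ tsupport α.ext0
    · obtain ⟨i, hi, hxi⟩ := hcov x ⟨hxS, hx.2⟩
      exact (hTk i x hxi).mono (Finset.le_sup hi)
    · obtain ⟨_, V, f, hf, hxV, -⟩ := (mem_polar_iff.1 hαm).2 x hx
      exact .of_eventually_zero hf hxV (notMem_tsupport_iff_eventuallyEq.1 hxS)
  obtain ⟨γ, h1, h2, h3⟩ := exists_add_del_mem_logarithmic (isClosed_tsupport α.ext0)
    (t.toList.map e) (fun x hx hxS => by
      obtain ⟨i, hi, hxi⟩ := hcov x ⟨hxS, hx.2⟩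
      exact ⟨e i, List.mem_map.2 ⟨i, Finset.mem_toList.2 hi, rfl⟩, hTN i hxi⟩) _ hαm hdα
    (subset_tsupport _) hpole
  have h4 := FormOff.support_add (subset_tsupport α.ext0)
    (FormOff.support_del (isClosed_tsupport _) h2)
  exact ⟨γ, ⟨h1, hαc.mono' h2, (closure_minimal h2 (isClosed_tsupport _)).trans hαU⟩,
    h3, hαc.mono' h4, (closure_minimal h4 (isClosed_tsupport _)).trans hαU⟩

end Reduction

open CategoryTheory CategoryTheory.Limits Opposite

/-! ### A criterion for quasi-isomorphisms -/

section Homological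

variable {C : Type*} [Category C] [Abelian C] {K L : CochainComplex C ℕ} (φ : K ⟶ L)

/-- The map from `Kᵖ⁺¹ ⊕ Lᵖ` to the object of pairs `(y, x)` with `y ∈ Lᵖ⁺¹`, `x ∈ Kᵖ⁺²` and
`d y = φ x`, which sends `(s, t)` to `(φ s + d t, d s)`. -/
noncomputable def relMap (p : ℕ) :
    K.X (p + 1) ⊞ L.X p ⟶ pullback (L.d (p + 1) (p + 2)) (φ.f (p + 2)) :=
  pullback.lift (biprod.desc (φ.f (p + 1)) (L.d p (p + 1))) (biprod.desc (K.d (p + 1) (p + 2)) 0)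
    (by ext <;> simp)

/-- The map from `K⁰` to the object of pairs `(y, x)` with `y ∈ L⁰`, `x ∈ K¹` and `d y = φ x`. -/
noncomputable def relMapZero : K.X 0 ⟶ pullback (L.d 0 1) (φ.f 1) :=
  pullback.lift (φ.f 0) (K.d 0 1) (by simp)

variable {φ}

/-- If `relMap φ p` is an epimorphism, then after refinement any `y` whose differential comes from
`K` is the sum of an element of `K` and a coboundary. -/
lemma exists_refinement {p : ℕ} (h : Epi (relMap φ p)) {A : C} (y : A ⟶ L.X (p + 1))
    (x : A ⟶ K.X (p + 2)) (hxy : y ≫ L.d (p + 1) (p + 2) = x ≫ φ.f (p + 2)) :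
    ∃ (A' : C) (π : A' ⟶ A) (_ : Epi π) (s : A' ⟶ K.X (p + 1)) (t : A' ⟶ L.X p),
      π ≫ y = s ≫ φ.f (p + 1) + t ≫ L.d p (p + 1) := by
  refine ⟨pullback (pullback.lift y x hxy) (relMap φ p), pullback.fst _ _, inferInstance,
    pullback.snd _ _ ≫ biprod.fst, pullback.snd _ _ ≫ biprod.snd, ?_⟩
  have h1 := pullback.condition (f := pullback.lift y x hxy) (g := relMap φ p)
  have h2 := h1 =≫ pullback.fst _ _
  have h3 : relMap φ p ≫ pullback.fst _ _
      = biprod.fst ≫ φ.f (p + 1) + biprod.snd ≫ L.d p (p + 1) := by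
    rw [← biprod.desc_eq]
    exact pullback.lift_fst _ _ _
  rw [Category.assoc, Category.assoc, pullback.lift_fst, h3, Preadditive.comp_add] at h2
  simpa only [Category.assoc] using h2

lemma exists_refinement_zero (h : Epi (relMapZero φ)) {A : C} (y : A ⟶ L.X 0)
    (x : A ⟶ K.X 1) (hxy : y ≫ L.d 0 1 = x ≫ φ.f 1) :
    ∃ (A' : C) (π : A' ⟶ A) (_ : Epi π) (s : A' ⟶ K.X 0), π ≫ y = s ≫ φ.f 0 := by
  refine ⟨pullback (pullback.lift y x hxy) (relMapZero φ), pullback.fst _ _, inferInstance,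
    pullback.snd _ _, ?_⟩
  have h1 := pullback.condition (f := pullback.lift y x hxy) (g := relMapZero φ)
  have h2 := h1 =≫ pullback.fst _ _
  rwa [Category.assoc, Category.assoc, pullback.lift_fst, relMapZero, pullback.lift_fst] at h2

variable (φ) in
lemma quasiIsoAt_of_refinements {i j k : ℕ} (hi : (ComplexShape.up ℕ).prev j = i)
    (hk : (ComplexShape.up ℕ).next j = k)
    (hm : ∀ ⦃A : C⦄ (x : A ⟶ K.X j) (y : A ⟶ L.X i), x ≫ φ.f j = y ≫ L.d i j →
      ∃ (A' : C) (π : A' ⟶ A) (_ : Epi π) (s : A' ⟶ K.X i), π ≫ x = s ≫ K.d i j)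
    (he : ∀ ⦃A : C⦄ (y : A ⟶ L.X j), y ≫ L.d j k = 0 →
      ∃ (A' : C) (π : A' ⟶ A) (_ : Epi π) (s : A' ⟶ K.X j) (_ : s ≫ K.d j k = 0)
        (t : A' ⟶ L.X i), π ≫ y = s ≫ φ.f j + t ≫ L.d i j) : QuasiIsoAt φ j := by
  rw [quasiIsoAt_iff' φ i j k hi hk, ShortComplex.quasiIso_iff]
  have hm' := (ShortComplex.mono_homologyMap_iff_up_to_refinements
    ((HomologicalComplex.shortComplexFunctor' C (ComplexShape.up ℕ) i j k).map φ)).2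
    fun A x _ y hxy => hm x y hxy
  have he' := (ShortComplex.epi_homologyMap_iff_up_to_refinements
    ((HomologicalComplex.shortComplexFunctor' C (ComplexShape.up ℕ) i j k).map φ)).2 he
  exact isIso_of_mono_of_epi _

/-- A monomorphism of complexes is a quasi-isomorphism if its cokernel is acyclic. The acyclicity is
phrased without the cokernel: every pair `(y, x)` with `d y = φ x` is of the form
`(φ s + d t, d s)`. -/
theorem quasiIso_of_epi_relMap [∀ p, Mono (φ.f p)] (h0 : Epi (relMapZero φ))
    (h : ∀ p, Epi (relMap φ p)) : QuasiIso φ := by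
  refine ⟨fun j => ?_⟩
  rcases j with _ | j
  · refine quasiIsoAt_of_refinements φ (i := 0) (k := 1) (by simp) (by simp) ?_ ?_
    · intro A x y hxy
      refine ⟨A, 𝟙 A, inferInstance, 0, ?_⟩
      rw [L.shape 0 0 (by simp), comp_zero] at hxy
      rw [zero_comp, Category.id_comp]
      exact (cancel_mono (φ.f 0)).1 (by rw [hxy, zero_comp])
    · intro A y hy
      obtain ⟨A', π, hπ, s, hs⟩ := exists_refinement_zero h0 y 0 (hy.trans zero_comp.symm)
      refine ⟨A', π, hπ, s, ?_, 0, by rw [zero_comp, add_zero, hs]⟩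
      rw [← cancel_mono (φ.f 1), zero_comp, Category.assoc, ← φ.comm, ← Category.assoc, ← hs,
        Category.assoc, hy, comp_zero]
  · refine quasiIsoAt_of_refinements φ (i := j) (k := j + 2) (by simp) (by simp) ?_ ?_
    · intro A x y hxy
      have key : ∃ (A' : C) (π : A' ⟶ A) (_ : Epi π) (s : A' ⟶ K.X j),
          π ≫ y ≫ L.d j (j + 1) = s ≫ φ.f j ≫ L.d j (j + 1) := by
        rcases j with _ | j
        · obtain ⟨A', π, hπ, s, hs⟩ := exists_refinement_zero h0 y x hxy.symm
          refine ⟨A', π, hπ, s, ?_⟩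
          rw [← Category.assoc, hs, Category.assoc]
        · obtain ⟨A', π, hπ, s, t, hst⟩ := exists_refinement (h j) y x hxy.symm
          refine ⟨A', π, hπ, s, ?_⟩
          rw [← Category.assoc, hst, Preadditive.add_comp, Category.assoc, Category.assoc,
            L.d_comp_d, comp_zero, add_zero]
      obtain ⟨A', π, hπ, s, hs⟩ := key
      refine ⟨A', π, hπ, s, ?_⟩
      rw [← cancel_mono (φ.f (j + 1)), Category.assoc, Category.assoc, hxy, hs, φ.comm]
    · intro A y hy
      obtain ⟨A', π, hπ, s, t, hst⟩ := exists_refinement (h j) y 0 (hy.trans zero_comp.symm)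
      refine ⟨A', π, hπ, s, ?_, t, hst⟩
      have e := hst =≫ L.d (j + 1) (j + 2)
      rw [Preadditive.add_comp, Category.assoc, Category.assoc, Category.assoc, L.d_comp_d,
        comp_zero, add_zero, hy, comp_zero] at e
      rw [← cancel_mono (φ.f (j + 2)), zero_comp, Category.assoc, ← φ.comm, ← e]

end Homological

/-! ### The criterion for complexes of vector spaces and of sheaves -/

section Concrete

/-- `quasiIso_of_epi_relMap` for complexes of vector spaces. -/
lemma quasiIso_of_elements {K L : CochainComplex (ModuleCat.{0} ℂ) ℕ} (φ : K ⟶ L)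
    (hφ : ∀ p, Function.Injective (φ.f p))
    (h0 : ∀ (y : L.X 0) (x : K.X 1), L.d 0 1 y = φ.f 1 x → ∃ s, φ.f 0 s = y)
    (h : ∀ p (y : L.X (p + 1)) (x : K.X (p + 2)), L.d (p + 1) (p + 2) y = φ.f (p + 2) x →
      ∃ s t, φ.f (p + 1) s + L.d p (p + 1) t = y) : QuasiIso φ := by
  have hmono : ∀ p, Mono (φ.f p) := fun p => (ModuleCat.mono_iff_injective _).2 (hφ p)
  refine quasiIso_of_epi_relMap ?_ fun p => ?_
  · rw [ModuleCat.epi_iff_surjective]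
    intro e
    have hinj := (ModuleCat.mono_iff_injective (pullback.fst (L.d 0 1) (φ.f 1))).1 inferInstance
    obtain ⟨s, hs⟩ := h0 (pullback.fst (L.d 0 1) (φ.f 1) e) (pullback.snd (L.d 0 1) (φ.f 1) e)
      (ConcreteCategory.congr_hom (pullback.condition (f := L.d 0 1) (g := φ.f 1)) e)
    refine ⟨s, hinj ?_⟩
    have h1 : relMapZero φ ≫ pullback.fst _ _ = φ.f 0 := pullback.lift_fst _ _ _
    exact (ConcreteCategory.congr_hom h1 s).trans hs
  · rw [ModuleCat.epi_iff_surjective]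
    intro e
    have hinj := (ModuleCat.mono_iff_injective
      (pullback.fst (L.d (p + 1) (p + 2)) (φ.f (p + 2)))).1 inferInstance
    obtain ⟨s, t, hst⟩ := h p (pullback.fst (L.d (p + 1) (p + 2)) (φ.f (p + 2)) e)
      (pullback.snd (L.d (p + 1) (p + 2)) (φ.f (p + 2)) e)
      (ConcreteCategory.congr_hom (pullback.condition (f := L.d (p + 1) (p + 2))
        (g := φ.f (p + 2))) e)
    refine ⟨(biprod.inl : K.X (p + 1) ⟶ _) s + (biprod.inr : L.X p ⟶ _) t, hinj ?_⟩
    have h1 : biprod.inl ≫ relMap φ p ≫ pullback.fst _ _ = φ.f (p + 1) := by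
      rw [relMap, pullback.lift_fst, biprod.inl_desc]
    have h2 : biprod.inr ≫ relMap φ p ≫ pullback.fst _ _ = L.d p (p + 1) := by
      rw [relMap, pullback.lift_fst, biprod.inr_desc]
    rw [map_add, map_add, ← hst]
    exact congrArg₂ (· + ·) (ConcreteCategory.congr_hom h1 s) (ConcreteCategory.congr_hom h2 t)

variable {Y : TopCat.{0}}

lemma sheaf_mono_iff_injective {F G : TopCat.Sheaf (ModuleCat.{0} ℂ) Y} (f : F ⟶ G) :
    Mono f ↔ ∀ U : Opens Y, Function.Injective (f.hom.app (op U)) := by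
  refine (Sheaf.Hom.mono_iff_presheaf_mono (Opens.grothendieckTopology Y) (ModuleCat ℂ) f).trans
    ((NatTrans.mono_iff_mono_app _).trans ?_)
  exact ⟨fun h U => (ModuleCat.mono_iff_injective _).1 (h (op U)),
    fun h U => (ModuleCat.mono_iff_injective _).2 (h U.unop)⟩

lemma sheaf_epi_of_local {F G : TopCat.Sheaf (ModuleCat.{0} ℂ) Y} (f : F ⟶ G)
    (h : ∀ (U : Opens Y) (t : G.obj.obj (op U)), ∀ x ∈ U, ∃ (V : Opens Y) (i : V ⟶ U), x ∈ V ∧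
      ∃ s : F.obj.obj (op V), f.hom.app (op V) s = G.obj.map i.op t) : Epi f := by
  refine (TopCat.Sheaf.isLocallySurjective_iff_epi f).1
    ((TopCat.Presheaf.isLocallySurjective_iff _).2 fun U t x hx => ?_)
  obtain ⟨V, i, hxV, s, hs⟩ := h U t x hx
  exact ⟨V, leOfHom i, ⟨s, hs⟩, hxV⟩

/-- `quasiIso_of_epi_relMap` for sheaves of vector spaces on a topological space: above degree `0`
the decomposition is required only locally. -/
lemma quasiIso_of_sections {K L : CochainComplex (TopCat.Sheaf (ModuleCat.{0} ℂ) Y) ℕ} (φ : K ⟶ L)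
    (hφ : ∀ p (U : Opens Y), Function.Injective ((φ.f p).hom.app (op U)))
    (h0 : ∀ (U : Opens Y) (y : (L.X 0).obj.obj (op U)) (x : (K.X 1).obj.obj (op U)),
      (L.d 0 1).hom.app (op U) y = (φ.f 1).hom.app (op U) x → ∃ s, (φ.f 0).hom.app (op U) s = y)
    (h : ∀ p (U : Opens Y) (y : (L.X (p + 1)).obj.obj (op U)) (x : (K.X (p + 2)).obj.obj (op U)),
      (L.d (p + 1) (p + 2)).hom.app (op U) y = (φ.f (p + 2)).hom.app (op U) x →
      ∀ z ∈ U, ∃ (V : Opens Y) (i : V ⟶ U), z ∈ V ∧ ∃ s t,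
        (φ.f (p + 1)).hom.app (op V) s + (L.d p (p + 1)).hom.app (op V) t
          = (L.X (p + 1)).obj.map i.op y) : QuasiIso φ := by
  have hmono : ∀ p, Mono (φ.f p) := fun p => (sheaf_mono_iff_injective _).2 (hφ p)
  refine quasiIso_of_epi_relMap ?_ fun p => ?_
  · refine sheaf_epi_of_local _ fun U e z hz => ⟨U, 𝟙 U, hz, ?_⟩
    have hinj := (sheaf_mono_iff_injective (pullback.fst (L.d 0 1) (φ.f 1))).1 inferInstance U
    have hc := congrArg (fun q => q.hom.app (op U))
      (pullback.condition (f := L.d 0 1) (g := φ.f 1))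
    obtain ⟨s, hs⟩ := h0 U ((pullback.fst (L.d 0 1) (φ.f 1)).hom.app (op U) e)
      ((pullback.snd (L.d 0 1) (φ.f 1)).hom.app (op U) e) (ConcreteCategory.congr_hom hc e)
    have h1 : relMapZero φ ≫ pullback.fst _ _ = φ.f 0 := pullback.lift_fst _ _ _
    refine ⟨s, hinj ?_⟩
    rw [op_id, CategoryTheory.Functor.map_id]
    exact (ConcreteCategory.congr_hom (congrArg (fun q => q.hom.app (op U)) h1) s).trans hs
  · refine sheaf_epi_of_local _ fun U e z hz => ?_
    have hc := congrArg (fun q => q.hom.app (op U))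
      (pullback.condition (f := L.d (p + 1) (p + 2)) (g := φ.f (p + 2)))
    obtain ⟨V, i, hzV, s, t, hst⟩ := h p U
      ((pullback.fst (L.d (p + 1) (p + 2)) (φ.f (p + 2))).hom.app (op U) e)
      ((pullback.snd (L.d (p + 1) (p + 2)) (φ.f (p + 2))).hom.app (op U) e)
      (ConcreteCategory.congr_hom hc e) z hz
    have hinj := (sheaf_mono_iff_injective
      (pullback.fst (L.d (p + 1) (p + 2)) (φ.f (p + 2)))).1 inferInstance V
    have h1 : biprod.inl ≫ relMap φ p ≫ pullback.fst _ _ = φ.f (p + 1) := by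
      rw [relMap, pullback.lift_fst, biprod.inl_desc]
    have h2 : biprod.inr ≫ relMap φ p ≫ pullback.fst _ _ = L.d p (p + 1) := by
      rw [relMap, pullback.lift_fst, biprod.inr_desc]
    refine ⟨V, i, hzV, (biprod.inl : K.X (p + 1) ⟶ K.X (p + 1) ⊞ L.X p).hom.app (op V) s
      + (biprod.inr : L.X p ⟶ K.X (p + 1) ⊞ L.X p).hom.app (op V) t, hinj ?_⟩
    have hnat := ConcreteCategory.congr_hom
      ((pullback.fst (L.d (p + 1) (p + 2)) (φ.f (p + 2))).hom.naturality i.op) e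
    rw [map_add, map_add]
    refine Eq.trans ?_ (hst.trans hnat.symm)
    exact congrArg₂ (· + ·)
      (ConcreteCategory.congr_hom (congrArg (fun q => q.hom.app (op V)) h1) s)
      (ConcreteCategory.congr_hom (congrArg (fun q => q.hom.app (op V)) h2) t)

end Concrete

/-! ### The two quasi-isomorphisms -/

section Main

variable {E : Type} [NormedAddCommGroup E] [NormedSpace ℂ E] [FiniteDimensional ℂ E]
  {X : Type} [TopologicalSpace X] [T2Space X] [ChartedSpace E X] [IsManifold 𝓘(ℂ, E) ω X]

theorem quasiIso_logToPolarCompact (D : SmoothHypersurface E X) (U : Opens X) :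
    QuasiIso (logToPolarCompact D U) := by
  have hd : ∀ (p : ℕ) (a : (polar D).compactSec p U),
      ((polar D).compactComplex U).d p (p + 1) a = (polar D).compactDel p U a := by
    intro p a
    simp only [FormSubsheaf.compactComplex, CochainComplex.of_d]
    rfl
  refine quasiIso_of_elements _ (fun p a b h => ?_) (fun y x hyx => ?_) (fun p y x hyx => ?_)
  · exact Subtype.ext (congrArg (Subtype.val (p := fun α => α ∈ (polar D).compactSec p U)) h)
  · let y' : (polar D).compactSec 0 U := y
    let x' : (logarithmic D).compactSec 1 U := x
    have hy : y'.1.del = x'.1 :=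
      congrArg (Subtype.val (p := fun α => α ∈ (polar D).compactSec 1 U))
        ((hd 0 y').symm.trans hyx)
    exact ⟨(⟨y'.1, mem_logarithmic_of_del y'.2.1 (by rw [hy]; exact x'.2.1), y'.2.2⟩ :
      (logarithmic D).compactSec 0 U), rfl⟩
  · let y' : (polar D).compactSec (p + 1) U := y
    let x' : (logarithmic D).compactSec (p + 2) U := x
    have hy : y'.1.del = x'.1 :=
      congrArg (Subtype.val (p := fun α => α ∈ (polar D).compactSec (p + 2) U))
        ((hd (p + 1) y').symm.trans hyx)
    obtain ⟨γ, hγ, hs⟩ := exists_compact_primitive y'.2 (by rw [hy]; exact x'.2.1)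
    let γ' : (polar D).compactSec p U := ⟨γ, hγ⟩
    let s : (logarithmic D).compactSec (p + 1) U := ⟨_, hs⟩
    refine ⟨s, (-γ' : (polar D).compactSec p U), ?_⟩
    refine (congrArg (_ + ·) ((hd p (-γ')).trans (map_neg _ γ'))).trans ?_
    exact Subtype.ext (add_neg_cancel_right y'.1 γ.del)

theorem quasiIso_logToPolar (D : SmoothHypersurface E X) : QuasiIso (logToPolar D) := by
  have hd : ∀ (p : ℕ) (U : Opens X) (a : (polar D).sec p U),
      ((polar D).complex.d p (p + 1)).hom.app (op U) a = (polar D).delLin p U a := by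
    intro p U a
    simp only [FormSubsheaf.complex, CochainComplex.of_d]
    rfl
  refine quasiIso_of_sections _ (fun p U a b h => ?_) (fun U y x hyx => ?_)
    (fun p U y x hyx z hz => ?_)
  · exact Subtype.ext (congrArg (Subtype.val (p := fun α => α ∈ (polar D).sec p U)) h)
  · let y' : (polar D).sec 0 U := y
    let x' : (logarithmic D).sec 1 U := x
    have hy : y'.1.del = x'.1 :=
      congrArg (Subtype.val (p := fun α => α ∈ (polar D).sec 1 U)) ((hd 0 U y').symm.trans hyx)
    exact ⟨(⟨y'.1, mem_logarithmic_of_del y'.2 (by rw [hy]; exact x'.2)⟩ :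
      (logarithmic D).sec 0 U), rfl⟩
  · let y' : (polar D).sec (p + 1) U := y
    let x' : (logarithmic D).sec (p + 2) U := x
    have hy : y'.1.del = x'.1 :=
      congrArg (Subtype.val (p := fun α => α ∈ (polar D).sec (p + 2) U))
        ((hd (p + 1) U y').symm.trans hyx)
    obtain ⟨V, hVU, hzV, γ, hγ, hs⟩ := exists_local_primitive y'.2 (by rw [hy]; exact x'.2) hz
    let γ' : (polar D).sec p V := ⟨γ, hγ⟩
    let s : (logarithmic D).sec (p + 1) V := ⟨_, hs⟩
    refine ⟨V, homOfLE hVU, hzV, s, (-γ' : (polar D).sec p V), ?_⟩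
    refine (congrArg (_ + ·) ((hd p V (-γ')).trans (map_neg _ γ'))).trans ?_
    exact Subtype.ext (add_neg_cancel_right (y'.1.restrict hVU) γ.del)

end Main

end DolbeaultLog

theorem proposition2p1 {E : Type} [NormedAddCommGroup E] [NormedSpace ℂ E] [FiniteDimensional ℂ E]
    {X : Type} [TopologicalSpace X] [T2Space X] [SecondCountableTopology X] [ChartedSpace E X]
    [IsManifold 𝓘(ℂ, E) ω X] (D : DolbeaultLog.SmoothHypersurface E X) :
    QuasiIso (DolbeaultLog.logToPolar D) ∧
      ∀ U : TopologicalSpace.Opens X, QuasiIso (DolbeaultLog.logToPolarCompact D U) :=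
  ⟨DolbeaultLog.quasiIso_logToPolar D, DolbeaultLog.quasiIso_logToPolarCompact D⟩
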